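/- For each $j\ge 1$ let $(X_{j,i})_{i\ge 0}$ be a standard (mean $0$, variance $1$) stationary real Gaussian sequence with autocorrelation function $\rho_j(k)=\mathbb E(X_{j,0}X_{j,k})$, $k\ge 0$, and spectral density $f_j$, i.e. $f_j$ is non-negative and integrable on $(-\pi,\pi)$ and $$\rho_j(k)=\int_{-\pi}^{\pi}e^{\mathrm i\lambda k}f_j(\lambda)\,d\lambda\qquad(k\ge 0).$$ Assume that there is a non-increasing sequence $(u_j)_{j\ge1}$ with $u_j\to 0$ such that for all $j\ge1$ $$\sup_{\lambda\in(-\pi,\pi)}|f_j(\lambda)-g_\infty(\lambda)|\le u_j ,$$ where $g_\infty:\mathbb R\to\mathbb R$ is $2\pi$-periodic, bounded on $(-\pi,\pi)$ and continuous at $0$. Let $H_\ell$ be the $\ell$-th (probabilists') Hermite polynomial ($H_1(x)=x$, $H_2(x)=x^2-1$), let $h:\mathbb R\to\mathbb R$ be measurable and either bounded or a finite linear combination of Hermite polynomials, and put $c_\ell=\mathbb E[h(X)H_\ell(X)]$ with $X$ standard Gaussian. Assume that $h$ has Hermite rank $\tau\ge 1$, i.e. $\tau$ is the smallest $\ell\ge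 0$ with $c_\ell\ne 0$. Let $(n_j)_{j\ge 1}$ be a sequence of non-negative integers with $n_j\to\infty$. Then the series below converges, the limit below exists, the two are equal, and, with $\tilde\sigma^2$ their common value, $$\frac1{\sqrt{n_j}}\sum_{i=1}^{n_j}h(X_{j,i})\ \xrightarrow{\ d\ }\ \mathcal N(0,\tilde\sigma^2)\qquad (j\to\infty),$$ $$\tilde\sigma^2=\lim_{j\to\infty}\operatorname{Var}\Big(\frac1{\sqrt{n_j}}\sum_{i=1}^{n_j}h(X_{j,i})\Big)=2\pi\sum_{\ell\ge\tau}\frac{c_\ell^2}{\ell!}\,g_\infty^{\star\ell}(0),$$ where $g_\infty^{\star 1}=g_\infty$ and $g_\infty^{\star(\ell+1)}(\lambda)=\int_{-\pi}^{\pi}g_\infty(\lambda-\mu)\,g_\infty^{\star\ell}(\mu)\,d\mu$. If $\tilde\sigma^2=0$, $\mathcal N(0,0)$ is the unit mass at $0$. -/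

import Mathlib

open MeasureTheory ProbabilityTheory Filter Topology
open scoped NNReal

namespace GaussianArray

/-- A standard stationary Gaussian process indexed by `ℕ`: all finite-dimensional laws are
Gaussian, every marginal is centred with variance one, and all time shifts of the process have
the same law. -/
structure IsStandardStationaryGaussian {Ω : Type*} [MeasurableSpace Ω]
    (P : Measure Ω) (X : ℕ → Ω → ℝ) : Prop where
  gaussian : IsGaussianProcess X P
  mean_zero : ∀ i, ∫ ω, X i ω ∂P = 0
  variance_one : ∀ i, variance (X i) P = 1
  stationary : ∀ m : ℕ,
    IdentDistrib (fun ω (i : ℕ) => X (i + m) ω) (fun ω (i : ℕ) => X i ω) P P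

/-- The autocorrelation function `ρ(k) = E[X₀ Xₖ]`, `k ≥ 0`, of a standard stationary process. -/
noncomputable def autocorr {Ω : Type*} [MeasurableSpace Ω]
    (P : Measure Ω) (X : ℕ → Ω → ℝ) (k : ℕ) : ℝ :=
  ∫ ω, X 0 ω * X k ω ∂P

/-- `f` is a spectral density for `ρ`: it is non-negative and integrable on `(-π, π)`, and
`ρ(k) = ∫_{-π}^{π} e^{i λ k} f(λ) dλ` for all `k ≥ 0`. Only the values of `f` on `(-π, π)`
matter. -/
structure IsSpectralDensity (ρ : ℕ → ℝ) (f : ℝ → ℝ) : Prop where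
  nonneg : ∀ x ∈ Set.Ioo (-Real.pi) Real.pi, 0 ≤ f x
  integrable : IntervalIntegrable f volume (-Real.pi) Real.pi
  fourier : ∀ k : ℕ, (ρ k : ℂ) =
    ∫ x in (-Real.pi)..Real.pi, Complex.exp (Complex.I * (x : ℂ) * (k : ℂ)) * (f x : ℂ)

/-- The self-convolutions of a `2π`-periodic function: `g^{⋆1} = g` and
`g^{⋆(ℓ+1)}(x) = ∫_{-π}^{π} g(x - y) g^{⋆ℓ}(y) dy`. The entry at `0` is a placeholder (there is
no function `g^{⋆0}`). -/
noncomputable def selfConv (g : ℝ → ℝ) : ℕ → ℝ → ℝ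
  | 0 => 0
  | 1 => g
  | (l + 2) => fun x => ∫ y in (-Real.pi)..Real.pi, g (x - y) * selfConv g (l + 1) y

/-- The `ℓ`-th (probabilists') Hermite polynomial as a real function: `H₀ = 1`, `H₁(x) = x`,
`H₂(x) = x² - 1`, and so on. -/
noncomputable def hermiteFun (l : ℕ) (x : ℝ) : ℝ :=
  Polynomial.aeval x (Polynomial.hermite l)

/-- The Hermite coefficient `c_ℓ = E[h(X) H_ℓ(X)]` with `X` standard Gaussian. -/
noncomputable def hermiteCoeff (h : ℝ → ℝ) (l : ℕ) : ℝ :=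
  ∫ x, h x * hermiteFun l x ∂(gaussianReal 0 1)

/-- `h` has Hermite rank `τ`: `τ` is the smallest `ℓ ≥ 0` with `c_ℓ ≠ 0`. -/
def HasHermiteRank (h : ℝ → ℝ) (τ : ℕ) : Prop :=
  IsLeast {l : ℕ | hermiteCoeff h l ≠ 0} τ

/-- `h` is a finite linear combination of Hermite polynomials. -/
def IsHermiteCombination (h : ℝ → ℝ) : Prop :=
  ∃ (s : Finset ℕ) (a : ℕ → ℝ), ∀ x, h x = ∑ l ∈ s, a l * hermiteFun l x

/-- The normalized sum `n^{-1/2} ∑_{i=1}^{n} h(X_i)`. -/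
noncomputable def normalizedSum {Ω : Type*} (h : ℝ → ℝ) (X : ℕ → Ω → ℝ) (n : ℕ) (ω : Ω) : ℝ :=
  (1 / Real.sqrt n) * ∑ i ∈ Finset.Icc 1 n, h (X i ω)

end GaussianArray

/-! Write `T_n(a) = n⁻¹ ∑_{i,m ≤ n} a(i - m)` (`toeplitzMean`), `R_j` for the even extension of the
autocorrelation `ρ_j` to `ℤ`, and `r` for the trigonometric moments of `g`. The hypotheses on `h`
put it in `L²(γ)`, `γ` the standard Gaussian law, with `c_0 = 0`.

Variance. Mehler's formula gives `Var F_j = ∑_l c_l²/l! · T_{n_j}(R_j^l)` for the normalized sum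
`F_j`. For `l = 1` the mean is the integral of `f_j` against the Fejér kernel; uniform closeness of
`f_j` to `g` and Fejér's theorem at `0` give the limit `2π g(0)`. For `l ≥ 2`, Parseval makes the
moments square summable, with `R_j` at `ℓ²` distance at most `2π u_j` from `r`. Hence
`T_{n_j}(R_j^l)` is close to `T_{n_j}(r^l)`, which tends to `∑_k r(k)^l = 2π g^{⋆l}(0)`
(`tendsto_toeplitzMean_pow`). The means with `l ≥ 1` are bounded uniformly in `j` and `l`, so `∑
c_l²/l! = ‖h‖² < ∞` dominates and the limit passes through the series
(`tendsto_variance_normalizedSum`).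

Normality. If `h = x q - q'` with smooth bounded data, Gaussian integration by parts gives `E[F
φ(F)] = E[V φ'(F)]` with `V = n⁻¹ ∑ R(i - m) q(X_i) h'(X_m)`. The covariance matrices are Toeplitz
with symbol `f_j`, so their quadratic forms are bounded by `2π sup f_j`; the Poincaré inequality
then yields `Var V = O(1/n)`. A differential equation for the characteristic function turns this
into `|E e^{itF} - e^{-t² Var F/2}| ≤ t² √(Var V)`.

For general `h`, truncate the Hermite expansion, write it as `x p - p'`, and replace `p` by `p e^{-a
x²}`: such Stein images approximate `h` in `L²(γ)`. The uniform bound on the Toeplitz means makes `h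
↦ F_j` bounded from centred functions in `L²(γ)` to `L²(P_j)` uniformly in `j`, so the approximation
error is uniform in `j` (`tendsto_charFun_normalizedSum`). Lévy's continuity theorem concludes. -/

namespace GaussianArray

/-! ### Gaussian sequences and regression residuals -/

section GaussianSequences

/-- A centred Gaussian sequence of measurable random variables with unit variances and covariances
`E[Xᵢ Xₘ] = R (i - m)`. -/
structure IsStdGaussianSeq {Ω : Type*} [MeasurableSpace Ω] (P : Measure Ω) (X : ℕ → Ω → ℝ)
    (R : ℤ → ℝ) : Prop where
  measurable : ∀ i, Measurable (X i)
  gaussian : IsGaussianProcess X P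
  mean_zero : ∀ i, ∫ ω, X i ω ∂P = 0
  corr : ∀ i m : ℕ, ∫ ω, X i ω * X m ω ∂P = R (i - m)
  corr_zero : R 0 = 1

variable {Ω : Type*} [MeasurableSpace Ω] {P : Measure Ω} {X : ℕ → Ω → ℝ} {R : ℤ → ℝ}

namespace IsStdGaussianSeq

lemma memLp (hX : IsStdGaussianSeq P X R) (i : ℕ) : MemLp (X i) 2 P :=
  (hX.gaussian.hasGaussianLaw_eval i).memLp_two

lemma covariance_eq [IsProbabilityMeasure P] (hX : IsStdGaussianSeq P X R) (i m : ℕ) :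
    covariance (X i) (X m) P = R (i - m) := by
  rw [covariance_eq_sub (hX.memLp i) (hX.memLp m), hX.mean_zero, hX.mean_zero, ← hX.corr i m]
  simp

lemma map_eq [IsProbabilityMeasure P] (hX : IsStdGaussianSeq P X R) (i : ℕ) :
    P.map (X i) = gaussianReal 0 1 := by
  have h := (hX.gaussian.hasGaussianLaw_eval i).isGaussian_map
  rw [IsGaussian.eq_gaussianReal _ h]
  congr 1
  · simp only [id]
    rw [integral_map (hX.measurable i).aemeasurable (by fun_prop), hX.mean_zero]
  · rw [variance_map (by fun_prop) (hX.measurable i).aemeasurable]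
    rw [Function.id_comp, ← covariance_self (hX.measurable i).aemeasurable, hX.covariance_eq]
    simp [hX.corr_zero]

lemma measurePreserving [IsProbabilityMeasure P] (hX : IsStdGaussianSeq P X R) (i : ℕ) :
    MeasurePreserving (X i) P (gaussianReal 0 1) :=
  ⟨hX.measurable i, hX.map_eq i⟩

/-- `Xᵢ` is independent of the family of residuals of the regressions on `Xᵢ`. -/
lemma indepFun_residual [IsProbabilityMeasure P] (hX : IsStdGaussianSeq P X R) (i : ℕ) :
    IndepFun (X i) (fun ω (m : ℕ) => X m ω - R (i - m) * X i ω) P := by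
  -- The variable and the residuals are linear in `X`, hence jointly Gaussian, and zero covariance
  -- suffices for independence. It holds since `R 0 = 1`.
  have hG : IsGaussianProcess (Sum.elim (fun _ : Unit => X i)
      (fun (m : ℕ) ω => X m ω - R (i - m) * X i ω)) P := by
    refine hX.gaussian.of_isGaussianProcess fun s => ?_
    rcases s with s | m
    · exact ⟨{i}, ContinuousLinearMap.proj ⟨i, by simp⟩, fun ω => by simp⟩
    · refine ⟨{i, m}, ContinuousLinearMap.proj ⟨m, by simp⟩
        - R (i - m) • ContinuousLinearMap.proj ⟨i, by simp⟩, fun ω => by simp⟩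
  have h := hG.indepFun_of_covariance_eq_zero (fun _ => (hX.measurable i).aemeasurable)
    (fun m => ((hX.measurable m).sub ((hX.measurable i).const_mul _)).aemeasurable)
    (fun _ m => by
      change covariance (X i) (X m - fun ω => R (i - m) * X i ω) P = 0
      rw [covariance_sub_right (Y := X m) (Z := fun ω => R (i - m) * X i ω) (hX.memLp i)
        (hX.memLp m) ((hX.memLp i).const_mul _), covariance_const_mul_right,
        hX.covariance_eq, hX.covariance_eq]
      simp [hX.corr_zero])
  exact h.comp (φ := fun x : Unit → ℝ => x ()) (measurable_pi_apply ()) measurable_id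

end IsStdGaussianSeq

end GaussianSequences

/-! ### Gaussian integration by parts -/

section IntegrationByParts

variable {F : Type*} [NormedAddCommGroup F] [NormedSpace ℝ F]

/-- **Gaussian integration by parts** on the real line. -/
lemma integral_smul_gaussianReal_eq {φ φ' : ℝ → F}
    (hd : ∀ x, HasDerivAt φ (φ' x) x) (h0 : Integrable φ (gaussianReal 0 1))
    (h1 : Integrable (fun x => x • φ x) (gaussianReal 0 1))
    (h2 : Integrable φ' (gaussianReal 0 1)) :
    ∫ x, x • φ x ∂(gaussianReal 0 1) = ∫ x, φ' x ∂(gaussianReal 0 1) := by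
  have hv : (1 : ℝ≥0) ≠ 0 := one_ne_zero
  have key : ∀ {ψ : ℝ → F}, Integrable ψ (gaussianReal 0 1) →
      Integrable (fun x => gaussianPDFReal 0 1 x • ψ x) := by
    intro ψ h
    rw [gaussianReal_of_var_ne_zero _ hv, integrable_withDensity_iff_integrable_smul'
      (measurable_gaussianPDF 0 1) (ae_of_all _ fun x => gaussianPDF_lt_top)] at h
    simpa [toReal_gaussianPDF] using h
  have hpdf : ∀ x, HasDerivAt (gaussianPDFReal 0 1) (-x * gaussianPDFReal 0 1 x) x := by
    intro x
    have h : HasDerivAt (fun x : ℝ => -(x - 0) ^ 2 / (2 * ((1 : ℝ≥0) : ℝ))) (-x) x := by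
      have := (((hasDerivAt_id x).sub_const 0).pow 2).neg.div_const (2 * ((1 : ℝ≥0) : ℝ))
      refine this.congr_deriv ?_
      norm_num
      ring
    have := h.exp.const_mul (√(2 * Real.pi * ((1 : ℝ≥0) : ℝ)))⁻¹
    refine this.congr_deriv ?_
    simp only [gaussianPDFReal]
    ring
  -- The density `p` satisfies `p' = -x p`, so `(p φ)' = p (φ' - x φ)`, and the integral of this
  -- derivative over the line vanishes.
  have hI := integral_eq_zero_of_hasDerivAt_of_integrable
    (fun x => (hpdf x).smul (hd x))
    (f' := fun x => gaussianPDFReal 0 1 x • φ' x + (-x * gaussianPDFReal 0 1 x) • φ x)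
    (by
      refine (key h2).add ?_
      refine (key h1).neg.congr (ae_of_all _ fun x => ?_)
      simp only [Pi.neg_apply, smul_smul, ← neg_smul]
      congr 1
      ring) (key h0)
  rw [integral_gaussianReal_eq_integral_smul hv, integral_gaussianReal_eq_integral_smul hv]
  have e : ∀ x, gaussianPDFReal 0 1 x • φ' x + (-x * gaussianPDFReal 0 1 x) • φ x
      = gaussianPDFReal 0 1 x • φ' x - gaussianPDFReal 0 1 x • x • φ x := by
    intro x
    rw [sub_eq_add_neg, smul_smul, ← neg_smul]
    congr 2
    ring
  simp_rw [e] at hI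
  rw [integral_sub (key h2) (key h1), sub_eq_zero] at hI
  exact hI.symm

variable {Ω : Type*} [MeasurableSpace Ω] {P : Measure Ω} {X : ℕ → Ω → ℝ} {R : ℤ → ℝ}

/-- Gaussian integration by parts in one variable `Xᵢ` of a Gaussian sequence, the rest of which
is given through the residuals of the regressions on `Xᵢ`. -/
lemma IsStdGaussianSeq.integral_smul_eq [IsProbabilityMeasure P] (hX : IsStdGaussianSeq P X R)
    (i : ℕ) {Φ Φ' : ℝ → (ℕ → ℝ) → F}
    (hd : ∀ x w, HasDerivAt (fun x => Φ x w) (Φ' x w) x)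
    (hΦ : StronglyMeasurable (Function.uncurry Φ))
    (hΦ' : StronglyMeasurable (Function.uncurry Φ'))
    (h0 : Integrable (fun ω => Φ (X i ω) (fun m : ℕ => X m ω - R (i - m) * X i ω)) P)
    (h1 : Integrable
      (fun ω => X i ω • Φ (X i ω) (fun m : ℕ => X m ω - R (i - m) * X i ω)) P)
    (h2 : Integrable (fun ω => Φ' (X i ω) (fun m : ℕ => X m ω - R (i - m) * X i ω)) P) :
    ∫ ω, X i ω • Φ (X i ω) (fun m : ℕ => X m ω - R (i - m) * X i ω) ∂P
      = ∫ ω, Φ' (X i ω) (fun m : ℕ => X m ω - R (i - m) * X i ω) ∂P := by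
  set W : Ω → ℕ → ℝ := fun ω m => X m ω - R (i - m) * X i ω with hW
  have mX := hX.measurable i
  have mW : Measurable W :=
    measurable_pi_lambda _ fun m => (hX.measurable m).sub (mX.const_mul _)
  -- Independence makes the joint law a product, so Fubini reduces the claim to the one-dimensional
  -- identity with the residuals frozen.
  have hmap : P.map (fun ω => (X i ω, W ω)) = (gaussianReal 0 1).prod (P.map W) := by
    rw [← hX.map_eq i]
    exact (indepFun_iff_map_prod_eq_prod_map_map mX.aemeasurable mW.aemeasurable).1
      (hX.indepFun_residual i)
  have : IsProbabilityMeasure (P.map W) := Measure.isProbabilityMeasure_map mW.aemeasurable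
  have mXW : AEMeasurable (fun ω => (X i ω, W ω)) P := (mX.prodMk mW).aemeasurable
  have hint : ∀ {Ψ : ℝ → (ℕ → ℝ) → F}, StronglyMeasurable (Function.uncurry Ψ) →
      Integrable (fun ω => Ψ (X i ω) (W ω)) P →
      Integrable (Function.uncurry Ψ) ((gaussianReal 0 1).prod (P.map W)) := by
    intro Ψ hΨ h
    rw [← hmap, integrable_map_measure hΨ.aestronglyMeasurable mXW]
    exact h
  have hval : ∀ {Ψ : ℝ → (ℕ → ℝ) → F}, StronglyMeasurable (Function.uncurry Ψ) →
      Integrable (fun ω => Ψ (X i ω) (W ω)) P →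
      ∫ ω, Ψ (X i ω) (W ω) ∂P = ∫ w, ∫ x, Ψ x w ∂(gaussianReal 0 1) ∂(P.map W) := by
    intro Ψ hΨ h
    have : ∫ ω, Ψ (X i ω) (W ω) ∂P
        = ∫ z, Function.uncurry Ψ z ∂((gaussianReal 0 1).prod (P.map W)) := by
      rw [← hmap, integral_map mXW hΨ.aestronglyMeasurable]
      rfl
    rw [this, integral_prod_symm _ (hint hΨ h)]
    rfl
  have hΦ1 : StronglyMeasurable (Function.uncurry fun (x : ℝ) (w : ℕ → ℝ) => x • Φ x w) :=
    measurable_fst.stronglyMeasurable.smul hΦ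
  rw [hval (Ψ := fun x w => x • Φ x w) hΦ1 h1, hval hΦ' h2]
  refine integral_congr_ae ?_
  filter_upwards [(hint hΦ h0).prod_left_ae, (hint (Ψ := fun x w => x • Φ x w) hΦ1 h1).prod_left_ae,
    (hint hΦ' h2).prod_left_ae] with w a b c
  exact integral_smul_gaussianReal_eq (fun x => hd x w) a b c

end IntegrationByParts

/-! ### Hermite polynomials and their Gaussian covariances -/

section Hermite

open Polynomial in
/-- The `l`-th Hermite polynomial with real coefficients. -/
noncomputable def hermiteReal (l : ℕ) : Polynomial ℝ :=
  (Polynomial.hermite l).map (Int.castRingHom ℝ)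

lemma hermiteFun_eq_eval (l : ℕ) (x : ℝ) : hermiteFun l x = (hermiteReal l).eval x := by
  rw [hermiteFun, hermiteReal, Polynomial.aeval_def, Polynomial.eval_map]
  rfl

open Polynomial in
lemma hermiteReal_succ (l : ℕ) :
    hermiteReal (l + 1) = X * hermiteReal l - derivative (hermiteReal l) := by
  simp [hermiteReal, hermite_succ, derivative_map]

lemma hermiteReal_zero : hermiteReal 0 = 1 := by
  simp [hermiteReal]

open Polynomial in
lemma derivative_hermiteReal_succ (l : ℕ) :
    derivative (hermiteReal (l + 1)) = C ((l : ℝ) + 1) * hermiteReal l := by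
  induction l with
  | zero => simp [hermiteReal_succ, hermiteReal_zero]
  | succ l ih =>
    rw [hermiteReal_succ (l + 1), derivative_sub, derivative_mul, derivative_X, ih,
      derivative_mul, derivative_C, hermiteReal_succ l]
    push_cast
    simp only [map_add, map_one]
    ring

lemma natDegree_hermiteReal (l : ℕ) : (hermiteReal l).natDegree = l := by
  rw [hermiteReal, (Polynomial.hermite_monic l).natDegree_map, Polynomial.natDegree_hermite]

lemma monic_hermiteReal (l : ℕ) : (hermiteReal l).Monic :=
  (Polynomial.hermite_monic l).map _

/-- Every polynomial is a linear combination of Hermite polynomials. -/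
lemma mem_span_hermiteReal (p : Polynomial ℝ) :
    p ∈ Submodule.span ℝ (Set.range hermiteReal) := by
  induction hn : p.natDegree using Nat.strong_induction_on generalizing p with
  | _ n ih =>
    subst hn
    set q := p - Polynomial.C p.leadingCoeff * hermiteReal p.natDegree with hq
    have hmem : p.leadingCoeff • hermiteReal p.natDegree
        ∈ Submodule.span ℝ (Set.range hermiteReal) :=
      Submodule.smul_mem _ _ (Submodule.subset_span ⟨_, rfl⟩)
    have hpq : p = q + p.leadingCoeff • hermiteReal p.natDegree := by
      rw [hq, Polynomial.smul_eq_C_mul]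
      ring
    rcases Nat.eq_zero_or_pos p.natDegree with h0 | h0
    · rw [h0, hermiteReal_zero] at hmem
      rw [Polynomial.eq_C_of_natDegree_eq_zero h0]
      rw [Polynomial.leadingCoeff, h0] at hmem
      simpa [Polynomial.smul_eq_C_mul] using hmem
    · rw [hpq]
      refine Submodule.add_mem _ (ih q.natDegree ?_ q rfl) hmem
      by_cases hq0 : q = 0
      · simpa [hq0] using h0
      have hp0 : p ≠ 0 := by
        rintro rfl
        simp at h0
      refine Polynomial.natDegree_lt_natDegree hq0 (Polynomial.degree_sub_lt_left ?_ hp0 ?_)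
      · rw [Polynomial.degree_C_mul (by simpa using hp0),
          Polynomial.degree_eq_natDegree (monic_hermiteReal _).ne_zero, natDegree_hermiteReal,
          Polynomial.degree_eq_natDegree hp0]
      · rw [Polynomial.leadingCoeff_mul, Polynomial.leadingCoeff_C, monic_hermiteReal, mul_one]

lemma integrable_eval_gaussianReal (p : Polynomial ℝ) :
    Integrable (fun x => p.eval x) (gaussianReal 0 1) := by
  simp_rw [Polynomial.eval_eq_sum_range]
  refine integrable_finsetSum _ fun k _ => Integrable.const_mul ?_ _
  have h := (memLp_id_gaussianReal (μ := 0) (v := 1) k).integrable_norm_pow'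
  refine h.mono' (by fun_prop) (ae_of_all _ fun x => ?_)
  simp [norm_pow]

lemma memLp_eval_gaussianReal (p : Polynomial ℝ) :
    MemLp (fun x => p.eval x) 2 (gaussianReal 0 1) := by
  rw [memLp_two_iff_integrable_sq (by fun_prop)]
  exact (integrable_eval_gaussianReal (p ^ 2)).congr (ae_of_all _ fun x => Polynomial.eval_pow _)

variable {Ω : Type*} [MeasurableSpace Ω] {P : Measure Ω} [IsProbabilityMeasure P]
  {X : ℕ → Ω → ℝ} {R : ℤ → ℝ}

lemma IsStdGaussianSeq.integrable_mul (hX : IsStdGaussianSeq P X R) (i m : ℕ) {u v : ℝ → ℝ}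
    (hu : MemLp u 2 (gaussianReal 0 1)) (hv : MemLp v 2 (gaussianReal 0 1)) :
    Integrable (fun ω => u (X i ω) * v (X m ω)) P :=
  (hu.comp_measurePreserving (hX.measurePreserving i)).integrable_mul
    (hv.comp_measurePreserving (hX.measurePreserving m))

/-- In `H_{l+1} = x H_l - H_l'` the factor `x` is removed by integration by parts in `X i`. The term
with `H_l'` cancels, and the derivative reaches `q (X m)` through `X m = R (i - m) * X i +
residual`. -/
lemma IsStdGaussianSeq.integral_hermite_succ_mul (hX : IsStdGaussianSeq P X R) (i m l : ℕ)
    (q : Polynomial ℝ) :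
    ∫ ω, (hermiteReal (l + 1)).eval (X i ω) * q.eval (X m ω) ∂P
      = R (i - m) * ∫ ω, (hermiteReal l).eval (X i ω) * q.derivative.eval (X m ω) ∂P := by
  have hint : ∀ a b : Polynomial ℝ, Integrable (fun ω => a.eval (X i ω) * b.eval (X m ω)) P :=
    fun a b => hX.integrable_mul i m (memLp_eval_gaussianReal a) (memLp_eval_gaussianReal b)
  have key := hX.integral_smul_eq i
    (Φ := fun x w => (hermiteReal l).eval x * q.eval (R (i - m) * x + w m))
    (Φ' := fun x w => (hermiteReal l).derivative.eval x * q.eval (R (i - m) * x + w m)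
      + (hermiteReal l).eval x * (q.derivative.eval (R (i - m) * x + w m) * R (i - m)))
    (fun x w => by
      refine ((hermiteReal l).hasDerivAt x).mul ?_
      refine (q.hasDerivAt _).comp x ?_
      simpa using ((hasDerivAt_id x).const_mul (R (i - m))).add_const (w m))
    (by
      refine Continuous.stronglyMeasurable ?_
      simp only [Function.uncurry_def]
      fun_prop)
    (by
      refine Continuous.stronglyMeasurable ?_
      simp only [Function.uncurry_def]
      fun_prop)
    (by simpa using hint _ _)
    (by
      refine (hint (Polynomial.X * hermiteReal l) q).congr (ae_of_all _ fun ω => ?_)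
      simp [Polynomial.eval_mul, mul_assoc])
    (by
      simp only [add_sub_cancel]
      refine (hint _ _).add ?_
      refine ((hint (hermiteReal l) q.derivative).mul_const (R (i - m))).congr
        (ae_of_all _ fun ω => ?_)
      simp only
      ring)
  simp only [add_sub_cancel, smul_eq_mul] at key
  have h2 : ∫ ω, (hermiteReal l).eval (X i ω) * (q.derivative.eval (X m ω) * R (i - m)) ∂P
      = R (i - m) * ∫ ω, (hermiteReal l).eval (X i ω) * q.derivative.eval (X m ω) ∂P := by
    rw [← integral_const_mul]
    congr 1
    ext ω
    ring
  rw [← h2]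
  rw [integral_add (hint _ _) (by
      refine ((hint (hermiteReal l) q.derivative).mul_const (R (i - m))).congr
        (ae_of_all _ fun ω => ?_)
      simp only
      ring)] at key
  rw [← sub_eq_iff_eq_add', ← integral_sub
    (by
      refine (hint (Polynomial.X * hermiteReal l) q).congr (ae_of_all _ fun ω => ?_)
      simp [Polynomial.eval_mul, mul_assoc]) (hint _ _)] at key
  rw [← key]
  congr 1
  ext ω
  simp only [hermiteReal_succ, Polynomial.eval_sub, Polynomial.eval_mul, Polynomial.eval_X]
  ring

/-- Each integration by parts lowers both degrees by one, with the factor `R (i - m)` and the factor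
from `H_{k+1}' = (k+1) H_k`. Unequal degrees end with a constant against a Hermite polynomial of
positive degree, which integrates to zero. -/
lemma IsStdGaussianSeq.integral_hermite_mul_hermite (hX : IsStdGaussianSeq P X R)
    (i m l k : ℕ) :
    ∫ ω, (hermiteReal l).eval (X i ω) * (hermiteReal k).eval (X m ω) ∂P
      = if l = k then (l.factorial : ℝ) * R (i - m) ^ l else 0 := by
  induction l generalizing k with
  | zero =>
    rcases k with _ | k
    · simp [hermiteReal_zero]
    · have := hX.integral_hermite_succ_mul m i k 1
      simp_rw [mul_comm ((hermiteReal (k + 1)).eval _)] at this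
      simpa [hermiteReal_zero] using this
  | succ l ih =>
    rw [hX.integral_hermite_succ_mul]
    rcases k with _ | k
    · simp [hermiteReal_zero]
    · have e : ∀ ω, (hermiteReal l).eval (X i ω)
          * (Polynomial.derivative (hermiteReal (k + 1))).eval (X m ω)
          = ((k : ℝ) + 1) * ((hermiteReal l).eval (X i ω) * (hermiteReal k).eval (X m ω)) := by
        intro ω
        rw [derivative_hermiteReal_succ, Polynomial.eval_mul, Polynomial.eval_C]
        ring
      simp_rw [e, integral_const_mul, ih]
      by_cases h : l = k
      · subst h
        simp only [↓reduceIte, Nat.factorial_succ, Nat.cast_mul, Nat.cast_add, Nat.cast_one]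
        ring
      · simp [h]

/-- The constant sequence equal to a standard Gaussian variable. -/
lemma isStdGaussianSeq_id :
    IsStdGaussianSeq (gaussianReal 0 1) (fun _ => id) (fun _ => 1) where
  measurable _ := measurable_id
  gaussian := by
    refine ⟨fun I => ?_⟩
    exact (IsGaussian.hasGaussianLaw_id (μ := gaussianReal 0 1)).map
      (ContinuousLinearMap.pi fun _ : I => ContinuousLinearMap.id ℝ ℝ)
  mean_zero _ := by simp
  corr i m := by
    have h := variance_id_gaussianReal (μ := 0) (v := 1)
    rw [variance_eq_sub (memLp_id_gaussianReal' 2 (by simp))] at h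
    simpa [pow_two] using h
  corr_zero := rfl

lemma integral_hermite_mul_hermite (l k : ℕ) :
    ∫ x, (hermiteReal l).eval x * (hermiteReal k).eval x ∂(gaussianReal 0 1)
      = if l = k then (l.factorial : ℝ) else 0 := by
  simpa using isStdGaussianSeq_id.integral_hermite_mul_hermite 0 0 l k

end Hermite

/-! ### Completeness of the Hermite polynomials and Mehler's formula -/

section HermiteBasis

lemma memLp_exp_abs_gaussianReal (t : ℝ) :
    MemLp (fun x => Real.exp |t * x|) 2 (gaussianReal 0 1) := by
  rw [memLp_two_iff_integrable_sq (by fun_prop)]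
  refine ((integrable_exp_mul_gaussianReal (μ := 0) (v := 1) (2 * t)).add
    (integrable_exp_mul_gaussianReal (μ := 0) (v := 1) (-(2 * t)))).mono' (by fun_prop)
    (ae_of_all _ fun x => ?_)
  rw [Real.norm_of_nonneg (by positivity), ← Real.exp_nat_mul]
  simp only [Pi.add_apply]
  rcases abs_cases (t * x) with ⟨h, -⟩ | ⟨h, -⟩ <;> rw [h]
  · refine (Real.exp_le_exp.2 (le_of_eq ?_)).trans
      (le_add_of_nonneg_right (Real.exp_pos _).le)
    push_cast
    ring
  · refine (Real.exp_le_exp.2 (le_of_eq ?_)).trans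
      (le_add_of_nonneg_left (Real.exp_pos _).le)
    push_cast
    ring

/-- The moment problem in `L²(γ)`: a function orthogonal to all monomials vanishes. -/
lemma ae_eq_zero_of_integral_pow_mul_eq_zero {u : ℝ → ℝ} (hu : MemLp u 2 (gaussianReal 0 1))
    (h : ∀ n : ℕ, ∫ x, x ^ n * u x ∂(gaussianReal 0 1) = 0) :
    u =ᵐ[gaussianReal 0 1] 0 := by
  have hui : Integrable u (gaussianReal 0 1) := hu.integrable (by norm_num)
  -- The Fourier transform of the signed measure `u γ` is expanded in powers of `t x`; the
  -- integrable majorant is `exp |t x| * |u x|`, and every term vanishes by hypothesis.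
  have hchar : ∀ t : ℝ, ∫ x, Complex.exp (t * x * Complex.I) * (u x : ℂ) ∂(gaussianReal 0 1) = 0 := by
    intro t
    have hs := hasSum_integral_of_dominated_convergence (μ := gaussianReal 0 1)
      (F := fun (n : ℕ) (x : ℝ) => (t * x * Complex.I) ^ n / (n.factorial : ℂ) * (u x : ℂ))
      (f := fun x : ℝ => Complex.exp (t * x * Complex.I) * (u x : ℂ))
      (fun n x => |t * x| ^ n / (n.factorial : ℝ) * |u x|)
      (fun n => by
        refine AEStronglyMeasurable.mul (by fun_prop) ?_
        exact Complex.continuous_ofReal.comp_aestronglyMeasurable hu.aestronglyMeasurable)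
      (fun n => ae_of_all _ fun x => by simp [abs_mul])
      (ae_of_all _ fun x => (Real.summable_pow_div_factorial _).mul_right _)
      (by
        refine ((memLp_exp_abs_gaussianReal t).integrable_mul hu.abs).congr
          (ae_of_all _ fun x => ?_)
        simp only [Pi.mul_apply]
        rw [tsum_mul_right, Real.exp_eq_exp_ℝ, NormedSpace.exp_eq_tsum_div]
        rfl)
      (ae_of_all _ fun x => by
        refine HasSum.mul_right _ ?_
        rw [Complex.exp_eq_exp_ℂ]
        exact NormedSpace.expSeries_div_hasSum_exp _)
    have hz : ∀ n : ℕ, ∫ x : ℝ, (t * x * Complex.I) ^ n / (n.factorial : ℂ) * (u x : ℂ)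
        ∂(gaussianReal 0 1) = 0 := by
      intro n
      have e : ∀ x : ℝ, (t * x * Complex.I) ^ n / (n.factorial : ℂ) * (u x : ℂ)
          = ((t * Complex.I) ^ n / (n.factorial : ℂ)) * ((x ^ n * u x : ℝ) : ℂ) := by
        intro x
        push_cast
        ring
      simp_rw [e]
      rw [integral_const_mul, integral_complex_ofReal, h n]
      simp
    simp_rw [hz] at hs
    exact hs.unique hasSum_zero
  -- `ENNReal.ofReal` truncates at zero, so `ν u` and `ν (-u)` have densities `u⁺` and `u⁻`. Their
  -- characteristic functions differ by the integral in `hchar`, so `u⁺ = u⁻` almost everywhere,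
  -- which forces `u = 0`.
  let ν : (ℝ → ℝ) → Measure ℝ := fun v => (gaussianReal 0 1).withDensity
    (fun x => ENNReal.ofReal (v x))
  have hfin : ∀ {v : ℝ → ℝ}, Integrable v (gaussianReal 0 1) → IsFiniteMeasure (ν v) :=
    fun {v} hv => isFiniteMeasure_withDensity_ofReal hv.2
  have hν : ν u = ν (-u) := by
    have := hfin hui
    have := hfin hui.neg
    refine Measure.ext_of_charFun (funext fun t => ?_)
    rw [charFun_apply_real, charFun_apply_real]
    have hm : ∀ {v : ℝ → ℝ}, Integrable v (gaussianReal 0 1) →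
        ∫ x, Complex.exp (t * x * Complex.I) ∂(ν v)
          = ∫ x, ((max (v x) 0 : ℝ) : ℂ) * Complex.exp (t * x * Complex.I)
            ∂(gaussianReal 0 1) := by
      intro v hv
      rw [integral_withDensity_eq_integral_toReal_smul₀ hv.1.aemeasurable.ennreal_ofReal
        (ae_of_all _ fun x => ENNReal.ofReal_lt_top)]
      simp [ENNReal.toReal_ofReal']
    have hi : ∀ {v : ℝ → ℝ}, Integrable v (gaussianReal 0 1) →
        Integrable (fun x => ((max (v x) 0 : ℝ) : ℂ) * Complex.exp (t * x * Complex.I))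
          (gaussianReal 0 1) := by
      intro v hv
      refine Integrable.mul_bdd (c := 1) hv.pos_part.ofReal (by fun_prop) (ae_of_all _ fun x => ?_)
      rw [← Complex.ofReal_mul, Complex.norm_exp_ofReal_mul_I]
    rw [hm hui, hm hui.neg, ← sub_eq_zero, ← integral_sub (hi hui) (hi hui.neg), ← hchar t]
    refine integral_congr_ae (ae_of_all _ fun x => ?_)
    simp only [Pi.neg_apply]
    rw [← sub_mul, ← Complex.ofReal_sub, mul_comm]
    congr 2
    rcases le_total (u x) 0 with h | h
    · rw [max_eq_right h, max_eq_left (by linarith)]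
      ring
    · rw [max_eq_left h, max_eq_right (by linarith)]
      ring
  have hae := (withDensity_eq_iff hui.1.aemeasurable.ennreal_ofReal
    hui.neg.1.aemeasurable.ennreal_ofReal (by
      rw [← lt_top_iff_ne_top]
      have := hfin hui
      have h1 := measure_lt_top (ν u) Set.univ
      simpa [ν, withDensity_apply] using h1)).1 hν
  filter_upwards [hae] with x hx
  simp only [Pi.neg_apply] at hx
  rcases lt_trichotomy (u x) 0 with h | h | h
  · rw [ENNReal.ofReal_of_nonpos h.le, eq_comm, ENNReal.ofReal_eq_zero] at hx
    linarith
  · exact h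
  · rw [ENNReal.ofReal_of_nonpos (p := -u x) (by linarith), ENNReal.ofReal_eq_zero] at hx
    linarith

/-- The normalized Hermite polynomials as elements of `L²(γ)`. -/
noncomputable def hermiteLp (l : ℕ) : Lp ℝ 2 (gaussianReal 0 1) :=
  (√(l.factorial : ℝ))⁻¹ • (memLp_eval_gaussianReal (hermiteReal l)).toLp _

lemma inner_toLp {Ω : Type*} [MeasurableSpace Ω] {P : Measure Ω} {u v : Ω → ℝ} (hu : MemLp u 2 P)
    (hv : MemLp v 2 P) : inner ℝ (hu.toLp u) (hv.toLp v) = ∫ x, u x * v x ∂P := by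
  rw [L2.inner_def]
  refine integral_congr_ae ?_
  filter_upwards [hu.coeFn_toLp, hv.coeFn_toLp] with x h1 h2
  rw [h1, h2]
  simp [mul_comm]

lemma orthonormal_hermiteLp : Orthonormal ℝ hermiteLp := by
  rw [orthonormal_iff_ite]
  intro l k
  rw [hermiteLp, hermiteLp, real_inner_smul_left, real_inner_smul_right, inner_toLp,
    integral_hermite_mul_hermite]
  split_ifs with h
  · subst h
    have : (0 : ℝ) < l.factorial := by exact_mod_cast l.factorial_pos
    have h2 := Real.mul_self_sqrt this.le
    field_simp
    rw [pow_two, h2]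
  · simp

/-- The Hilbert basis of `L²(γ)` given by the normalized Hermite polynomials. -/
noncomputable def hermiteBasis : HilbertBasis ℕ ℝ (Lp ℝ 2 (gaussianReal 0 1)) :=
  HilbertBasis.mkOfOrthogonalEqBot orthonormal_hermiteLp <| by
    rw [Submodule.eq_bot_iff]
    intro u hu
    rw [Submodule.mem_orthogonal] at hu
    have hH : ∀ l, ∫ x, (hermiteReal l).eval x * u x ∂(gaussianReal 0 1) = 0 := by
      intro l
      have h := hu _ (Submodule.subset_span ⟨l, rfl⟩)
      rw [hermiteLp, real_inner_smul_left] at h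
      have h0 : (√(l.factorial : ℝ))⁻¹ ≠ 0 := by positivity
      have h1 := (mul_eq_zero.1 h).resolve_left h0
      rw [← Lp.toLp_coeFn u (Lp.memLp u), inner_toLp] at h1
      exact h1
    have hp : ∀ p : Polynomial ℝ, ∫ x, p.eval x * u x ∂(gaussianReal 0 1) = 0 := by
      intro p
      have hi : ∀ p : Polynomial ℝ, Integrable (fun x => p.eval x * u x) (gaussianReal 0 1) :=
        fun p => (memLp_eval_gaussianReal p).integrable_mul (Lp.memLp u)
      induction mem_span_hermiteReal p using Submodule.span_induction with
      | mem x h =>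
        obtain ⟨l, rfl⟩ := h
        exact hH l
      | zero => simp
      | add p q _ _ hp hq =>
        simp_rw [Polynomial.eval_add, add_mul]
        rw [integral_add (hi p) (hi q), hp, hq, add_zero]
      | smul a p _ hp =>
        simp_rw [Polynomial.eval_smul, smul_eq_mul, mul_assoc]
        rw [integral_const_mul, hp, mul_zero]
    have h0 := ae_eq_zero_of_integral_pow_mul_eq_zero (Lp.memLp u) fun n => by
      simpa using hp (Polynomial.X ^ n)
    exact (Lp.eq_zero_iff_ae_eq_zero).2 h0

lemma hermiteBasis_apply (l : ℕ) : hermiteBasis l = hermiteLp l := by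
  rw [hermiteBasis, HilbertBasis.coe_mkOfOrthogonalEqBot]

lemma hermiteBasis_repr_toLp {h : ℝ → ℝ} (hh : MemLp h 2 (gaussianReal 0 1)) (l : ℕ) :
    hermiteBasis.repr (hh.toLp h) l = (√(l.factorial : ℝ))⁻¹ * hermiteCoeff h l := by
  rw [HilbertBasis.repr_apply_apply, hermiteBasis_apply, hermiteLp, real_inner_smul_left,
    inner_toLp, hermiteCoeff]
  congr 2
  ext x
  rw [hermiteFun_eq_eval, mul_comm]

variable {Ω : Type*} [MeasurableSpace Ω] {P : Measure Ω} [IsProbabilityMeasure P]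
  {X : ℕ → Ω → ℝ} {R : ℤ → ℝ}

/-- **Mehler's formula**: the covariance of `h(Xᵢ)` and `h(Xₘ)` in terms of Hermite
coefficients. -/
lemma IsStdGaussianSeq.hasSum_hermiteCoeff (hX : IsStdGaussianSeq P X R) (i m : ℕ) {h : ℝ → ℝ}
    (hh : MemLp h 2 (gaussianReal 0 1)) :
    HasSum (fun l => hermiteCoeff h l ^ 2 / (l.factorial : ℝ) * R (i - m) ^ l)
      (∫ ω, h (X i ω) * h (X m ω) ∂P) := by
  have mi := hX.measurePreserving i
  have mm := hX.measurePreserving m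
  -- Composition with `X i` and with `X m` embeds `L²(γ)` isometrically in `L²(P)`. The images of
  -- the two normalized Hermite bases are biorthogonal up to the factors `R (i - m) ^ l`, so the
  -- inner product expands diagonally.
  let Ti := Lp.compMeasurePreservingₗᵢ ℝ (E := ℝ) (p := 2) (X i) mi
  let Tm := Lp.compMeasurePreservingₗᵢ ℝ (E := ℝ) (p := 2) (X m) mm
  have hB : ∀ {u v : ℝ → ℝ} (hu : MemLp u 2 (gaussianReal 0 1))
      (hv : MemLp v 2 (gaussianReal 0 1)), inner ℝ (Ti (hu.toLp u)) (Tm (hv.toLp v))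
      = ∫ ω, u (X i ω) * v (X m ω) ∂P := fun hu hv =>
    inner_toLp (hu.comp_measurePreserving mi) (hv.comp_measurePreserving mm)
  have hbb : ∀ l k, inner ℝ (Ti (hermiteLp l)) (Tm (hermiteLp k))
      = if l = k then R (i - m) ^ l else 0 := by
    intro l k
    rw [hermiteLp, hermiteLp, map_smul, map_smul, real_inner_smul_left, real_inner_smul_right,
      hB, hX.integral_hermite_mul_hermite]
    split_ifs with hlk
    · subst hlk
      have : (0 : ℝ) < l.factorial := by exact_mod_cast l.factorial_pos
      have h2 := Real.mul_self_sqrt this.le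
      field_simp
      rw [pow_two, h2]
    · simp
  set a : ℕ → ℝ := fun l => hermiteBasis.repr (hh.toLp h) l with ha
  have hs : HasSum (fun l => a l • hermiteLp l) (hh.toLp h) := by
    simpa only [hermiteBasis_apply] using hermiteBasis.hasSum_repr (hh.toLp h)
  have hbh : ∀ l, inner ℝ (Ti (hermiteLp l)) (Tm (hh.toLp h)) = a l * R (i - m) ^ l := by
    intro l
    have h1 := (hs.mapL Tm.toContinuousLinearMap).mapL (innerSL ℝ (Ti (hermiteLp l)))
    refine h1.unique ?_
    convert! hasSum_ite_eq l (a l * R (i - m) ^ l) using 2 with k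
    simp only [innerSL_apply_apply, LinearIsometry.coe_toContinuousLinearMap, map_smul,
      hbb, smul_eq_mul]
    by_cases hlk : l = k
    · simp [hlk]
    · simp [hlk, Ne.symm hlk]
  have h1 := (hs.mapL Ti.toContinuousLinearMap).mapL (innerSL ℝ (Tm (hh.toLp h)))
  rw [innerSL_apply_apply, LinearIsometry.coe_toContinuousLinearMap, real_inner_comm, hB] at h1
  convert! h1 using 2 with l
  simp only [innerSL_apply_apply, map_smul]
  rw [real_inner_comm, hbh, smul_eq_mul, ha]
  simp only [hermiteBasis_repr_toLp]
  have : (0 : ℝ) < l.factorial := by exact_mod_cast l.factorial_pos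
  have h2 := Real.mul_self_sqrt this.le
  field_simp
  rw [pow_two (√_), h2]
  ring

lemma hasSum_hermiteCoeff_sq {h : ℝ → ℝ} (hh : MemLp h 2 (gaussianReal 0 1)) :
    HasSum (fun l => hermiteCoeff h l ^ 2 / (l.factorial : ℝ))
      (∫ x, h x ^ 2 ∂(gaussianReal 0 1)) := by
  simpa [pow_two] using isStdGaussianSeq_id.hasSum_hermiteCoeff 0 0 hh

end HermiteBasis

/-! ### The Gaussian Poincaré inequality -/

section Poincare

/-- Cauchy–Schwarz against the constant `1`, obtained by expanding the integral of `(f - c)²` with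
`c` the mean of `f`. -/
lemma sq_intervalIntegral_le {f : ℝ → ℝ} (hf : Continuous f) {a b : ℝ} (hab : a < b) :
    (∫ x in a..b, f x) ^ 2 ≤ (b - a) * ∫ x in a..b, f x ^ 2 := by
  set c := (b - a)⁻¹ * ∫ x in a..b, f x with hc
  have hba : 0 < b - a := sub_pos.2 hab
  have h0 : 0 ≤ ∫ x in a..b, (f x - c) ^ 2 :=
    intervalIntegral.integral_nonneg hab.le fun x _ => sq_nonneg _
  have e : ∀ x, (f x - c) ^ 2 = f x ^ 2 - 2 * c * f x + c ^ 2 := fun x => by ring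
  simp_rw [e] at h0
  rw [intervalIntegral.integral_add
      ((by fun_prop : Continuous fun x => f x ^ 2 - 2 * c * f x).intervalIntegrable _ _)
      (by simp),
    intervalIntegral.integral_sub
      ((by fun_prop : Continuous fun x => f x ^ 2).intervalIntegrable _ _)
      ((by fun_prop : Continuous fun x => 2 * c * f x).intervalIntegrable _ _),
    intervalIntegral.integral_const_mul, intervalIntegral.integral_const, smul_eq_mul] at h0
  have e2 : ∫ x in a..b, f x = (b - a) * c := by
    rw [hc]
    field_simp
  rw [e2] at h0 ⊢
  nlinarith

set_option maxHeartbeats 1000000 in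
/-- **Poincaré inequality** for a centred Gaussian measure, by interpolation along rotations. -/
lemma variance_le_of_isGaussian {I : Type*} [Fintype I] {μ : Measure (I → ℝ)} [IsGaussian μ]
    (hμ : ∀ a, ∫ x, x a ∂μ = 0) {B : ℝ} (hB0 : 0 ≤ B)
    (hB : ∀ v : I → ℝ, ∫ y, (∑ a, v a * y a) ^ 2 ∂μ ≤ B * ∑ a, v a ^ 2)
    {Φ : (I → ℝ) → ℝ} {G : I → (I → ℝ) → ℝ}
    (hd : ∀ x, HasFDerivAt Φ (∑ a, G a x • (ContinuousLinearMap.proj a : (I → ℝ) →L[ℝ] ℝ)) x)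
    (hG : ∀ a, Continuous (G a)) (hΦb : ∃ K, ∀ x, |Φ x| ≤ K)
    (hGb : ∀ a, ∃ K, ∀ x, |G a x| ≤ K) :
    variance Φ μ ≤ Real.pi ^ 2 / 8 * B * ∫ x, ∑ a, G a x ^ 2 ∂μ := by
  have hpi := Real.pi_pos
  obtain ⟨K, hK⟩ := hΦb
  have hΦc : Continuous Φ := continuous_iff_continuousAt.2 fun x => (hd x).continuousAt
  have hint : Integrable (fun x => ∑ a, G a x ^ 2) μ := by
    refine integrable_finsetSum _ fun a _ => ?_
    obtain ⟨L, hL⟩ := hGb a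
    refine Integrable.of_bound (by fun_prop) (L ^ 2) (ae_of_all _ fun x => ?_)
    rw [Real.norm_of_nonneg (sq_nonneg _), ← sq_abs]
    exact pow_le_pow_left₀ (abs_nonneg _) (hL x) 2
  set g : (I → ℝ) × (I → ℝ) → ℝ := fun z => ∑ a, G a z.1 * z.2 a with hg
  have hgc : Continuous g := by fun_prop
  -- `r θ z` is the derivative of `Φ` along the arc `cos θ • z.1 + sin θ • z.2`, which joins `z.1`
  -- to `z.2` on `[0, π/2]`. It equals `g` at the rotation of `z` by `θ`, so under the
  -- rotation-invariant measure `μ.prod μ` its second moment does not depend on `θ`.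
  set r : ℝ → (I → ℝ) × (I → ℝ) → ℝ := fun θ z => ∑ a,
    G a (Real.cos θ • z.1 + Real.sin θ • z.2) * (-Real.sin θ * z.1 a + Real.cos θ * z.2 a) with hr
  have hrc : Continuous (fun w : ((I → ℝ) × (I → ℝ)) × ℝ => r w.2 w.1) := by
    simp only [hr]
    fun_prop
  have hrθ : ∀ z, Continuous fun θ => r θ z := fun z => by
    simp only [hr]
    fun_prop
  -- the pointwise estimate along a rotation
  have hpt : ∀ z : (I → ℝ) × (I → ℝ), (Φ z.2 - Φ z.1) ^ 2
      ≤ Real.pi / 2 * ∫ θ in (0)..(Real.pi / 2), r θ z ^ 2 := by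
    intro z
    have hcθ := hrθ z
    have hder : ∀ θ : ℝ, HasDerivAt (fun θ => Φ (Real.cos θ • z.1 + Real.sin θ • z.2))
        (r θ z) θ := by
      intro θ
      have h1 : HasDerivAt (fun θ => Real.cos θ • z.1 + Real.sin θ • z.2)
          (-Real.sin θ • z.1 + Real.cos θ • z.2) θ :=
        ((Real.hasDerivAt_cos θ).smul_const z.1).add ((Real.hasDerivAt_sin θ).smul_const z.2)
      have h2 := (hd _).comp_hasDerivAt θ h1
      refine h2.congr_deriv ?_
      simp [hr]
    have hftc := intervalIntegral.integral_eq_sub_of_hasDerivAt (a := 0) (b := Real.pi / 2)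
      (fun θ _ => hder θ) (hcθ.intervalIntegrable _ _)
    have := sq_intervalIntegral_le hcθ (a := 0) (b := Real.pi / 2) (by positivity)
    rw [hftc] at this
    simpa using this
  -- the variance as a double integral
  have hbdd : ∀ {f : (I → ℝ) × (I → ℝ) → ℝ}, Continuous f → (∃ L, ∀ z, |f z| ≤ L) →
      Integrable f (μ.prod μ) := fun {f} hf ⟨L, hL⟩ =>
    Integrable.of_bound hf.aestronglyMeasurable L (ae_of_all _ fun x => hL x)
  have hK2 : ∀ x y, |Φ x * Φ y| ≤ K * K := fun x y => by
    rw [abs_mul]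
    exact mul_le_mul (hK x) (hK y) (abs_nonneg _) ((abs_nonneg _).trans (hK x))
  have hvar : 2 * variance Φ μ = ∫ z, (Φ z.2 - Φ z.1) ^ 2 ∂(μ.prod μ) := by
    have hmem : MemLp Φ 2 μ := MemLp.of_bound hΦc.aestronglyMeasurable K
      (ae_of_all _ fun x => hK x)
    rw [variance_eq_sub hmem]
    have e : ∀ z : (I → ℝ) × (I → ℝ), (Φ z.2 - Φ z.1) ^ 2
        = (Φ z.2 * Φ z.2 + Φ z.1 * Φ z.1) - 2 * (Φ z.1 * Φ z.2) := fun z => by ring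
    simp_rw [e]
    rw [integral_sub, integral_add, integral_const_mul, integral_prod_mul,
      integral_fun_fst (fun x => Φ x * Φ x), integral_fun_snd (fun x => Φ x * Φ x)]
    · simp only [Pi.pow_apply, probReal_univ, one_smul]
      simp_rw [pow_two]
      ring
    · exact hbdd (by fun_prop) ⟨K * K, fun z => hK2 _ _⟩
    · exact hbdd (by fun_prop) ⟨K * K, fun z => hK2 _ _⟩
    · exact (hbdd (by fun_prop) ⟨K * K, fun z => hK2 _ _⟩).add
        (hbdd (by fun_prop) ⟨K * K, fun z => hK2 _ _⟩)
    · exact (hbdd (by fun_prop) ⟨K * K, fun z => hK2 _ _⟩).const_mul 2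
  have hrot : ∀ θ, (μ.prod μ).map (ContinuousLinearMap.rotation θ) = μ.prod μ := by
    refine fun θ => IsGaussian.map_rotation_eq_self ?_ θ
    ext a
    have := eval_integral (f := fun x : I → ℝ => x) (μ := μ)
      (fun i => (IsGaussian.integrable_dual μ (ContinuousLinearMap.proj i))) a
    simpa [hμ a] using this
  have hH : ∀ v : I → ℝ, ∫⁻ y, ENNReal.ofReal ((∑ a, v a * y a) ^ 2) ∂μ
      ≤ ENNReal.ofReal (B * ∑ a, v a ^ 2) := by
    intro v
    rw [← ofReal_integral_eq_lintegral_ofReal _ (ae_of_all _ fun y => sq_nonneg _)]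
    · exact ENNReal.ofReal_le_ofReal (hB v)
    · have := (IsGaussian.memLp_dual μ (∑ a, v a • (ContinuousLinearMap.proj a
        : (I → ℝ) →L[ℝ] ℝ)) 2 (by simp)).integrable_sq
      simpa using this
  have hgl : ∫⁻ z, ENNReal.ofReal (g z ^ 2) ∂(μ.prod μ)
      ≤ ENNReal.ofReal (B * ∫ x, ∑ a, G a x ^ 2 ∂μ) := by
    rw [lintegral_prod _ (by fun_prop)]
    refine (lintegral_mono fun x => hH fun a => G a x).trans ?_
    rw [← ofReal_integral_eq_lintegral_ofReal (hint.const_mul B) (ae_of_all _ fun y => by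
      have : 0 ≤ ∑ a, G a y ^ 2 := Finset.sum_nonneg fun a _ => sq_nonneg _
      positivity), integral_const_mul]
  -- One factor `π / 2` comes from Cauchy–Schwarz on the arc, the other from the length of the range
  -- of `θ`. Halving, because the left side is twice the variance, gives the constant `π² / 8`.
  have hmain : ENNReal.ofReal (2 * variance Φ μ) ≤ ENNReal.ofReal (Real.pi / 2 * (Real.pi / 2)
      * (B * ∫ x, ∑ a, G a x ^ 2 ∂μ)) := by
    rw [hvar, ofReal_integral_eq_lintegral_ofReal _ (ae_of_all _ fun y => sq_nonneg _)]
    swap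
    · refine hbdd (by fun_prop) ⟨(2 * K) ^ 2, fun z => ?_⟩
      rw [abs_of_nonneg (sq_nonneg _), ← sq_abs]
      refine pow_le_pow_left₀ (abs_nonneg _) ?_ 2
      have h1 := abs_le.1 (hK z.1)
      have h2 := abs_le.1 (hK z.2)
      exact abs_le.2 ⟨by linarith, by linarith⟩
    calc ∫⁻ z, ENNReal.ofReal ((Φ z.2 - Φ z.1) ^ 2) ∂(μ.prod μ)
        ≤ ∫⁻ z, ENNReal.ofReal (Real.pi / 2) * (∫⁻ θ in Set.Ioc 0 (Real.pi / 2),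
            ENNReal.ofReal (r θ z ^ 2)) ∂(μ.prod μ) := by
          refine lintegral_mono fun z => ?_
          have hcθ : Continuous fun θ : ℝ => r θ z ^ 2 := (hrθ z).pow 2
          refine (ENNReal.ofReal_le_ofReal (hpt z)).trans (le_of_eq ?_)
          rw [ENNReal.ofReal_mul (by positivity),
            intervalIntegral.integral_of_le (by positivity),
            ofReal_integral_eq_lintegral_ofReal _ (ae_of_all _ fun y => sq_nonneg _)]
          exact (hcθ.intervalIntegrable _ _).1
      _ = ENNReal.ofReal (Real.pi / 2) * ∫⁻ θ in Set.Ioc 0 (Real.pi / 2),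
            ∫⁻ z, ENNReal.ofReal (r θ z ^ 2) ∂(μ.prod μ) := by
          have hcm : Measurable (fun w : ((I → ℝ) × (I → ℝ)) × ℝ =>
              ENNReal.ofReal (r w.2 w.1 ^ 2)) :=
            (hrc.pow 2).measurable.ennreal_ofReal
          rw [lintegral_const_mul _ hcm.lintegral_prod_right',
            lintegral_lintegral_swap hcm.aemeasurable]
      _ = ENNReal.ofReal (Real.pi / 2) * (ENNReal.ofReal (Real.pi / 2)
            * ∫⁻ z, ENNReal.ofReal (g z ^ 2) ∂(μ.prod μ)) := by
          congr 1
          have : ∀ θ : ℝ, ∫⁻ z, ENNReal.ofReal (r θ z ^ 2)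
              ∂(μ.prod μ) = ∫⁻ z, ENNReal.ofReal (g z ^ 2) ∂(μ.prod μ) := by
            intro θ
            conv_rhs => rw [← hrot θ]
            rw [lintegral_map (by fun_prop) (ContinuousLinearMap.continuous _).measurable]
            simp only [hg, hr, ContinuousLinearMap.rotation_apply, Pi.add_apply, Pi.smul_apply,
              smul_eq_mul]
          simp_rw [this]
          rw [lintegral_const, mul_comm]
          simp
      _ ≤ _ := by
          rw [ENNReal.ofReal_mul (by positivity), ENNReal.ofReal_mul (by positivity), mul_assoc]
          gcongr
  have hnn : 0 ≤ ∫ x, ∑ a, G a x ^ 2 ∂μ :=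
    integral_nonneg fun x => Finset.sum_nonneg fun a _ => sq_nonneg _
  rw [ENNReal.ofReal_le_ofReal_iff (by positivity)] at hmain
  linarith

end Poincare

/-! ### Stein's identity for normalized sums -/

section SteinMethod

/-- The image of a vector under a symmetric positive semidefinite matrix whose quadratic form is
bounded by `B`. -/
lemma sum_sq_apply_le_of_quadForm_le {I : Type*} [Fintype I] {A : I → I → ℝ} {B : ℝ} (hB0 : 0 < B)
    (hs : ∀ a b, A a b = A b a) (h0 : ∀ v : I → ℝ, 0 ≤ ∑ a, ∑ b, v a * v b * A a b)
    (hB : ∀ v : I → ℝ, ∑ a, ∑ b, v a * v b * A a b ≤ B * ∑ a, v a ^ 2) (w : I → ℝ) :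
    ∑ a, (∑ b, A a b * w b) ^ 2 ≤ B ^ 2 * ∑ a, w a ^ 2 := by
  set z : I → ℝ := fun a => ∑ b, A a b * w b with hz
  -- With `z = A w`, positivity at `z - B w` reads `0 ≤ ⟨z, A z⟩ - 2 B |z|² + B² ⟨w, A w⟩`. Bounding
  -- both forms by `B` leaves `B |z|² ≤ B³ |w|²`.
  have h1 := h0 (fun a => z a - B * w a)
  have e1 : ∑ a, ∑ b, z a * w b * A a b = ∑ a, z a ^ 2 := by
    refine Finset.sum_congr rfl fun a _ => ?_
    rw [pow_two]
    conv_rhs => rw [hz]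
    simp only [Finset.mul_sum]
    exact Finset.sum_congr rfl fun b _ => by ring
  have e2 : ∑ a, ∑ b, w a * z b * A a b = ∑ a, z a ^ 2 := by
    rw [Finset.sum_comm, ← e1]
    refine Finset.sum_congr rfl fun a _ => Finset.sum_congr rfl fun b _ => ?_
    rw [hs b a]
    ring
  have e3 : ∑ a, ∑ b, (z a - B * w a) * (z b - B * w b) * A a b
      = ∑ a, ∑ b, z a * z b * A a b - B * ∑ a, ∑ b, z a * w b * A a b
        - B * ∑ a, ∑ b, w a * z b * A a b + B ^ 2 * ∑ a, ∑ b, w a * w b * A a b := by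
    simp only [Finset.mul_sum, ← Finset.sum_sub_distrib, ← Finset.sum_add_distrib]
    exact Finset.sum_congr rfl fun a _ => Finset.sum_congr rfl fun b _ => by ring
  rw [e3, e1, e2] at h1
  have h2 := hB z
  have h3 := mul_le_mul_of_nonneg_left (hB w) (sq_nonneg B)
  have h4 : B * ∑ a, z a ^ 2 ≤ B * (B ^ 2 * ∑ a, w a ^ 2) := by nlinarith
  exact le_of_mul_le_mul_left h4 hB0

/-- Data for Stein's method: `h(x) = x q(x) - q'(x)`, with all functions smooth and bounded
by `K`. -/
structure SteinData (K : ℝ) (q q' h h' h'' : ℝ → ℝ) : Prop where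
  eq : ∀ x, h x = x * q x - q' x
  deriv_q : ∀ x, HasDerivAt q (q' x) x
  deriv_h : ∀ x, HasDerivAt h (h' x) x
  deriv_h' : ∀ x, HasDerivAt h' (h'' x) x
  cont_q' : Continuous q'
  cont_h'' : Continuous h''
  bound_q : ∀ x, |q x| ≤ K
  bound_q' : ∀ x, |q' x| ≤ K
  bound_h : ∀ x, |h x| ≤ K
  bound_h' : ∀ x, |h' x| ≤ K
  bound_h'' : ∀ x, |h'' x| ≤ K

variable {K : ℝ} {q q' h h' h'' : ℝ → ℝ}

namespace SteinData

lemma cont_q (S : SteinData K q q' h h' h'') : Continuous q :=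
  continuous_iff_continuousAt.2 fun x => (S.deriv_q x).continuousAt

lemma cont_h (S : SteinData K q q' h h' h'') : Continuous h :=
  continuous_iff_continuousAt.2 fun x => (S.deriv_h x).continuousAt

lemma cont_h' (S : SteinData K q q' h h' h'') : Continuous h' :=
  continuous_iff_continuousAt.2 fun x => (S.deriv_h' x).continuousAt

lemma nonneg (S : SteinData K q q' h h' h'') : 0 ≤ K := (abs_nonneg _).trans (S.bound_q 0)

end SteinData

variable {Ω : Type*} [MeasurableSpace Ω] {P : Measure Ω} {X : ℕ → Ω → ℝ} {R : ℤ → ℝ}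

/-- The random variable `V` such that `E[F φ(F)] = E[V φ'(F)]`, where `F` is the normalized sum. -/
noncomputable def steinFactor (q h' : ℝ → ℝ) (R : ℤ → ℝ) (X : ℕ → Ω → ℝ) (n : ℕ) (ω : Ω) : ℝ :=
  (1 / (n : ℝ)) * ∑ i ∈ Finset.Icc 1 n, ∑ m ∈ Finset.Icc 1 n,
    R (i - m) * (q (X i ω) * h' (X m ω))

lemma measurable_normalizedSum (hX : ∀ i, Measurable (X i)) (hh : Measurable h) (n : ℕ) :
    Measurable (normalizedSum h X n) := by
  unfold normalizedSum
  exact (Finset.measurable_fun_sum _ fun i _ => hh.comp (hX i)).const_mul _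

lemma abs_normalizedSum_le {Ω : Type*} {X : ℕ → Ω → ℝ} (hK : ∀ x, |h x| ≤ K) (n : ℕ) (ω : Ω) :
    |normalizedSum h X n ω| ≤ 1 / √n * (n * K) := by
  unfold normalizedSum
  rw [abs_mul, abs_of_nonneg (by positivity)]
  gcongr
  refine (Finset.abs_sum_le_sum_abs _ _).trans ((Finset.sum_le_sum fun i _ => hK _).trans ?_)
  simp

lemma measurable_steinFactor (S : SteinData K q q' h h' h'') (hX : ∀ i, Measurable (X i))
    (n : ℕ) : Measurable (steinFactor q h' R X n) := by
  unfold steinFactor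
  refine (Finset.measurable_fun_sum _ fun i _ => Finset.measurable_fun_sum _ fun m _ => ?_).const_mul _
  exact ((S.cont_q.measurable.comp (hX i)).mul (S.cont_h'.measurable.comp (hX m))).const_mul _

lemma exists_abs_steinFactor_le {Ω : Type*} {X : ℕ → Ω → ℝ} (S : SteinData K q q' h h' h'') (n : ℕ) :
    ∃ M, ∀ ω, |steinFactor q h' R X n ω| ≤ M := by
  refine ⟨(1 / (n : ℝ)) * ∑ i ∈ Finset.Icc 1 n, ∑ m ∈ Finset.Icc 1 n,
    |R (i - m)| * (K * K), fun ω => ?_⟩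
  unfold steinFactor
  have := S.nonneg
  rw [abs_mul, abs_of_nonneg (by positivity)]
  refine mul_le_mul_of_nonneg_left ?_ (by positivity)
  refine (Finset.abs_sum_le_sum_abs _ _).trans (Finset.sum_le_sum fun i _ => ?_)
  refine (Finset.abs_sum_le_sum_abs _ _).trans (Finset.sum_le_sum fun m _ => ?_)
  rw [abs_mul, abs_mul]
  exact mul_le_mul_of_nonneg_left (mul_le_mul (S.bound_q _) (S.bound_h' _) (abs_nonneg _) this)
    (abs_nonneg _)

variable [IsProbabilityMeasure P]

/-- Stein's identity for the normalized sum. -/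
lemma IsStdGaussianSeq.integral_normalizedSum_smul (hX : IsStdGaussianSeq P X R)
    (S : SteinData K q q' h h' h'') (n : ℕ) {φ φ' : ℝ → ℂ} (hφ : ∀ y, HasDerivAt φ (φ' y) y)
    (hφ' : Continuous φ') :
    ∫ ω, normalizedSum h X n ω • φ (normalizedSum h X n ω) ∂P
      = ∫ ω, steinFactor q h' R X n ω • φ' (normalizedSum h X n ω) ∂P := by
  set F := normalizedSum h X n with hF
  have hφc : Continuous φ := continuous_iff_continuousAt.2 fun x => (hφ x).continuousAt
  have mF : Measurable F := measurable_normalizedSum hX.measurable S.cont_h.measurable n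
  have hbd : ∀ {ξ : ℝ → ℂ}, Continuous ξ → ∃ M, ∀ ω, ‖ξ (F ω)‖ ≤ M := by
    intro ξ hξ
    obtain ⟨M, hM⟩ := (isCompact_Icc (a := -(1 / √n * (n * K))) (b := 1 / √n * (n * K))).exists_bound_of_continuousOn
      hξ.continuousOn
    exact ⟨M, fun ω => hM _ (abs_le.1 (abs_normalizedSum_le S.bound_h n ω))⟩
  -- bounded measurable integrands
  have hint : ∀ {ξ : ℝ → ℂ} {Y : Ω → ℝ}, Continuous ξ → Integrable Y P →
      Integrable (fun ω => Y ω • ξ (F ω)) P := by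
    intro ξ Y hξ hY
    obtain ⟨M, hM⟩ := hbd hξ
    simp_rw [Complex.real_smul]
    exact hY.ofReal.mul_bdd (c := M) (hξ.measurable.comp mF).aestronglyMeasurable
      (ae_of_all _ hM)
  have hb1 : ∀ {k : ℝ → ℝ}, Continuous k → (∀ x, |k x| ≤ K) → ∀ i,
      Integrable (fun ω => k (X i ω)) P := fun {k} hk hkK i =>
    Integrable.of_bound (hk.measurable.comp (hX.measurable i)).aestronglyMeasurable K
      (ae_of_all _ fun ω => hkK _)
  have hXq : ∀ i, Integrable (fun ω => X i ω * q (X i ω)) P := fun i =>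
    ((hX.memLp i).integrable (by norm_num)).mul_bdd (c := K)
      (S.cont_q.measurable.comp (hX.measurable i)).aestronglyMeasurable
      (ae_of_all _ fun ω => S.bound_q _)
  have hqh : ∀ i m : ℕ, Integrable (fun ω => R (i - m) * (q (X i ω) * h' (X m ω))) P := fun i m =>
    ((hb1 S.cont_q S.bound_q i).mul_bdd (c := K)
      (S.cont_h'.measurable.comp (hX.measurable m)).aestronglyMeasurable
      (ae_of_all _ fun ω => S.bound_h' _)).const_mul _
  have hterm : ∀ i, ∫ ω, h (X i ω) • φ (F ω) ∂P
      = ∫ ω, (1 / √n * ∑ m ∈ Finset.Icc 1 n, R (i - m) * (q (X i ω) * h' (X m ω)))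
        • φ' (F ω) ∂P := by
    intro i
    have hq'φ := hint hφc (hb1 S.cont_q' S.bound_q' i)
    have hsum : Integrable (fun ω => (1 / √n * ∑ m ∈ Finset.Icc 1 n,
        R (i - m) * (q (X i ω) * h' (X m ω))) • φ' (F ω)) P :=
      hint hφ' ((integrable_finsetSum _ fun m _ => hqh i m).const_mul _)
    -- Each `X m` is rewritten as `R (i - m) * x + w m`, so that the whole sum becomes a function of
    -- `x = X i`. The part of the derivative with `q'` combines with `x q` into `h (X i)`; the chain
    -- rule through the sum yields the `i`-th row of the Stein factor.
    have key := hX.integral_smul_eq i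
      (Φ := fun x w => q x • φ (1 / √n * ∑ m ∈ Finset.Icc 1 n, h (R (i - m) * x + w m)))
      (Φ' := fun x w => q' x • φ (1 / √n * ∑ m ∈ Finset.Icc 1 n, h (R (i - m) * x + w m))
        + (1 / √n * ∑ m ∈ Finset.Icc 1 n, R (i - m) * (q x * h' (R (i - m) * x + w m)))
          • φ' (1 / √n * ∑ m ∈ Finset.Icc 1 n, h (R (i - m) * x + w m)))
      (fun x w => by
        have hS : HasDerivAt
            (fun x => 1 / √n * ∑ m ∈ Finset.Icc 1 n, h (R (i - m) * x + w m))
            (1 / √n * ∑ m ∈ Finset.Icc 1 n, h' (R (i - m) * x + w m) * R (i - m)) x := by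
          refine HasDerivAt.const_mul _ (HasDerivAt.fun_sum fun m _ => ?_)
          refine (S.deriv_h _).comp x ?_
          simpa using ((hasDerivAt_id x).const_mul (R (i - m))).add_const (w m)
        refine ((S.deriv_q x).smul ((hφ _).scomp x hS)).congr_deriv ?_
        rw [add_comm, Function.comp_apply, smul_smul]
        congr 2
        rw [mul_left_comm, Finset.mul_sum]
        congr 1
        exact Finset.sum_congr rfl fun m _ => by ring)
      (by
        have := S.cont_q
        have := S.cont_h
        refine Continuous.stronglyMeasurable ?_
        simp only [Function.uncurry_def]
        fun_prop)
      (by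
        have := S.cont_q
        have := S.cont_q'
        have := S.cont_h
        have := S.cont_h'
        refine Continuous.stronglyMeasurable ?_
        simp only [Function.uncurry_def]
        fun_prop)
      (by
        simp only [add_sub_cancel]
        exact hint hφc (hb1 S.cont_q S.bound_q i))
      (by
        simp only [add_sub_cancel, smul_smul]
        exact hint hφc (hXq i))
      (by
        simp only [add_sub_cancel]
        exact hq'φ.add hsum)
    simp only [add_sub_cancel, smul_smul] at key
    have key2 : ∫ ω, (X i ω * q (X i ω)) • φ (F ω) ∂P
        = ∫ ω, q' (X i ω) • φ (F ω) + (1 / √n * ∑ m ∈ Finset.Icc 1 n,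
        R (i - m) * (q (X i ω) * h' (X m ω))) • φ' (F ω) ∂P := key
    rw [integral_add hq'φ hsum, ← sub_eq_iff_eq_add', ← integral_sub (hint hφc (hXq i)) hq'φ]
      at key2
    rw [← key2]
    congr 1
    ext ω
    rw [← sub_smul, S.eq]
  have e1 : ∀ ω, F ω • φ (F ω) = ∑ i ∈ Finset.Icc 1 n, (1 / √n) • (h (X i ω) • φ (F ω)) := by
    intro ω
    rw [← Finset.smul_sum, ← Finset.sum_smul, smul_smul]
    rfl
  have e2 : ∀ ω, steinFactor q h' R X n ω • φ' (F ω) = ∑ i ∈ Finset.Icc 1 n, (1 / √n) •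
      ((1 / √n * ∑ m ∈ Finset.Icc 1 n, R (i - m) * (q (X i ω) * h' (X m ω))) • φ' (F ω)) := by
    intro ω
    rw [← Finset.smul_sum, ← Finset.sum_smul, smul_smul, ← Finset.mul_sum, ← mul_assoc,
      ← pow_two, div_pow, one_pow, Real.sq_sqrt (Nat.cast_nonneg n)]
    rfl
  simp_rw [e1, e2]
  have i1 : ∀ i ∈ Finset.Icc 1 n, Integrable (fun ω => (1 / √n) • (h (X i ω) • φ (F ω))) P :=
    fun i _ => (hint hφc (hb1 S.cont_h S.bound_h i)).smul (1 / √(n : ℝ))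
  have i2 : ∀ i ∈ Finset.Icc 1 n, Integrable (fun ω => (1 / √n) • ((1 / √n *
      ∑ m ∈ Finset.Icc 1 n, R (i - m) * (q (X i ω) * h' (X m ω))) • φ' (F ω))) P :=
    fun i _ => (hint hφ' ((integrable_finsetSum _ fun m _ => hqh i m).const_mul _)).smul
      (1 / √(n : ℝ))
  rw [integral_finsetSum _ i1, integral_finsetSum _ i2]
  refine Finset.sum_congr rfl fun i _ => ?_
  rw [integral_smul, integral_smul, hterm i]

/-- Integration by parts against `q` itself: `x q` and `q'` have the same Gaussian mean. -/
lemma IsStdGaussianSeq.integral_comp_eq_zero (hX : IsStdGaussianSeq P X R)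
    (S : SteinData K q q' h h' h'') (i : ℕ) : ∫ ω, h (X i ω) ∂P = 0 := by
  have hq : ∀ {k : ℝ → ℝ}, Continuous k → (∀ x, |k x| ≤ K) → Integrable k (gaussianReal 0 1) :=
    fun hk hkK => Integrable.of_bound hk.aestronglyMeasurable K (ae_of_all _ hkK)
  have hxq : Integrable (fun x => x • q x) (gaussianReal 0 1) :=
    ((memLp_id_gaussianReal' 1 (by simp)).integrable le_rfl).mul_bdd (c := K)
      S.cont_q.aestronglyMeasurable (ae_of_all _ S.bound_q)
  have h1 := integral_smul_gaussianReal_eq S.deriv_q (hq S.cont_q S.bound_q) hxq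
    (hq S.cont_q' S.bound_q')
  rw [← integral_map (hX.measurable i).aemeasurable S.cont_h.aestronglyMeasurable, hX.map_eq]
  simp_rw [S.eq]
  simp_rw [smul_eq_mul] at h1 hxq
  rw [integral_sub hxq (hq S.cont_q' S.bound_q'), ← h1]
  simp

end SteinMethod

/-! ### Variance of the Stein factor -/

section SteinVariance

variable {K : ℝ} {q q' h h' h'' : ℝ → ℝ}
variable {Ω : Type*} [MeasurableSpace Ω] {P : Measure Ω} {X : ℕ → Ω → ℝ} {R : ℤ → ℝ}

/-- The quadratic forms of the covariance matrices are bounded by `B`. -/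
def QuadFormLE (R : ℤ → ℝ) (B : ℝ) : Prop :=
  ∀ (s : Finset ℕ) (v : s → ℝ), ∑ a, ∑ b, v a * v b * R ((a : ℕ) - (b : ℕ)) ≤ B * ∑ a, v a ^ 2

lemma IsStdGaussianSeq.integral_sq_sum (hX : IsStdGaussianSeq P X R) (s : Finset ℕ)
    (v : s → ℝ) : ∫ ω, (∑ a, v a * X a ω) ^ 2 ∂P
      = ∑ a, ∑ b, v a * v b * R ((a : ℕ) - (b : ℕ)) := by
  have e : ∀ ω, (∑ a, v a * X a ω) ^ 2 = ∑ a, ∑ b, v a * v b * (X a ω * X b ω) := by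
    intro ω
    rw [pow_two, Finset.sum_mul_sum]
    exact Finset.sum_congr rfl fun a _ => Finset.sum_congr rfl fun b _ => by ring
  have hi : ∀ a b : s, Integrable (fun ω => v a * v b * (X a ω * X b ω)) P := fun a b =>
    ((hX.memLp a).integrable_mul (hX.memLp b)).const_mul _
  simp_rw [e]
  rw [integral_finsetSum _ fun a _ => integrable_finsetSum _ fun b _ => hi a b]
  refine Finset.sum_congr rfl fun a _ => ?_
  rw [integral_finsetSum _ fun b _ => hi a b]
  exact Finset.sum_congr rfl fun b _ => by rw [integral_const_mul, hX.corr]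

lemma IsStdGaussianSeq.corr_symm (hX : IsStdGaussianSeq P X R) (i m : ℕ) :
    R (i - m) = R (m - i) := by
  rw [← hX.corr, ← hX.corr]
  simp_rw [mul_comm]

-- The Poincaré inequality is applied to `V` as a function of `X 1, …, X n`. By symmetry of the
-- Toeplitz matrix `A`, the gradient of `V` is `n⁻¹ (q' · A h' + h'' · A q)`. Since `A` enlarges
-- norms by at most `B`, the squared length of the gradient is at most `n⁻² · 2 K² · 2 B² n K² = 4
-- K⁴ B² / n`.
set_option maxHeartbeats 1000000 in
lemma IsStdGaussianSeq.variance_steinFactor_le [IsProbabilityMeasure P]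
    (hX : IsStdGaussianSeq P X R) (S : SteinData K q q' h h' h'') {B : ℝ} (hB0 : 0 < B)
    (hB : QuadFormLE R B) {n : ℕ} (hn : 0 < n) :
    variance (steinFactor q h' R X n) P ≤ Real.pi ^ 2 / 8 * B * (4 * K ^ 4 * B ^ 2 / n) := by
  have hn' : (0 : ℝ) < n := by exact_mod_cast hn
  set I := Finset.Icc 1 n with hI
  have hcard : (Fintype.card I : ℝ) = n := by simp [hI]
  let A : I → I → ℝ := fun a b => R ((a : ℕ) - (b : ℕ))
  have hA : ∀ (k : ℝ → ℝ) (_ : ∀ x, |k x| ≤ K) (x : I → ℝ),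
      ∑ a, (∑ b, A a b * k (x b)) ^ 2 ≤ B ^ 2 * (n * K ^ 2) := by
    intro k hk x
    refine (sum_sq_apply_le_of_quadForm_le (A := A) hB0 (fun a b => hX.corr_symm a b)
      (fun v => ?_) (hB I) fun b => k (x b)).trans ?_
    · rw [← hX.integral_sq_sum]
      exact integral_nonneg fun ω => sq_nonneg _
    · gcongr
      calc ∑ a, k (x a) ^ 2 ≤ ∑ _a : I, K ^ 2 := Finset.sum_le_sum fun a _ => by
            rw [← sq_abs]
            exact pow_le_pow_left₀ (abs_nonneg _) (hk _) 2
        _ = n * K ^ 2 := by rw [Finset.sum_const, nsmul_eq_mul, Finset.card_univ, hcard]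
  set Y : Ω → I → ℝ := fun ω a => X a ω with hY
  have mY : Measurable Y := measurable_pi_lambda _ fun a => hX.measurable a
  have hG : IsGaussian (P.map Y) := (hX.gaussian.hasGaussianLaw I).isGaussian_map
  let Φ : (I → ℝ) → ℝ := fun x => (1 / (n : ℝ)) * ∑ i, ∑ m, A i m * (q (x i) * h' (x m))
  let G : I → (I → ℝ) → ℝ := fun a x => (1 / (n : ℝ)) *
    (q' (x a) * ∑ m, A a m * h' (x m) + h'' (x a) * ∑ i, A a i * q (x i))
  have hΦY : steinFactor q h' R X n = Φ ∘ Y := by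
    ext ω
    simp only [steinFactor, Φ, Function.comp, hY, A]
    congr 1
    rw [← hI, ← Finset.sum_coe_sort]
    exact Finset.sum_congr rfl fun a _ => by rw [← Finset.sum_coe_sort]
  have hc1 := S.cont_q
  have hc2 := S.cont_q'
  have hc3 := S.cont_h'
  have hc4 := S.cont_h''
  have hd : ∀ x, HasFDerivAt Φ
      (∑ a, G a x • (ContinuousLinearMap.proj a : (I → ℝ) →L[ℝ] ℝ)) x := by
    intro x
    have hp : ∀ a : I, HasFDerivAt (fun x : I → ℝ => x a)
        (ContinuousLinearMap.proj a : (I → ℝ) →L[ℝ] ℝ) x := fun a => hasFDerivAt_apply a x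
    have h1 : HasFDerivAt Φ ((1 / (n : ℝ)) • ∑ i, ∑ m, A i m •
        (q (x i) • (h'' (x m) • (ContinuousLinearMap.proj m : (I → ℝ) →L[ℝ] ℝ))
          + h' (x m) • (q' (x i) • (ContinuousLinearMap.proj i : (I → ℝ) →L[ℝ] ℝ)))) x := by
      refine HasFDerivAt.const_mul ?_ _
      refine HasFDerivAt.fun_sum fun i _ => HasFDerivAt.fun_sum fun m _ =>
        HasFDerivAt.const_mul ?_ _
      exact ((S.deriv_q (x i)).comp_hasFDerivAt x (hp i)).mul
        ((S.deriv_h' (x m)).comp_hasFDerivAt x (hp m))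
    refine h1.congr_fderiv ?_
    ext y
    simp only [smul_apply, sum_apply,
      add_apply, ContinuousLinearMap.proj_apply, smul_eq_mul, G]
    simp only [mul_add, add_mul, Finset.sum_add_distrib, Finset.mul_sum, Finset.sum_mul]
    rw [add_comm]
    congr 1
    · exact Finset.sum_congr rfl fun i _ => Finset.sum_congr rfl fun m _ => by ring
    · rw [Finset.sum_comm]
      refine Finset.sum_congr rfl fun i _ => Finset.sum_congr rfl fun m _ => ?_
      rw [show A m i = A i m from hX.corr_symm m i]
      ring
  have hΦb : ∀ x, |Φ x| ≤ (1 / (n : ℝ)) * ∑ i, ∑ m, |A i m| * (K * K) := by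
    intro x
    rw [abs_mul, abs_of_nonneg (by positivity)]
    refine mul_le_mul_of_nonneg_left ?_ (by positivity)
    refine (Finset.abs_sum_le_sum_abs _ _).trans (Finset.sum_le_sum fun i _ => ?_)
    refine (Finset.abs_sum_le_sum_abs _ _).trans (Finset.sum_le_sum fun m _ => ?_)
    rw [abs_mul, abs_mul]
    exact mul_le_mul_of_nonneg_left
      (mul_le_mul (S.bound_q _) (S.bound_h' _) (abs_nonneg _) S.nonneg) (abs_nonneg _)
  have hGc : ∀ a, Continuous (G a) := fun a => by fun_prop
  have hGs : ∀ x, ∑ a, G a x ^ 2 ≤ 4 * K ^ 4 * B ^ 2 / n := by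
    intro x
    have hKsq : ∀ {k : ℝ → ℝ} (_ : ∀ x, |k x| ≤ K) (y : ℝ), k y ^ 2 ≤ K ^ 2 := fun hk y => by
      rw [← sq_abs]
      exact pow_le_pow_left₀ (abs_nonneg _) (hk _) 2
    calc ∑ a, G a x ^ 2 ≤ ∑ a, (2 * (1 / (n : ℝ)) ^ 2 * K ^ 2) *
          ((∑ m, A a m * h' (x m)) ^ 2 + (∑ i, A a i * q (x i)) ^ 2) := by
          refine Finset.sum_le_sum fun a _ => ?_
          simp only [G]
          rw [mul_pow, show 2 * (1 / (n : ℝ)) ^ 2 * K ^ 2 = (1 / (n : ℝ)) ^ 2 * (2 * K ^ 2) by ring,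
            mul_assoc]
          refine mul_le_mul_of_nonneg_left ?_ (sq_nonneg _)
          refine add_sq_le.trans ?_
          rw [mul_pow, mul_pow, mul_assoc]
          refine mul_le_mul_of_nonneg_left ?_ zero_le_two
          rw [mul_add]
          exact add_le_add
            (mul_le_mul_of_nonneg_right (hKsq S.bound_q' _) (sq_nonneg _))
            (mul_le_mul_of_nonneg_right (hKsq S.bound_h'' _) (sq_nonneg _))
      _ ≤ (2 * (1 / (n : ℝ)) ^ 2 * K ^ 2) * (B ^ 2 * (n * K ^ 2) + B ^ 2 * (n * K ^ 2)) := by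
          rw [← Finset.mul_sum, Finset.sum_add_distrib]
          refine mul_le_mul_of_nonneg_left ?_ (by positivity)
          exact add_le_add (hA h' S.bound_h' x) (hA q S.bound_q x)
      _ = _ := by
          field_simp
          ring
  have hGb : ∀ a, ∃ L, ∀ x, |G a x| ≤ L := by
    intro a
    refine ⟨√(4 * K ^ 4 * B ^ 2 / n), fun x => Real.abs_le_sqrt ((?_ : _ ≤ _).trans (hGs x))⟩
    exact Finset.single_le_sum (f := fun a => G a x ^ 2) (fun a _ => sq_nonneg _)
      (Finset.mem_univ a)
  have hpo := variance_le_of_isGaussian (μ := P.map Y)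
    (fun a => by
      rw [integral_map mY.aemeasurable (Continuous.aestronglyMeasurable (by fun_prop))]
      exact hX.mean_zero a) hB0.le
    (fun v => by
      rw [integral_map mY.aemeasurable (Continuous.aestronglyMeasurable (by fun_prop))]
      rw [hX.integral_sq_sum]
      exact hB I v) hd hGc ⟨_, hΦb⟩ hGb
  have hΦm : Continuous Φ := by fun_prop
  rw [hΦY, ← variance_map hΦm.aestronglyMeasurable.aemeasurable mY.aemeasurable]
  refine hpo.trans (mul_le_mul_of_nonneg_left ?_ (by positivity))
  have : IsProbabilityMeasure (P.map Y) := hG.toIsProbabilityMeasure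
  calc ∫ x, ∑ a, G a x ^ 2 ∂(P.map Y) ≤ ∫ _x, 4 * K ^ 4 * B ^ 2 / n ∂(P.map Y) := by
        refine integral_mono_of_nonneg (ae_of_all _ fun x => Finset.sum_nonneg fun a _ =>
          sq_nonneg _) (integrable_const _) (ae_of_all _ hGs)
    _ = _ := by simp

end SteinVariance

/-! ### From Stein's identity to characteristic functions -/

section CharFun

variable {K : ℝ} {q q' h h' h'' : ℝ → ℝ}
variable {Ω : Type*} [MeasurableSpace Ω] {P : Measure Ω} [IsProbabilityMeasure P]
  {X : ℕ → Ω → ℝ} {R : ℤ → ℝ}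

/-- Nonnegativity of the variance of `|V - E V|`. -/
lemma integral_abs_sub_integral_le {V : Ω → ℝ} (hV : MemLp V 2 P) :
    ∫ ω, |V ω - ∫ ω, V ω ∂P| ∂P ≤ √(variance V P) := by
  refine Real.le_sqrt_of_sq_le ?_
  have hm : MemLp (fun ω => V ω - ∫ ω, V ω ∂P) 2 P := hV.sub (memLp_const _)
  have h := variance_nonneg |fun ω => V ω - ∫ ω, V ω ∂P| P
  rw [variance_eq_sub hm.abs] at h
  rw [variance_eq_integral hV.aemeasurable]
  simpa [sq_abs] using h

lemma hasDerivAt_cexp_mul_I (s y : ℝ) :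
    HasDerivAt (fun y : ℝ => Complex.exp (s * y * Complex.I))
      (s * Complex.I * Complex.exp (s * y * Complex.I)) y := by
  have h0 : HasDerivAt (fun y : ℝ => (s : ℂ) * y * Complex.I) (s * Complex.I) y := by
    simpa using ((Complex.ofRealCLM.hasDerivAt (x := y)).const_mul (s : ℂ)).mul_const Complex.I
  refine h0.cexp.congr_deriv ?_
  ring

/-- Stein's estimate of the characteristic function: if `E[F φ(F)] = E[V φ'(F)]` for smooth `φ`,
then `F` is close to the Gaussian law with variance `E[V]`. -/
lemma norm_charFun_sub_le_of_stein {F V : Ω → ℝ} (mF : Measurable F) {M : ℝ}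
    (hFb : ∀ ω, |F ω| ≤ M) (hV : MemLp V 2 P) (hv : 0 ≤ ∫ ω, V ω ∂P)
    (hst : ∀ φ φ' : ℝ → ℂ, (∀ y, HasDerivAt φ (φ' y) y) → Continuous φ' →
      ∫ ω, F ω • φ (F ω) ∂P = ∫ ω, V ω • φ' (F ω) ∂P) (t : ℝ) :
    ‖charFun (P.map F) t - Complex.exp (-((∫ ω, V ω ∂P : ℝ) * t ^ 2 / 2 : ℂ))‖
      ≤ t ^ 2 * √(variance V P) := by
  set v := ∫ ω, V ω ∂P with hvdef
  set δ := √(variance V P) with hδ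
  have hδ0 : 0 ≤ δ := Real.sqrt_nonneg _
  have hVi : Integrable V P := hV.integrable (by norm_num)
  let E : ℝ → Ω → ℂ := fun s ω => Complex.exp (s * F ω * Complex.I)
  have mE : ∀ s, Measurable (E s) := fun s => by
    simp only [E]
    fun_prop
  have hE1 : ∀ s ω, ‖E s ω‖ = 1 := fun s ω => by
    simp only [E]
    rw [← Complex.ofReal_mul, Complex.norm_exp_ofReal_mul_I]
  have hEi : ∀ s, Integrable (E s) P := fun s =>
    Integrable.of_bound (mE s).aestronglyMeasurable 1 (ae_of_all _ fun ω => (hE1 s ω).le)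
  have hVE : ∀ s, Integrable (fun ω => (V ω : ℂ) * E s ω) P := fun s =>
    hVi.ofReal.mul_bdd (c := 1) (mE s).aestronglyMeasurable (ae_of_all _ fun ω => (hE1 s ω).le)
  let ψ : ℝ → ℂ := fun s => ∫ ω, E s ω ∂P
  -- Differentiation under the integral gives `E[i F e^{isF}]`; Stein's identity with `φ y =
  -- e^{isy}` turns it into `-s E[V e^{isF}]`.
  have hψ : ∀ s, HasDerivAt ψ (-s * ∫ ω, (V ω : ℂ) * E s ω ∂P) s := by
    intro s
    have h1 := (hasDerivAt_integral_of_dominated_loc_of_deriv_le (μ := P) (F := E)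
      (F' := fun s ω => F ω * Complex.I * E s ω) (bound := fun _ => M) (x₀ := s)
      (s := Set.univ) Filter.univ_mem (Eventually.of_forall fun s => (mE s).aestronglyMeasurable)
      (hEi s) (by
        refine Measurable.aestronglyMeasurable ?_
        have := mE s
        fun_prop)
      (ae_of_all _ fun ω s _ => by
        rw [norm_mul, norm_mul, hE1, Complex.norm_I, mul_one, mul_one, Complex.norm_real]
        exact hFb ω) (integrable_const M)
      (ae_of_all _ fun ω s _ => by
        have h := hasDerivAt_cexp_mul_I (F ω) s
        simp only [E]
        simpa only [mul_comm ((F ω : ℝ) : ℂ) ((_ : ℝ) : ℂ)] using h)).2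
    refine h1.congr_deriv ?_
    have h2 := hst (fun y => Complex.exp (s * y * Complex.I))
      (fun y => s * Complex.I * Complex.exp (s * y * Complex.I))
      (fun y => hasDerivAt_cexp_mul_I s y) (by fun_prop)
    calc ∫ ω, F ω * Complex.I * E s ω ∂P
        = Complex.I * ∫ ω, F ω • Complex.exp (s * F ω * Complex.I) ∂P := by
          rw [← integral_const_mul]
          congr 1
          ext ω
          rw [Complex.real_smul]
          ring
      _ = Complex.I * ∫ ω, V ω • (s * Complex.I * Complex.exp (s * F ω * Complex.I)) ∂P := by
          rw [h2]
      _ = _ := by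
          rw [← integral_const_mul, ← integral_const_mul]
          congr 1
          ext ω
          rw [Complex.real_smul]
          linear_combination (s * V ω * E s ω) * Complex.I_mul_I
  let g : ℝ → ℂ := fun s => Complex.exp ((v * s ^ 2 / 2 : ℝ) : ℂ)
  have hg : ∀ s, HasDerivAt g (v * s * g s) s := by
    intro s
    have h0 : HasDerivAt (fun s : ℝ => v * s ^ 2 / 2) (v * s) s := by
      refine (((hasDerivAt_pow 2 s).const_mul v).div_const 2).congr_deriv ?_
      norm_num
      ring
    refine h0.ofReal_comp.cexp.congr_deriv ?_
    simp only [g]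
    push_cast
    ring
  -- `g` is the integrating factor of `ψ' = -v s ψ`, the equation obtained for constant `V`. What
  -- remains of the derivative is the fluctuation of `V` about `v`, bounded in `L¹` by `δ`. The mean
  -- value inequality on the segment from `0` to `t` gives `t² g(t) δ`, and division by `g(t)`
  -- removes the exponential.
  have hχ : ∀ s, HasDerivAt (fun s => ψ s * g s)
      (s * g s * ∫ ω, ((v - V ω : ℝ) : ℂ) * E s ω ∂P) s := by
    intro s
    refine ((hψ s).mul (hg s)).congr_deriv ?_
    have : ∫ ω, ((v - V ω : ℝ) : ℂ) * E s ω ∂P = v * ψ s - ∫ ω, (V ω : ℂ) * E s ω ∂P := by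
      simp only [ψ]
      rw [← integral_const_mul, ← integral_sub ((hEi s).const_mul _) (hVE s)]
      congr 1
      ext ω
      push_cast
      ring
    rw [this]
    ring
  have hgn : ∀ s, ‖g s‖ = Real.exp (v * s ^ 2 / 2) := fun s => by
    simp only [g]
    rw [Complex.norm_exp, Complex.ofReal_re]
  have hbound : ∀ s ∈ Set.uIcc 0 t, ‖s * g s * ∫ ω, ((v - V ω : ℝ) : ℂ) * E s ω ∂P‖
      ≤ |t| * Real.exp (v * t ^ 2 / 2) * δ := by
    intro s hs
    have hst : |s| ≤ |t| := by
      have := Set.abs_sub_left_of_mem_uIcc hs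
      simpa using this
    rw [norm_mul, norm_mul, hgn, Complex.norm_real, Real.norm_eq_abs]
    have h3 : ‖∫ ω, ((v - V ω : ℝ) : ℂ) * E s ω ∂P‖ ≤ δ := by
      refine (norm_integral_le_integral_norm _).trans ?_
      refine (le_of_eq ?_).trans (integral_abs_sub_integral_le hV)
      congr 1
      ext ω
      rw [norm_mul, hE1, mul_one, Complex.norm_real, Real.norm_eq_abs, abs_sub_comm]
    have h4 : s ^ 2 ≤ t ^ 2 := sq_le_sq.2 hst
    gcongr
  have hmv := (convex_uIcc 0 t).norm_image_sub_le_of_norm_hasDerivWithin_le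
    (fun s _ => (hχ s).hasDerivWithinAt) hbound Set.left_mem_uIcc Set.right_mem_uIcc
  have hψ0 : ψ 0 * g 0 = 1 := by simp [ψ, g, E]
  rw [hψ0, sub_zero, Real.norm_eq_abs] at hmv
  have hchar : charFun (P.map F) t = ψ t := by
    rw [charFun_apply_real, integral_map mF.aemeasurable (by fun_prop)]
  have hgi : Complex.exp (-((v : ℝ) * t ^ 2 / 2 : ℂ)) = (g t)⁻¹ := by
    simp only [g]
    rw [← Complex.exp_neg]
    push_cast
    rfl
  have hgt : g t ≠ 0 := Complex.exp_ne_zero _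
  rw [hchar, hgi, show ψ t - (g t)⁻¹ = (ψ t * g t - 1) * (g t)⁻¹ by field_simp, norm_mul,
    norm_inv, hgn]
  have hpos := Real.exp_pos (v * t ^ 2 / 2)
  rw [← div_eq_mul_inv, div_le_iff₀ hpos]
  refine hmv.trans (le_of_eq ?_)
  rw [← sq_abs t]
  ring

lemma IsStdGaussianSeq.memLp_normalizedSum (hX : IsStdGaussianSeq P X R)
    (hh : MemLp h 2 (gaussianReal 0 1)) (n : ℕ) : MemLp (normalizedSum h X n) 2 P := by
  have := memLp_finsetSum (Finset.Icc 1 n) (p := 2) (μ := P) (f := fun i ω => h (X i ω))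
    fun i _ => hh.comp_measurePreserving (hX.measurePreserving i)
  exact this.const_mul (1 / √(n : ℝ))

/-- Quantitative central limit theorem for normalized sums of smooth functions. -/
lemma IsStdGaussianSeq.norm_charFun_normalizedSum_sub_le (hX : IsStdGaussianSeq P X R)
    (S : SteinData K q q' h h' h'') {B : ℝ} (hB0 : 0 < B) (hB : QuadFormLE R B) {n : ℕ}
    (hn : 0 < n) (t : ℝ) :
    ‖charFun (P.map (normalizedSum h X n)) t
        - Complex.exp (-((variance (normalizedSum h X n) P : ℝ) * t ^ 2 / 2 : ℂ))‖
      ≤ t ^ 2 * √(Real.pi ^ 2 / 8 * B * (4 * K ^ 4 * B ^ 2 / n)) := by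
  have hV : MemLp (steinFactor q h' R X n) 2 P := by
    obtain ⟨M, hM⟩ := exists_abs_steinFactor_le (R := R) (X := X) S n
    exact MemLp.of_bound (measurable_steinFactor S hX.measurable n).aestronglyMeasurable M
      (ae_of_all _ hM)
  have hh : MemLp h 2 (gaussianReal 0 1) :=
    MemLp.of_bound S.cont_h.aestronglyMeasurable K (ae_of_all _ S.bound_h)
  have mF : Measurable (normalizedSum h X n) :=
    measurable_normalizedSum hX.measurable S.cont_h.measurable n
  have hmean : ∫ ω, normalizedSum h X n ω ∂P = 0 := by
    unfold normalizedSum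
    rw [integral_const_mul, integral_finsetSum]
    · simp [hX.integral_comp_eq_zero S]
    · exact fun i _ => (hh.comp_measurePreserving (hX.measurePreserving i)).integrable
        (by norm_num)
  -- Stein's identity with `φ` the identity: `E[F²] = E[V]`, so the Gaussian to compare with has
  -- exactly the variance of `F`.
  have hvar : variance (normalizedSum h X n) P = ∫ ω, steinFactor q h' R X n ω ∂P := by
    rw [variance_eq_sub (hX.memLp_normalizedSum hh n), hmean]
    have := hX.integral_normalizedSum_smul S n (φ := fun y => (y : ℂ)) (φ' := fun _ => 1)
      (fun y => Complex.ofRealCLM.hasDerivAt) continuous_const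
    simp only [Complex.real_smul, mul_one, ← Complex.ofReal_mul] at this
    rw [integral_complex_ofReal, integral_complex_ofReal, Complex.ofReal_inj] at this
    rw [← this]
    simp [pow_two]
  rw [hvar]
  refine (norm_charFun_sub_le_of_stein mF (abs_normalizedSum_le S.bound_h n) hV
    (hvar ▸ variance_nonneg _ _)
    (fun φ φ' hφ hφ' => hX.integral_normalizedSum_smul S n hφ hφ') t).trans ?_
  exact mul_le_mul_of_nonneg_left
    (Real.sqrt_le_sqrt (hX.variance_steinFactor_le S hB0 hB hn)) (sq_nonneg t)

end CharFun

/-! ### Trigonometric moments, Parseval's identity and Toeplitz forms -/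

section Fourier

/-- Lebesgue measure on `(-π, π]`. -/
noncomputable def circleMeasure : Measure ℝ := volume.restrict (Set.Ioc (-Real.pi) Real.pi)

instance : IsFiniteMeasure circleMeasure := by
  unfold circleMeasure
  infer_instance

lemma intervalIntegral_eq_circleMeasure {E : Type*} [NormedAddCommGroup E] [NormedSpace ℝ E]
    (f : ℝ → E) : ∫ x in (-Real.pi)..Real.pi, f x = ∫ x, f x ∂circleMeasure :=
  intervalIntegral.integral_of_le (by linarith [Real.pi_pos])

lemma circleMeasure_real_univ : circleMeasure.real Set.univ = 2 * Real.pi := by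
  have : 0 ≤ Real.pi + Real.pi := by linarith [Real.pi_pos]
  simp [circleMeasure, measureReal_def, ENNReal.toReal_ofReal this]
  ring

lemma ae_circleMeasure_mem_Ioo : ∀ᵐ x ∂circleMeasure, x ∈ Set.Ioo (-Real.pi) Real.pi := by
  have : circleMeasure = volume.restrict (Set.Ioo (-Real.pi) Real.pi) :=
    Measure.restrict_congr_set Ioo_ae_eq_Ioc.symm
  rw [this]
  exact ae_restrict_mem measurableSet_Ioo

/-- The real function `f` is measurable and bounded on `(-π, π]` up to null sets. -/
structure IsCircleBounded (f : ℝ → ℝ) : Prop where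
  aesm : AEStronglyMeasurable f circleMeasure
  bdd : ∃ C, ∀ᵐ x ∂circleMeasure, |f x| ≤ C

/-- `R` is the sequence of trigonometric moments of `f`. -/
def HasTrigMoments (f : ℝ → ℝ) (R : ℤ → ℝ) : Prop :=
  ∀ k : ℤ, ∫ x, Complex.exp (Complex.I * x * k) * f x ∂circleMeasure = (R k : ℂ)

namespace IsCircleBounded

variable {f f' : ℝ → ℝ}

lemma memLp (hf : IsCircleBounded f) (p : ENNReal) : MemLp f p circleMeasure := by
  obtain ⟨C, hC⟩ := hf.bdd
  exact MemLp.of_bound hf.aesm C hC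

lemma integrable (hf : IsCircleBounded f) : Integrable f circleMeasure :=
  memLp_one_iff_integrable.1 (hf.memLp 1)

lemma sub (hf : IsCircleBounded f) (hf' : IsCircleBounded f') :
    IsCircleBounded (fun x => f x - f' x) := by
  obtain ⟨C, hC⟩ := hf.bdd
  obtain ⟨C', hC'⟩ := hf'.bdd
  refine ⟨hf.aesm.sub hf'.aesm, C + C', ?_⟩
  filter_upwards [hC, hC'] with x h h'
  exact (abs_sub _ _).trans (add_le_add h h')

lemma add (hf : IsCircleBounded f) (hf' : IsCircleBounded f') :
    IsCircleBounded (fun x => f x + f' x) := by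
  obtain ⟨C, hC⟩ := hf.bdd
  obtain ⟨C', hC'⟩ := hf'.bdd
  refine ⟨hf.aesm.add hf'.aesm, C + C', ?_⟩
  filter_upwards [hC, hC'] with x h h'
  exact (abs_add_le _ _).trans (add_le_add h h')

lemma bounded_mul (hf : IsCircleBounded f) {φ : ℝ → ℂ} (hφ : Continuous φ) :
    Integrable (fun x => φ x * f x) circleMeasure := by
  obtain ⟨M, hM⟩ := (isCompact_Icc (a := -Real.pi) (b := Real.pi)).exists_bound_of_continuousOn
    hφ.continuousOn
  refine Integrable.bdd_mul (c := M) hf.integrable.ofReal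
    hφ.measurable.aestronglyMeasurable ?_
  filter_upwards [ae_circleMeasure_mem_Ioo] with x hx
  exact hM x (Set.Ioo_subset_Icc_self hx)

end IsCircleBounded

lemma continuous_character (k : ℤ) : Continuous fun x : ℝ => Complex.exp (Complex.I * x * k) := by
  fun_prop

lemma norm_character (x : ℝ) (k : ℤ) : ‖Complex.exp (Complex.I * x * k)‖ = 1 := by
  rw [show Complex.I * x * k = ((x * k : ℝ) : ℂ) * Complex.I by push_cast; ring,
    Complex.norm_exp_ofReal_mul_I]

namespace HasTrigMoments

variable {f f' : ℝ → ℝ} {R R' : ℤ → ℝ}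

lemma sub (hf : IsCircleBounded f) (hf' : IsCircleBounded f') (h : HasTrigMoments f R)
    (h' : HasTrigMoments f' R') :
    HasTrigMoments (fun x => f x - f' x) (fun k => R k - R' k) := by
  intro k
  rw [Complex.ofReal_sub, ← h k, ← h' k, ← integral_sub (hf.bounded_mul (continuous_character k))
    (hf'.bounded_mul (continuous_character k))]
  congr 1
  ext x
  push_cast
  ring

lemma add (hf : IsCircleBounded f) (hf' : IsCircleBounded f') (h : HasTrigMoments f R)
    (h' : HasTrigMoments f' R') :
    HasTrigMoments (fun x => f x + f' x) (fun k => R k + R' k) := by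
  intro k
  rw [Complex.ofReal_add, ← h k, ← h' k, ← integral_add (hf.bounded_mul (continuous_character k))
    (hf'.bounded_mul (continuous_character k))]
  congr 1
  ext x
  push_cast
  ring

/-- **Parseval's identity**. -/
lemma hasSum_sq (hf : IsCircleBounded f) (h : HasTrigMoments f R) :
    HasSum (fun k => R k ^ 2) (2 * Real.pi * ∫ x, f x ^ 2 ∂circleMeasure) := by
  have hpi := Real.pi_pos
  have hab : -Real.pi < Real.pi := by linarith
  have hp := hasSum_sq_fourierCoeffOn hab (f := fun x => (f x : ℂ)) (hf.memLp 2).ofReal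
  have hc : ∀ k : ℤ, fourierCoeffOn hab (fun x => (f x : ℂ)) k
      = ((2 * Real.pi)⁻¹ : ℝ) * (R (-k) : ℂ) := by
    intro k
    rw [fourierCoeffOn_eq_integral, intervalIntegral_eq_circleMeasure, ← h (-k),
      Complex.real_smul]
    congr 1
    · rw [sub_neg_eq_add, ← two_mul, one_div]
    · congr 1
      ext x
      rw [fourier_coe_apply, smul_eq_mul]
      congr 2
      push_cast
      have : (Real.pi : ℂ) ≠ 0 := by exact_mod_cast hpi.ne'
      field_simp
      ring
  have hp2 := (Equiv.neg ℤ).hasSum_iff.2 hp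
  have hp3 := hp2.mul_left ((2 * Real.pi) ^ 2)
  rw [intervalIntegral_eq_circleMeasure] at hp3
  convert! hp3 using 1
  · ext k
    simp only [Function.comp, Equiv.neg_apply, hc, neg_neg, norm_mul, Complex.norm_real,
      Real.norm_eq_abs]
    rw [mul_pow, mul_pow, sq_abs, sq_abs]
    field_simp
  · simp only [Complex.norm_real, Real.norm_eq_abs, sq_abs, smul_eq_mul]
    rw [sub_neg_eq_add, ← two_mul]
    field_simp

/-- Polarization of Parseval's identity; evenness of the moments, which are real, makes complex
conjugates superfluous. -/
lemma hasSum_mul (hf : IsCircleBounded f) (hf' : IsCircleBounded f') (h : HasTrigMoments f R)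
    (h' : HasTrigMoments f' R') :
    HasSum (fun k => R k * R' k) (2 * Real.pi * ∫ x, f x * f' x ∂circleMeasure) := by
  have h1 := (h.add hf hf' h').hasSum_sq (hf.add hf')
  have h2 := (h.sub hf hf' h').hasSum_sq (hf.sub hf')
  have h3 := (h1.sub h2).mul_left (1 / 4)
  convert! h3 using 1
  · ext k
    ring
  · have e : ∫ x, (f x + f' x) ^ 2 ∂circleMeasure - ∫ x, (f x - f' x) ^ 2 ∂circleMeasure
        = 4 * ∫ x, f x * f' x ∂circleMeasure := by
      rw [← integral_sub ((hf.add hf').memLp 2).integrable_sq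
        ((hf.sub hf').memLp 2).integrable_sq, ← integral_const_mul]
      refine integral_congr_ae (ae_of_all _ fun x => ?_)
      simp only
      ring
    linear_combination -(Real.pi / 2) * e

lemma neg_eq (h : HasTrigMoments f R) (k : ℤ) : R (-k) = R k := by
  have h1 := h (-k)
  have h2 := congrArg (starRingEnd ℂ) (h k)
  rw [← integral_conj, Complex.conj_ofReal] at h2
  rw [← Complex.ofReal_inj, ← h1, ← h2]
  refine integral_congr_ae (ae_of_all _ fun x => ?_)
  simp only
  rw [map_mul, ← Complex.exp_conj]
  simp

/-- The quadratic forms of the Toeplitz matrices of the trigonometric moments. -/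
lemma sum_sum_eq_integral (hf : IsCircleBounded f) (h : HasTrigMoments f R) {ι : Type*}
    (s : Finset ι) (p : ι → ℤ) (v : ι → ℝ) :
    ∑ a ∈ s, ∑ b ∈ s, v a * v b * R (p a - p b)
      = ∫ x, ‖∑ a ∈ s, (v a : ℂ) * Complex.exp (Complex.I * x * p a)‖ ^ 2 * f x
        ∂circleMeasure := by
  rw [← Complex.ofReal_inj, ← integral_complex_ofReal]
  push_cast
  have e : ∀ x : ℝ, ((‖∑ a ∈ s, (v a : ℂ) * Complex.exp (Complex.I * x * p a)‖ : ℝ) : ℂ) ^ 2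
      * f x = ∑ a ∈ s, ∑ b ∈ s, (v a * v b : ℂ)
        * (Complex.exp (Complex.I * x * (p a - p b : ℤ)) * f x) := by
    intro x
    rw [← Complex.mul_conj', map_sum, Finset.sum_mul_sum, Finset.sum_mul]
    refine Finset.sum_congr rfl fun a _ => ?_
    rw [Finset.sum_mul]
    refine Finset.sum_congr rfl fun b _ => ?_
    rw [map_mul, ← Complex.exp_conj]
    simp only [map_mul, Complex.conj_I, Complex.conj_ofReal]
    rw [show Complex.I * x * ((p a - p b : ℤ) : ℂ)
      = Complex.I * x * p a + -Complex.I * x * p b by push_cast; ring, Complex.exp_add]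
    simp only [map_intCast]
    ring
  simp_rw [e]
  have hi : ∀ a b, Integrable (fun x : ℝ => (v a * v b : ℂ)
      * (Complex.exp (Complex.I * x * (p a - p b : ℤ)) * f x)) circleMeasure := fun a b =>
    (hf.bounded_mul (continuous_character (p a - p b))).const_mul _
  rw [integral_finsetSum _ fun a _ => integrable_finsetSum _ fun b _ => hi a b]
  refine Finset.sum_congr rfl fun a _ => ?_
  rw [integral_finsetSum _ fun b _ => hi a b]
  refine Finset.sum_congr rfl fun b _ => ?_
  rw [integral_const_mul, h (p a - p b)]

end HasTrigMoments

lemma isCircleBounded_const (c : ℝ) : IsCircleBounded fun _ => c :=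
  ⟨aestronglyMeasurable_const, |c|, ae_of_all _ fun _ => le_rfl⟩

lemma hasTrigMoments_one : HasTrigMoments (fun _ => 1) (fun k => if k = 0 then 2 * Real.pi else 0) := by
  intro k
  simp only
  split_ifs with h
  · subst h
    simp [circleMeasure_real_univ]
  · have hk : (k : ℂ) ≠ 0 := by exact_mod_cast h
    rw [← intervalIntegral_eq_circleMeasure]
    have e : ∀ x : ℝ, Complex.exp (Complex.I * x * k) * ((1 : ℝ) : ℂ)
        = Complex.exp ((Complex.I * k) * x) := by
      intro x
      rw [Complex.ofReal_one, mul_one]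
      congr 1
      ring
    simp_rw [e]
    rw [integral_exp_mul_complex (mul_ne_zero Complex.I_ne_zero hk)]
    have e2 : Complex.exp (Complex.I * k * (Real.pi : ℝ))
        = Complex.exp (Complex.I * k * ((-Real.pi : ℝ) : ℂ)) := by
      rw [Complex.exp_eq_exp_iff_exists_int]
      exact ⟨k, by push_cast; ring⟩
    rw [e2]
    simp

/-- Bound on the Toeplitz forms by the supremum of the symbol. -/
lemma HasTrigMoments.quadFormLE {f : ℝ → ℝ} {R : ℤ → ℝ} (hf : IsCircleBounded f)
    (h : HasTrigMoments f R) {C : ℝ} (hC : ∀ᵐ x ∂circleMeasure, f x ≤ C) :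
    QuadFormLE R (2 * Real.pi * C) := by
  intro s v
  have h1 := h.sum_sum_eq_integral hf Finset.univ (fun a : s => ((a : ℕ) : ℤ)) v
  -- The symbol `1` gives the form `2π ∑ (v a)²` as an integral with the same nonnegative weight
  -- `D`, so `f ≤ C` compares the two forms.
  have h2 := hasTrigMoments_one.sum_sum_eq_integral (isCircleBounded_const 1) Finset.univ
    (fun a : s => ((a : ℕ) : ℤ)) v
  set D : ℝ → ℝ := fun x => ‖∑ a : s, (v a : ℂ) * Complex.exp (Complex.I * x * ((a : ℕ) : ℤ))‖ ^ 2
    with hD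
  have e : ∑ a : s, ∑ b : s, v a * v b * (if ((a : ℕ) : ℤ) - ((b : ℕ) : ℤ) = 0 then 2 * Real.pi
      else 0) = 2 * Real.pi * ∑ a, v a ^ 2 := by
    rw [Finset.mul_sum]
    refine Finset.sum_congr rfl fun a _ => ?_
    rw [Finset.sum_eq_single a]
    · simp
      ring
    · intro b _ hb
      have : ((a : ℕ) : ℤ) - ((b : ℕ) : ℤ) ≠ 0 := by
        rw [sub_ne_zero]
        exact_mod_cast fun hab : (a : ℕ) = b => hb (Subtype.ext hab.symm)
      simp [this]
    · simp
  rw [e] at h2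
  have hDc : Continuous D := by fun_prop
  have hDi : Integrable D circleMeasure :=
    (hDc.intervalIntegrable (-Real.pi) Real.pi).1
  have hDf : Integrable (fun x => D x * f x) circleMeasure := by
    have := (hf.bounded_mul (φ := fun x => (D x : ℂ)) (by fun_prop)).re
    refine this.congr (ae_of_all _ fun x => ?_)
    simp
  rw [h1]
  calc ∫ x, D x * f x ∂circleMeasure ≤ ∫ x, C * D x ∂circleMeasure := by
        refine integral_mono_ae hDf (hDi.const_mul C) ?_
        filter_upwards [hC] with x hx
        rw [mul_comm C]
        exact mul_le_mul_of_nonneg_left hx (by positivity)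
    _ = 2 * Real.pi * C * ∑ a, v a ^ 2 := by
        rw [integral_const_mul]
        have : ∫ x, D x ∂circleMeasure = 2 * Real.pi * ∑ a, v a ^ 2 := by
          rw [h2]
          simp [hD]
        rw [this]
        ring

end Fourier

/-! ### Self-convolutions and powers of the moments -/

section Convolution

/-- The line is a countable union of translates of `(-π, π]`. Convolutions evaluate `g` at `x - y`,
outside the basic period, hence the need for measurability on the whole line. -/
lemma aestronglyMeasurable_of_periodic {g : ℝ → ℝ} (hp : Function.Periodic g (2 * Real.pi))
    (hg : AEStronglyMeasurable g circleMeasure) : AEStronglyMeasurable g volume := by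
  have hpi : 0 < 2 * Real.pi := by positivity
  rw [← Measure.restrict_univ (μ := volume), ← iUnion_Ioc_add_zsmul hpi (-Real.pi),
    aestronglyMeasurable_iUnion_iff]
  intro n
  have h1 : MeasurePreserving (fun x : ℝ => x - n • (2 * Real.pi)) volume volume :=
    measurePreserving_sub_right volume _
  have h2 := h1.restrict_preimage (s := Set.Ioc (-Real.pi) Real.pi) measurableSet_Ioc
  have h3 := hg.comp_measurePreserving h2
  rw [Set.preimage_sub_const_Ioc] at h3
  have e1 : Real.pi + n • (2 * Real.pi) = -Real.pi + (n + 1) • (2 * Real.pi) := by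
    simp only [zsmul_eq_mul]
    push_cast
    ring
  rw [e1] at h3
  refine h3.congr (ae_of_all _ fun x => ?_)
  exact hp.sub_zsmul_eq n

variable {g G : ℝ → ℝ} {r S : ℤ → ℝ} {C : ℝ}

lemma integral_character_mul_translate (hp : Function.Periodic g (2 * Real.pi))
    (hr : HasTrigMoments g r) (k : ℤ) (y : ℝ) :
    ∫ x, Complex.exp (Complex.I * x * k) * g (x - y) ∂circleMeasure
      = Complex.exp (Complex.I * y * k) * r k := by
  rw [← hr k, ← intervalIntegral_eq_circleMeasure, ← intervalIntegral_eq_circleMeasure]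
  set φ : ℝ → ℂ := fun x => Complex.exp (Complex.I * x * k) * g x with hφ
  have hφp : Function.Periodic φ (2 * Real.pi) := by
    intro x
    simp only [hφ]
    rw [hp x]
    congr 1
    rw [Complex.exp_eq_exp_iff_exists_int]
    exact ⟨k, by push_cast; ring⟩
  have e : ∀ x : ℝ, Complex.exp (Complex.I * x * k) * g (x - y)
      = Complex.exp (Complex.I * y * k) * φ (x - y) := by
    intro x
    simp only [hφ]
    rw [← mul_assoc, ← Complex.exp_add]
    congr 2
    push_cast
    ring
  simp_rw [e]
  rw [intervalIntegral.integral_const_mul, intervalIntegral.integral_comp_sub_right]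
  congr 1
  have := hφp.intervalIntegral_add_eq (-Real.pi - y) (-Real.pi)
  rw [show -Real.pi - y + 2 * Real.pi = Real.pi - y by ring,
    show -Real.pi + 2 * Real.pi = Real.pi by ring] at this
  exact this

/-- Fubini, since translating `g` by `y` multiplies its `k`-th moment by the character at `y`. Null
sets of `g` stay null under `(x, y) ↦ x - y`, which gives joint measurability. -/
lemma HasTrigMoments.convolution (hp : Function.Periodic g (2 * Real.pi))
    (hgb : ∀ x, |g x| ≤ C) (hgm : AEStronglyMeasurable g circleMeasure)
    (hr : HasTrigMoments g r) (hG : IsCircleBounded G) (hS : HasTrigMoments G S) :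
    IsCircleBounded (fun x => ∫ y, g (x - y) * G y ∂circleMeasure) ∧
      HasTrigMoments (fun x => ∫ y, g (x - y) * G y ∂circleMeasure) (fun k => r k * S k) := by
  have hgv := aestronglyMeasurable_of_periodic hp hgm
  have hm : AEStronglyMeasurable (fun z : ℝ × ℝ => g (z.1 - z.2) * G z.2)
      (circleMeasure.prod circleMeasure) := by
    refine AEStronglyMeasurable.mul ?_ (hG.aesm.comp_quasiMeasurePreserving
      Measure.quasiMeasurePreserving_snd)
    have h1 := hgv.comp_quasiMeasurePreserving (quasiMeasurePreserving_sub volume volume)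
    refine h1.mono_ac ?_
    unfold circleMeasure
    rw [Measure.prod_restrict]
    exact Measure.absolutelyContinuous_of_le Measure.restrict_le_self
  obtain ⟨M, hM⟩ := hG.bdd
  have hC0 : 0 ≤ C := (abs_nonneg _).trans (hgb 0)
  have hMprod : ∀ᵐ z ∂(circleMeasure.prod circleMeasure), |G z.2| ≤ M :=
    Measure.quasiMeasurePreserving_snd.ae hM
  refine ⟨⟨hm.integral_prod_right', C * M * (2 * Real.pi), ae_of_all _ fun x => ?_⟩, fun k => ?_⟩
  · rw [← circleMeasure_real_univ, ← Real.norm_eq_abs]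
    refine norm_integral_le_of_norm_le_const ?_
    filter_upwards [hM] with y hy
    rw [norm_mul]
    exact mul_le_mul (hgb _) hy (norm_nonneg _) hC0
  · have hint : Integrable (fun z : ℝ × ℝ => Complex.exp (Complex.I * z.1 * k)
        * ((g (z.1 - z.2) * G z.2 : ℝ) : ℂ)) (circleMeasure.prod circleMeasure) := by
      refine Integrable.of_bound (AEStronglyMeasurable.mul (by fun_prop)
        (Complex.continuous_ofReal.comp_aestronglyMeasurable hm)) (C * M) ?_
      filter_upwards [hMprod] with z hz
      rw [norm_mul, norm_character, one_mul, Complex.norm_real, norm_mul]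
      exact mul_le_mul (hgb _) hz (norm_nonneg _) hC0
    calc ∫ x, Complex.exp (Complex.I * x * k)
          * ((∫ y, g (x - y) * G y ∂circleMeasure : ℝ) : ℂ) ∂circleMeasure
        = ∫ x, ∫ y, Complex.exp (Complex.I * x * k) * ((g (x - y) * G y : ℝ) : ℂ)
            ∂circleMeasure ∂circleMeasure := by
          congr 1
          ext x
          rw [← integral_complex_ofReal, integral_const_mul]
      _ = ∫ y, ∫ x, Complex.exp (Complex.I * x * k) * ((g (x - y) * G y : ℝ) : ℂ)
            ∂circleMeasure ∂circleMeasure := integral_integral_swap hint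
      _ = ∫ y, r k * (Complex.exp (Complex.I * y * k) * G y) ∂circleMeasure := by
          congr 1
          ext y
          rw [show (r k : ℂ) * (Complex.exp (Complex.I * y * k) * G y)
            = (Complex.exp (Complex.I * y * k) * r k) * G y by ring,
            ← integral_character_mul_translate hp hr k y, ← integral_mul_const]
          congr 1
          ext x
          push_cast
          ring
      _ = ((r k * S k : ℝ) : ℂ) := by
          rw [integral_const_mul, hS k, Complex.ofReal_mul]

lemma selfConv_succ_succ (l : ℕ) (x : ℝ) :
    selfConv g (l + 2) x = ∫ y, g (x - y) * selfConv g (l + 1) y ∂circleMeasure := by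
  exact intervalIntegral_eq_circleMeasure _

lemma HasTrigMoments.selfConv (hp : Function.Periodic g (2 * Real.pi))
    (hgb : ∀ x, |g x| ≤ C) (hgm : AEStronglyMeasurable g circleMeasure)
    (hr : HasTrigMoments g r) (l : ℕ) :
    IsCircleBounded (selfConv g (l + 1)) ∧
      HasTrigMoments (GaussianArray.selfConv g (l + 1)) (fun k => r k ^ (l + 1)) := by
  induction l with
  | zero =>
    simp only [zero_add, pow_one, GaussianArray.selfConv]
    exact ⟨⟨hgm, C, ae_of_all _ hgb⟩, hr⟩
  | succ l ih =>
    have h := hr.convolution hp hgb hgm ih.1 ih.2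
    simp only [← selfConv_succ_succ, ← pow_succ'] at h
    exact h

/-- The value at `0` of the self-convolutions as a sum of powers of the trigonometric moments. -/
lemma HasTrigMoments.hasSum_pow (hp : Function.Periodic g (2 * Real.pi))
    (hgb : ∀ x, |g x| ≤ C) (hgm : AEStronglyMeasurable g circleMeasure)
    (hr : HasTrigMoments g r) (l : ℕ) :
    HasSum (fun k => r k ^ (l + 2)) (2 * Real.pi * GaussianArray.selfConv g (l + 2) 0) := by
  have hgv := aestronglyMeasurable_of_periodic hp hgm
  -- The value at `0` is the inner product of the reflection of `g` with `g^{⋆(l+1)}`. Since `r` is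
  -- even the reflection has the same moments, and Parseval gives `∑ r · r^{l+1}`. The exponent
  -- starts at `2` because Parseval needs two factors.
  have h1 : IsCircleBounded fun y => g (0 - y) := by
    refine ⟨?_, C, ae_of_all _ fun y => hgb _⟩
    have := hgv.comp_measurePreserving (Measure.measurePreserving_sub_left volume (0 : ℝ))
    exact this.mono_measure Measure.restrict_le_self
  have h2 : HasTrigMoments (fun y => g (0 - y)) r := by
    intro k
    rw [← hr.neg_eq k, ← hr (-k), ← intervalIntegral_eq_circleMeasure,
      ← intervalIntegral_eq_circleMeasure]
    have := intervalIntegral.integral_comp_neg (a := -Real.pi) (b := Real.pi)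
      (fun x : ℝ => Complex.exp (Complex.I * x * (-k : ℤ)) * (g x : ℂ))
    rw [neg_neg] at this
    rw [← this]
    congr 1
    ext x
    simp only [zero_sub]
    congr 2
    push_cast
    ring
  have h3 := hr.selfConv hp hgb hgm l
  have h4 := h2.hasSum_mul h1 h3.1 h3.2
  rw [selfConv_succ_succ]
  simpa only [← pow_succ'] using h4

end Convolution

/-! ### The Fejér kernel -/

section Fejer

/-- The mean of a function of the differences over `{1, …, n}²`, scaled by `n`. -/
noncomputable def toeplitzMean (R : ℤ → ℝ) (n : ℕ) : ℝ :=
  (1 / (n : ℝ)) * ∑ i ∈ Finset.Icc 1 n, ∑ m ∈ Finset.Icc 1 n, R (i - m)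

/-- The Fejér kernel. -/
noncomputable def fejerKernel (n : ℕ) (x : ℝ) : ℝ :=
  (1 / (n : ℝ)) * ‖∑ a ∈ Finset.Icc 1 n, Complex.exp (Complex.I * x * ((a : ℕ) : ℤ))‖ ^ 2

lemma continuous_fejerKernel (n : ℕ) : Continuous (fejerKernel n) := by
  unfold fejerKernel
  fun_prop

lemma fejerKernel_nonneg (n : ℕ) (x : ℝ) : 0 ≤ fejerKernel n x := by
  unfold fejerKernel
  positivity

lemma integrable_fejerKernel (n : ℕ) : Integrable (fejerKernel n) circleMeasure :=
  ((continuous_fejerKernel n).intervalIntegrable (-Real.pi) Real.pi).1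

lemma IsCircleBounded.integrable_fejerKernel_mul {f : ℝ → ℝ} (hf : IsCircleBounded f) (n : ℕ) :
    Integrable (fun x => fejerKernel n x * f x) circleMeasure := by
  have h1 := continuous_fejerKernel n
  have := (hf.bounded_mul (φ := fun x => (fejerKernel n x : ℂ)) (by fun_prop)).re
  refine this.congr (ae_of_all _ fun x => ?_)
  simp

lemma HasTrigMoments.toeplitzMean_eq {f : ℝ → ℝ} {R : ℤ → ℝ} (hf : IsCircleBounded f)
    (h : HasTrigMoments f R) (n : ℕ) :
    toeplitzMean R n = ∫ x, fejerKernel n x * f x ∂circleMeasure := by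
  have h1 := h.sum_sum_eq_integral hf (Finset.Icc 1 n) (fun a : ℕ => (a : ℤ)) (fun _ => 1)
  simp only [one_mul, Complex.ofReal_one, mul_one] at h1
  unfold toeplitzMean fejerKernel
  rw [h1, ← integral_const_mul]
  simp only [mul_assoc]

lemma integral_fejerKernel {n : ℕ} (hn : 0 < n) :
    ∫ x, fejerKernel n x ∂circleMeasure = 2 * Real.pi := by
  have h := hasTrigMoments_one.toeplitzMean_eq (isCircleBounded_const 1) n
  simp only [mul_one] at h
  rw [← h, toeplitzMean]
  have hn' : (n : ℝ) ≠ 0 := by positivity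
  have : ∀ i ∈ Finset.Icc 1 n, ∑ m ∈ Finset.Icc 1 n,
      (if (i : ℤ) - (m : ℤ) = 0 then 2 * Real.pi else 0) = 2 * Real.pi := by
    intro i hi
    simp_rw [sub_eq_zero, Nat.cast_inj]
    rw [Finset.sum_ite_eq, if_pos hi]
  rw [Finset.sum_congr rfl this]
  simp
  field_simp

/-- The geometric sum telescopes: `(e^{ix} - 1) D` has modulus at most `2`, while `|e^{ix} - 1| = 2
|sin (x/2)| ≥ 2 |x| / π` for `|x| ≤ π`. Hence `|D| |x| ≤ π`. -/
lemma fejerKernel_mul_sq_le {n : ℕ} {x : ℝ} (hx : |x| ≤ Real.pi) :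
    fejerKernel n x * x ^ 2 ≤ Real.pi ^ 2 / n := by
  have hpi := Real.pi_pos
  set D := ∑ a ∈ Finset.Icc 1 n, Complex.exp (Complex.I * x * ((a : ℕ) : ℤ)) with hD
  have e : (Complex.exp (Complex.I * x) - 1) * D
      = Complex.exp (Complex.I * x * ((n + 1 : ℕ) : ℤ)) - Complex.exp (Complex.I * x) := by
    rw [hD]
    clear hD D
    induction n with
    | zero => simp
    | succ n ih =>
      rw [Finset.sum_Icc_succ_top (by omega), mul_add, ih, sub_mul, ← Complex.exp_add]
      push_cast
      ring_nf
  have h1 : ‖Complex.exp (Complex.I * x) - 1‖ * ‖D‖ ≤ 2 := by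
    rw [← norm_mul, e]
    refine (norm_sub_le _ _).trans ?_
    rw [norm_character]
    have := norm_character x 1
    simp only [Int.cast_one, mul_one] at this
    rw [this]
    norm_num
  have h2 : 2 / Real.pi * |x| ≤ ‖Complex.exp (Complex.I * x) - 1‖ := by
    rw [Complex.norm_exp_I_mul_ofReal_sub_one, norm_mul, Real.norm_eq_abs, Real.norm_eq_abs,
      abs_two]
    have h3 : 2 / Real.pi * |x / 2| ≤ |Real.sin (x / 2)| :=
      Real.mul_abs_le_abs_sin (by rw [abs_div, abs_two]; linarith)
    rw [abs_div, abs_two] at h3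
    calc 2 / Real.pi * |x| = 2 * (2 / Real.pi * (|x| / 2)) := by ring
      _ ≤ _ := by gcongr
  have h4 : ‖D‖ * |x| ≤ Real.pi := by
    have h5 : 2 / Real.pi * |x| * ‖D‖ ≤ 2 :=
      (mul_le_mul_of_nonneg_right h2 (norm_nonneg _)).trans h1
    calc ‖D‖ * |x| = Real.pi / 2 * (2 / Real.pi * |x| * ‖D‖) := by field_simp
      _ ≤ Real.pi / 2 * 2 := by gcongr
      _ = Real.pi := by ring
  unfold fejerKernel
  rw [← hD, mul_assoc, ← sq_abs x, ← mul_pow, one_div, mul_comm, div_eq_mul_inv]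
  exact mul_le_mul_of_nonneg_right (pow_le_pow_left₀ (by positivity) h4 2) (by positivity)

/-- Fejér's theorem at a point of continuity. -/
lemma HasTrigMoments.tendsto_toeplitzMean {g : ℝ → ℝ} {r : ℤ → ℝ} {C : ℝ}
    (hgb : ∀ x, |g x| ≤ C) (hgm : AEStronglyMeasurable g circleMeasure)
    (hr : HasTrigMoments g r) (hc : ContinuousAt g 0) :
    Tendsto (toeplitzMean r) atTop (𝓝 (2 * Real.pi * g 0)) := by
  have hpi := Real.pi_pos
  have hC0 : 0 ≤ C := (abs_nonneg _).trans (hgb 0)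
  have hg : IsCircleBounded g := ⟨hgm, C, ae_of_all _ hgb⟩
  have hg' := hg.sub (isCircleBounded_const (g 0))
  rw [Metric.tendsto_atTop]
  intro ε hε
  -- Near `0` the kernel has mass at most `2π`, so oscillation `η` costs `2π η = ε / 2`. Away from
  -- `0` the kernel is at most `π² / (n δ²)` and `|g - g 0| ≤ 2 C`; `N` makes this cost less than `ε
  -- / 2` over length `2π`.
  set η := ε / (4 * Real.pi) with hη
  have hη0 : 0 < η := by positivity
  obtain ⟨δ, hδ, hδg⟩ := Metric.continuousAt_iff.1 hc η hη0
  obtain ⟨N, hN⟩ := exists_nat_gt (Real.pi ^ 2 / δ ^ 2 * (2 * C) * (2 * Real.pi) / (ε / 2))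
  refine ⟨N + 1, fun n hn => ?_⟩
  have hn0 : 0 < n := by omega
  have hn' : (0 : ℝ) < n := by exact_mod_cast hn0
  have hNn : (N : ℝ) < n := by exact_mod_cast (by omega : N < n)
  have e : toeplitzMean r n - 2 * Real.pi * g 0
      = ∫ x, fejerKernel n x * (g x - g 0) ∂circleMeasure := by
    rw [hr.toeplitzMean_eq hg n, ← integral_fejerKernel hn0, ← integral_mul_const,
      ← integral_sub (hg.integrable_fejerKernel_mul n) ((integrable_fejerKernel n).mul_const _)]
    congr 1
    ext x
    ring
  have hpt : ∀ᵐ x ∂circleMeasure, ‖fejerKernel n x * (g x - g 0)‖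
      ≤ fejerKernel n x * η + Real.pi ^ 2 / n / δ ^ 2 * (2 * C) := by
    filter_upwards [ae_circleMeasure_mem_Ioo] with x hx
    have hk := fejerKernel_nonneg n x
    rw [norm_mul, Real.norm_eq_abs, Real.norm_eq_abs, abs_of_nonneg hk]
    by_cases hxδ : |x| < δ
    · have h1 := hδg (x := x) (by simpa [Real.dist_eq] using hxδ)
      rw [Real.dist_eq] at h1
      have h2 : 0 ≤ Real.pi ^ 2 / n / δ ^ 2 * (2 * C) := by positivity
      have h3 := mul_le_mul_of_nonneg_left h1.le hk
      linarith
    · have hxδ' : δ ≤ |x| := not_lt.1 hxδ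
      have h1 := fejerKernel_mul_sq_le (n := n) (abs_le.2 ⟨hx.1.le, hx.2.le⟩)
      have h2 : fejerKernel n x ≤ Real.pi ^ 2 / n / δ ^ 2 := by
        rw [le_div_iff₀ (by positivity)]
        refine le_trans (mul_le_mul_of_nonneg_left ?_ hk) h1
        rw [← sq_abs x]
        gcongr
      have h3 : |g x - g 0| ≤ 2 * C := by
        refine (abs_sub _ _).trans ?_
        linarith [hgb x, hgb 0]
      have h4 : fejerKernel n x * |g x - g 0| ≤ Real.pi ^ 2 / n / δ ^ 2 * (2 * C) :=
        mul_le_mul h2 h3 (abs_nonneg _) (by positivity)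
      have h5 : 0 ≤ fejerKernel n x * η := by positivity
      linarith
  rw [Real.dist_eq, e, ← Real.norm_eq_abs]
  have hb := norm_integral_le_of_norm_le (((integrable_fejerKernel n).mul_const η).add
    (integrable_const _)) hpt
  have hsplit : ∫ x, (fejerKernel n x * η + Real.pi ^ 2 / n / δ ^ 2 * (2 * C)) ∂circleMeasure
      = 2 * Real.pi * η + Real.pi ^ 2 / n / δ ^ 2 * (2 * C) * (2 * Real.pi) := by
    rw [integral_add ((integrable_fejerKernel n).mul_const η) (integrable_const _),
      integral_mul_const, integral_fejerKernel hn0, integral_const, circleMeasure_real_univ,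
      smul_eq_mul]
    ring
  refine (hb.trans_eq hsplit).trans_lt ?_
  have h6 : 2 * Real.pi * η = ε / 2 := by
    rw [hη]
    field_simp
    ring
  have h7 : Real.pi ^ 2 / n / δ ^ 2 * (2 * C) * (2 * Real.pi) < ε / 2 := by
    have h8 := hN.trans hNn
    rw [div_lt_iff₀ (by positivity)] at h8
    calc Real.pi ^ 2 / n / δ ^ 2 * (2 * C) * (2 * Real.pi)
        = Real.pi ^ 2 / δ ^ 2 * (2 * C) * (2 * Real.pi) / n := by field_simp
      _ < ε / 2 := by
        rw [div_lt_iff₀ hn']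
        linarith
  linarith

end Fejer

/-! ### Limits and stability of Toeplitz means -/

section ToeplitzMeans

/-- For fixed `i` the map `m ↦ i - m` is injective, so each of the `n` rows is bounded by the full
sum. -/
lemma abs_toeplitzMean_le {a : ℤ → ℝ} (ha : Summable fun k => |a k|) (n : ℕ) :
    |toeplitzMean a n| ≤ ∑' k, |a k| := by
  have hrow : ∀ i ∈ Finset.Icc 1 n, ∑ m ∈ Finset.Icc 1 n, |a ((i : ℤ) - m)| ≤ ∑' k, |a k| := by
    intro i _
    have hinj : Function.Injective fun m : ℕ => (i : ℤ) - m := fun m m' h => by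
      simpa using h
    exact ((ha.comp_injective hinj).sum_le_tsum _ fun _ _ => abs_nonneg _).trans
      (tsum_comp_le_tsum_of_inj ha (fun _ => abs_nonneg _) hinj)
  rcases Nat.eq_zero_or_pos n with rfl | hn
  · simp [toeplitzMean, tsum_nonneg]
  have hn' : (0 : ℝ) < n := by exact_mod_cast hn
  unfold toeplitzMean
  rw [abs_mul, abs_of_nonneg (by positivity)]
  calc 1 / (n : ℝ) * |∑ i ∈ Finset.Icc 1 n, ∑ m ∈ Finset.Icc 1 n, a (i - m)|
      ≤ 1 / (n : ℝ) * ∑ i ∈ Finset.Icc 1 n, ∑' k, |a k| := by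
        gcongr
        refine (Finset.abs_sum_le_sum_abs _ _).trans (Finset.sum_le_sum fun i hi => ?_)
        exact (Finset.abs_sum_le_sum_abs _ _).trans (hrow i hi)
    _ = ∑' k, |a k| := by
        rw [Finset.sum_const, Nat.card_Icc, nsmul_eq_mul]
        simp
        field_simp

lemma toeplitzMean_sub (a b : ℤ → ℝ) (n : ℕ) :
    toeplitzMean a n - toeplitzMean b n = toeplitzMean (fun k => a k - b k) n := by
  simp only [toeplitzMean, ← mul_sub, Finset.sum_sub_distrib]

/-- Linearity in `a`: the weight of `a k` is `(1 - |k|/n)⁺` for `n > 0`. This form is suited to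
dominated convergence. -/
lemma hasSum_toeplitzMean (a : ℤ → ℝ) (n : ℕ) :
    HasSum (fun k => a k * toeplitzMean (Pi.single k 1) n) (toeplitzMean a n) := by
  have h : HasSum (fun k => (1 / (n : ℝ)) * ∑ i ∈ Finset.Icc 1 n, ∑ m ∈ Finset.Icc 1 n,
      a k * (Pi.single k 1 : ℤ → ℝ) (i - m)) (toeplitzMean a n) := by
    refine HasSum.mul_left _ (hasSum_sum fun i _ => hasSum_sum fun m _ => ?_)
    convert hasSum_single ((i : ℤ) - m) ?_ using 1
    · simp
    · intro k hk
      rw [Pi.single_eq_of_ne (Ne.symm hk), mul_zero]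
  convert h using 2 with k
  simp only [toeplitzMean, Finset.mul_sum]
  exact Finset.sum_congr rfl fun i _ => Finset.sum_congr rfl fun m _ => by ring

lemma abs_toeplitzMean_single_le (k : ℤ) (n : ℕ) :
    |toeplitzMean (Pi.single k 1) n| ≤ 1 := by
  have h : HasSum (fun m => |(Pi.single k 1 : ℤ → ℝ) m|) 1 := by
    convert hasSum_single k ?_ using 1
    · simp
    · intro m hm
      rw [Pi.single_eq_of_ne hm, abs_zero]
  exact (abs_toeplitzMean_le h.summable n).trans_eq h.tsum_eq

lemma tendsto_toeplitzMean_single (k : ℤ) :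
    Tendsto (toeplitzMean (Pi.single k 1)) atTop (𝓝 1) := by
  -- A crude count suffices: every `i` with `|k| < i ≤ n - |k|` has its partner `i - k` in `[1, n]`.
  -- If `n < 2|k|` the bound is negative.
  have hlow : ∀ n : ℕ, 0 < n → 1 - 2 * (k.natAbs : ℝ) / n ≤ toeplitzMean (Pi.single k 1) n := by
    intro n hn
    have hn' : (0 : ℝ) < n := by exact_mod_cast hn
    have h1 : ∑ i ∈ Finset.Ioc k.natAbs (n - k.natAbs), (1 : ℝ)
        ≤ ∑ i ∈ Finset.Icc 1 n, ∑ m ∈ Finset.Icc 1 n, (Pi.single k 1 : ℤ → ℝ) (i - m) := by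
      have hnn : ∀ m : ℤ, 0 ≤ (Pi.single k 1 : ℤ → ℝ) m := fun m => by
        by_cases h : m = k
        · subst h
          simp
        · rw [Pi.single_eq_of_ne h]
      refine (Finset.sum_le_sum fun i hi => ?_).trans
        (Finset.sum_le_sum_of_subset_of_nonneg ?_ fun i _ _ =>
          Finset.sum_nonneg fun m _ => hnn _)
      · rw [Finset.mem_Ioc] at hi
        have hm : ((i : ℤ) - k).toNat ∈ Finset.Icc 1 n := by
          rw [Finset.mem_Icc]
          omega
        refine le_trans (le_of_eq ?_) (Finset.single_le_sum (fun m _ => hnn _) hm)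
        rw [show (i : ℤ) - (((i : ℤ) - k).toNat : ℤ) = k by omega]
        simp
      · intro i hi
        rw [Finset.mem_Ioc] at hi
        rw [Finset.mem_Icc]
        omega
    have h2 : (n : ℝ) - 2 * k.natAbs ≤ ∑ i ∈ Finset.Ioc k.natAbs (n - k.natAbs), (1 : ℝ) := by
      rw [Finset.sum_const, Nat.card_Ioc, nsmul_eq_mul, mul_one, sub_le_iff_le_add]
      exact_mod_cast (by omega : n ≤ n - k.natAbs - k.natAbs + 2 * k.natAbs)
    unfold toeplitzMean
    calc 1 - 2 * (k.natAbs : ℝ) / n = 1 / (n : ℝ) * (n - 2 * k.natAbs) := by field_simp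
      _ ≤ _ := by
        gcongr
        exact h2.trans h1
  have hlim : Tendsto (fun n : ℕ => 1 - 2 * (k.natAbs : ℝ) / n) atTop (𝓝 1) := by
    simpa using (tendsto_const_div_atTop_nhds_zero_nat (2 * (k.natAbs : ℝ))).const_sub 1
  refine tendsto_of_tendsto_of_tendsto_of_le_of_le' hlim tendsto_const_nhds ?_ ?_
  · filter_upwards [eventually_gt_atTop 0] with n hn using hlow n hn
  · exact Eventually.of_forall fun n => (abs_le.1 (abs_toeplitzMean_single_le k n)).2

lemma tendsto_toeplitzMean_tsum {a : ℤ → ℝ} (ha : Summable fun k => |a k|) :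
    Tendsto (toeplitzMean a) atTop (𝓝 (∑' k, a k)) := by
  have h := tendsto_tsum_of_dominated_convergence (𝓕 := atTop)
    (f := fun n k => a k * toeplitzMean (Pi.single k 1) n) (g := a) (bound := fun k => |a k|) ha
    (fun k => by simpa using (tendsto_toeplitzMean_single k).const_mul (a k))
    (Eventually.of_forall fun n k => by
      rw [norm_mul, Real.norm_eq_abs, Real.norm_eq_abs]
      exact mul_le_of_le_one_right (abs_nonneg _) (abs_toeplitzMean_single_le k n))
  simpa only [(hasSum_toeplitzMean a _).tsum_eq] using h

/-- One factor `|a - b|` and one factor `|a| + |b|` are kept and the others bounded by `1`; summed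
over `k`, the product is controlled by `ℓ²` norms, uniformly in the argument. -/
lemma abs_pow_sub_pow_le {a b : ℝ} (ha : |a| ≤ 1) (hb : |b| ≤ 1) (l : ℕ) :
    |a ^ (l + 2) - b ^ (l + 2)| ≤ (l + 2) * (|a - b| * (|a| + |b|)) := by
  induction l with
  | zero =>
    rw [show a ^ (0 + 2) - b ^ (0 + 2) = (a - b) * (a + b) by ring, abs_mul]
    have h1 : |a - b| * |a + b| ≤ |a - b| * (|a| + |b|) :=
      mul_le_mul_of_nonneg_left (abs_add_le a b) (abs_nonneg _)
    have h2 : 0 ≤ |a - b| * (|a| + |b|) := by positivity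
    push_cast
    linarith
  | succ l ih =>
    rw [show a ^ (l + 1 + 2) - b ^ (l + 1 + 2)
      = a * (a ^ (l + 2) - b ^ (l + 2)) + (a - b) * b * b ^ (l + 1) by ring]
    have h1 : |a * (a ^ (l + 2) - b ^ (l + 2))| ≤ (l + 2) * (|a - b| * (|a| + |b|)) := by
      rw [abs_mul]
      exact (mul_le_of_le_one_left (abs_nonneg _) ha).trans ih
    have h2 : |(a - b) * b * b ^ (l + 1)| ≤ |a - b| * (|a| + |b|) := by
      rw [abs_mul, abs_mul, abs_pow]
      refine (mul_le_of_le_one_right (by positivity) (pow_le_one₀ (abs_nonneg _) hb)).trans ?_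
      exact mul_le_mul_of_nonneg_left (by linarith [abs_nonneg a]) (abs_nonneg _)
    push_cast
    refine (abs_add_le _ _).trans ?_
    linarith

/-- Stability of the Toeplitz means of powers under `ℓ²` perturbations. -/
lemma abs_toeplitzMean_pow_sub_le {a b : ℤ → ℝ} (ha : ∀ k, |a k| ≤ 1) (hb : ∀ k, |b k| ≤ 1)
    {A T w : ℝ} (hA : HasSum (fun k => (a k - b k) ^ 2) A) (hT : HasSum (fun k => b k ^ 2) T)
    (hw : 0 < w) (hAw : A ≤ w ^ 2) (l n : ℕ) :
    |toeplitzMean (fun k => a k ^ (l + 2)) n - toeplitzMean (fun k => b k ^ (l + 2)) n|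
      ≤ (l + 2) * (w ^ 2 + w + w * T) := by
  -- The cross term `2 |a - b| |b|` is split with weight `w`. For `w` at least the `ℓ²` distance,
  -- both resulting sums are of order `w`.
  have hpt : ∀ k, |a k ^ (l + 2) - b k ^ (l + 2)|
      ≤ (l + 2) * ((1 + w⁻¹) * (a k - b k) ^ 2 + w * b k ^ 2) := by
    intro k
    refine (abs_pow_sub_pow_le (ha k) (hb k) l).trans ?_
    refine mul_le_mul_of_nonneg_left ?_ (by positivity)
    have h1 : |a k| ≤ |a k - b k| + |b k| := by
      have := abs_add_le (a k - b k) (b k)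
      simpa using this
    have h2 : 2 * (|a k - b k| * |b k|) ≤ w⁻¹ * (a k - b k) ^ 2 + w * b k ^ 2 := by
      have h3 : 0 ≤ w⁻¹ * (|a k - b k| - w * |b k|) ^ 2 := by positivity
      have h4 : w⁻¹ * (|a k - b k| - w * |b k|) ^ 2
          = w⁻¹ * |a k - b k| ^ 2 - 2 * (|a k - b k| * |b k|) + w * |b k| ^ 2 := by
        field_simp
        ring
      rw [h4, sq_abs, sq_abs] at h3
      linarith
    have h5 : |a k - b k| * (|a k| + |b k|) ≤ |a k - b k| * (|a k - b k| + 2 * |b k|) :=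
      mul_le_mul_of_nonneg_left (by linarith) (abs_nonneg _)
    have h6 : |a k - b k| * |a k - b k| = (a k - b k) ^ 2 := by
      rw [← pow_two, sq_abs]
    nlinarith
  have hs : HasSum (fun k => ((l : ℝ) + 2) * ((1 + w⁻¹) * (a k - b k) ^ 2 + w * b k ^ 2))
      ((l + 2) * ((1 + w⁻¹) * A + w * T)) :=
    ((hA.mul_left _).add (hT.mul_left _)).mul_left _
  have hsum : Summable fun k => |a k ^ (l + 2) - b k ^ (l + 2)| :=
    Summable.of_nonneg_of_le (fun _ => abs_nonneg _) hpt hs.summable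
  rw [toeplitzMean_sub]
  refine (abs_toeplitzMean_le hsum n).trans ?_
  refine (hsum.tsum_le_tsum hpt hs.summable).trans (hs.tsum_eq.trans_le ?_)
  refine mul_le_mul_of_nonneg_left ?_ (by positivity)
  have h7 : (1 + w⁻¹) * A ≤ (1 + w⁻¹) * w ^ 2 :=
    mul_le_mul_of_nonneg_left hAw (by positivity)
  have h8 : (1 + w⁻¹) * w ^ 2 = w ^ 2 + w := by
    field_simp
  linarith

variable {f g : ℝ → ℝ} {R r : ℤ → ℝ} {C : ℝ}

lemma integral_circleMeasure_le {φ : ℝ → ℝ} {M : ℝ} (h : ∀ᵐ x ∂circleMeasure, |φ x| ≤ M) :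
    |∫ x, φ x ∂circleMeasure| ≤ M * (2 * Real.pi) := by
  rw [← circleMeasure_real_univ, ← Real.norm_eq_abs]
  exact norm_integral_le_of_norm_le_const h

lemma abs_integral_fejerKernel_mul_le {φ : ℝ → ℝ} {M : ℝ} (hM : 0 ≤ M)
    (h : ∀ᵐ x ∂circleMeasure, |φ x| ≤ M) (n : ℕ) :
    |∫ x, fejerKernel n x * φ x ∂circleMeasure| ≤ M * (2 * Real.pi) := by
  rcases Nat.eq_zero_or_pos n with rfl | hn
  · have := Real.pi_pos
    simp only [fejerKernel, CharP.cast_eq_zero, div_zero, zero_mul, integral_zero, abs_zero]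
    positivity
  rw [← integral_fejerKernel hn, ← integral_const_mul, ← Real.norm_eq_abs]
  refine norm_integral_le_of_norm_le ((integrable_fejerKernel n).const_mul M) ?_
  filter_upwards [h] with x hx
  have := fejerKernel_nonneg n x
  rw [norm_mul, Real.norm_eq_abs, Real.norm_eq_abs, abs_of_nonneg this, mul_comm]
  exact mul_le_mul_of_nonneg_right hx this

/-- The Toeplitz means of the powers of trigonometric moments are uniformly bounded. -/
lemma HasTrigMoments.abs_toeplitzMean_pow_le (hf : IsCircleBounded f) (h : HasTrigMoments f R)
    (hC0 : 0 ≤ C) (hC : ∀ᵐ x ∂circleMeasure, |f x| ≤ C) (hR : ∀ k, |R k| ≤ 1) (l n : ℕ) :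
    |toeplitzMean (fun k => R k ^ (l + 1)) n| ≤ C * (2 * Real.pi) + (C * (2 * Real.pi)) ^ 2 := by
  have hpi := Real.pi_pos
  -- The first power need not be summable and is handled by the Fejér kernel; all higher powers are
  -- dominated by the squares, hence by Parseval.
  rcases l with _ | l
  · simp only [zero_add, pow_one]
    rw [h.toeplitzMean_eq hf n]
    exact (abs_integral_fejerKernel_mul_le hC0 hC n).trans
      (le_add_of_nonneg_right (sq_nonneg _))
  · have hsq := h.hasSum_sq hf
    have hpt : ∀ k, |R k ^ (l + 1 + 1)| ≤ R k ^ 2 := by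
      intro k
      rw [abs_pow, ← sq_abs (R k)]
      exact pow_le_pow_of_le_one (abs_nonneg _) (hR k) (by omega)
    have hsum : Summable fun k => |R k ^ (l + 1 + 1)| :=
      Summable.of_nonneg_of_le (fun _ => abs_nonneg _) hpt hsq.summable
    refine (abs_toeplitzMean_le hsum n).trans ((hsum.tsum_le_tsum hpt hsq.summable).trans ?_)
    rw [hsq.tsum_eq]
    have h1 : ∫ x, f x ^ 2 ∂circleMeasure ≤ C ^ 2 * (2 * Real.pi) := by
      refine (le_abs_self _).trans (integral_circleMeasure_le ?_)
      filter_upwards [hC] with x hx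
      rw [abs_pow]
      exact pow_le_pow_left₀ (abs_nonneg _) hx 2
    have h2 : 2 * Real.pi * ∫ x, f x ^ 2 ∂circleMeasure
        ≤ 2 * Real.pi * (C ^ 2 * (2 * Real.pi)) := by gcongr
    have h3 : 0 ≤ C * (2 * Real.pi) := by positivity
    nlinarith

/-- Convergence of the Toeplitz means of powers along a sequence of symbols which converges
uniformly. -/
lemma tendsto_toeplitzMean_pow {f : ℕ → ℝ → ℝ} {R : ℕ → ℤ → ℝ} {u : ℕ → ℝ} {n : ℕ → ℕ}
    (hp : Function.Periodic g (2 * Real.pi)) (hgb : ∀ x, |g x| ≤ C)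
    (hgm : AEStronglyMeasurable g circleMeasure) (hgc : ContinuousAt g 0)
    (hr : HasTrigMoments g r) (hr1 : ∀ k, |r k| ≤ 1)
    (hf : ∀ j, IsCircleBounded (f j)) (hR : ∀ j, HasTrigMoments (f j) (R j))
    (hR1 : ∀ j k, |R j k| ≤ 1) (hu0 : ∀ j, 0 ≤ u j) (hu : Tendsto u atTop (𝓝 0))
    (hfg : ∀ j, ∀ᵐ x ∂circleMeasure, |f j x - g x| ≤ u j) (hn : Tendsto n atTop atTop) (l : ℕ) :
    Tendsto (fun j => toeplitzMean (fun k => R j k ^ (l + 1)) (n j)) atTop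
      (𝓝 (2 * Real.pi * selfConv g (l + 1) 0)) := by
  have hpi := Real.pi_pos
  have hg : IsCircleBounded g := ⟨hgm, C, ae_of_all _ hgb⟩
  have hd : ∀ j, IsCircleBounded fun x => f j x - g x := fun j => (hf j).sub hg
  have hdm : ∀ j, HasTrigMoments (fun x => f j x - g x) (fun k => R j k - r k) := fun j =>
    (hR j).sub (hf j) hg hr
  rcases l with _ | l
  · simp only [zero_add, pow_one]
    have h1 := (hr.tendsto_toeplitzMean hgb hgm hgc).comp hn
    have h2 : Tendsto (fun j => toeplitzMean (R j) (n j) - toeplitzMean r (n j)) atTop (𝓝 0) := by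
      refine squeeze_zero_norm (a := fun j => u j * (2 * Real.pi)) (fun j => ?_)
        (by simpa using hu.mul_const (2 * Real.pi))
      rw [toeplitzMean_sub, (hdm j).toeplitzMean_eq (hd j)]
      exact abs_integral_fejerKernel_mul_le (hu0 j) (hfg j) _
    have h3 := h2.add h1
    rw [zero_add] at h3
    refine h3.congr fun j => ?_
    simp
  · have hsum := hr.hasSum_pow hp hgb hgm l
    have hsq := hr.hasSum_sq hg
    have habs : Summable fun k => |r k ^ (l + 2)| := by
      refine Summable.of_nonneg_of_le (fun _ => abs_nonneg _) (fun k => ?_) hsq.summable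
      rw [abs_pow, ← sq_abs (r k)]
      exact pow_le_pow_of_le_one (abs_nonneg _) (hr1 k) (by omega)
    have h1 := (tendsto_toeplitzMean_tsum habs).comp hn
    rw [hsum.tsum_eq] at h1
    set T := 2 * Real.pi * ∫ x, g x ^ 2 ∂circleMeasure with hT
    -- By Parseval the `ℓ²` distance of the moments is at most `2π u_j`. The term `1 / (j + 1)`
    -- keeps `w` positive when `u_j = 0`.
    let w : ℕ → ℝ := fun j => u j * (2 * Real.pi) + 1 / ((j : ℝ) + 1)
    have hw0 : ∀ j, 0 < w j := fun j => by
      have := hu0 j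
      positivity
    have hwl : Tendsto w atTop (𝓝 0) := by
      have := (hu.mul_const (2 * Real.pi)).add tendsto_one_div_add_atTop_nhds_zero_nat
      simpa [w] using this
    have h2 : Tendsto (fun j => toeplitzMean (fun k => R j k ^ (l + 2)) (n j)
        - toeplitzMean (fun k => r k ^ (l + 2)) (n j)) atTop (𝓝 0) := by
      refine squeeze_zero_norm (a := fun j => ((l : ℝ) + 2) * (w j ^ 2 + w j + w j * T))
        (fun j => ?_) ?_
      · refine abs_toeplitzMean_pow_sub_le (hR1 j) hr1 ((hdm j).hasSum_sq (hd j)) hsq (hw0 j)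
          ?_ l (n j)
        have h3 : ∫ x, (f j x - g x) ^ 2 ∂circleMeasure ≤ u j ^ 2 * (2 * Real.pi) := by
          refine (le_abs_self _).trans (integral_circleMeasure_le ?_)
          filter_upwards [hfg j] with x hx
          rw [abs_pow]
          exact pow_le_pow_left₀ (abs_nonneg _) hx 2
        calc 2 * Real.pi * ∫ x, (f j x - g x) ^ 2 ∂circleMeasure
            ≤ 2 * Real.pi * (u j ^ 2 * (2 * Real.pi)) := by gcongr
          _ = (u j * (2 * Real.pi)) ^ 2 := by ring
          _ ≤ w j ^ 2 := by
            have := hu0 j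
            refine pow_le_pow_left₀ (by positivity) ?_ 2
            exact le_add_of_nonneg_right (by positivity)
      · have := (((hwl.pow 2).add hwl).add (hwl.mul_const T)).const_mul ((l : ℝ) + 2)
        simpa using this
    have h3 := h2.add h1
    rw [zero_add] at h3
    refine h3.congr fun j => ?_
    simp

end ToeplitzMeans

/-! ### Variance of normalized sums via Hermite coefficients -/

section Variance

variable {Ω : Type*} [MeasurableSpace Ω] {P : Measure Ω} [IsProbabilityMeasure P]
  {X : ℕ → Ω → ℝ} {R : ℤ → ℝ} {h : ℝ → ℝ}

lemma hermiteCoeff_zero (h : ℝ → ℝ) : hermiteCoeff h 0 = ∫ x, h x ∂(gaussianReal 0 1) := by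
  simp [hermiteCoeff, hermiteFun]

namespace IsStdGaussianSeq

lemma integral_normalizedSum (hX : IsStdGaussianSeq P X R) (hh : MemLp h 2 (gaussianReal 0 1))
    (h0 : hermiteCoeff h 0 = 0) (n : ℕ) : ∫ ω, normalizedSum h X n ω ∂P = 0 := by
  have hi : ∀ i, MemLp (fun ω => h (X i ω)) 2 P := fun i =>
    hh.comp_measurePreserving (hX.measurePreserving i)
  unfold normalizedSum
  rw [integral_const_mul, integral_finsetSum _ fun i _ => (hi i).integrable (by norm_num)]
  rw [Finset.sum_eq_zero, mul_zero]
  intro i _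
  rw [← h0, hermiteCoeff_zero, ← hX.map_eq i, integral_map (hX.measurable i).aemeasurable]
  rw [hX.map_eq i]
  exact hh.aestronglyMeasurable

lemma variance_normalizedSum_eq_integral (hX : IsStdGaussianSeq P X R)
    (hh : MemLp h 2 (gaussianReal 0 1)) (h0 : hermiteCoeff h 0 = 0) (n : ℕ) :
    variance (normalizedSum h X n) P = ∫ ω, normalizedSum h X n ω ^ 2 ∂P := by
  rw [variance_eq_sub (hX.memLp_normalizedSum hh n), hX.integral_normalizedSum hh h0]
  simp

/-- The variance of a normalized sum in terms of the Hermite coefficients. -/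
lemma hasSum_variance_normalizedSum (hX : IsStdGaussianSeq P X R)
    (hh : MemLp h 2 (gaussianReal 0 1)) (h0 : hermiteCoeff h 0 = 0) (n : ℕ) :
    HasSum (fun l => hermiteCoeff h l ^ 2 / (l.factorial : ℝ) * toeplitzMean (fun k => R k ^ l) n)
      (variance (normalizedSum h X n) P) := by
  have hi : ∀ i, MemLp (fun ω => h (X i ω)) 2 P := fun i =>
    hh.comp_measurePreserving (hX.measurePreserving i)
  have hs : HasSum (fun l => (1 / (n : ℝ)) * ∑ i ∈ Finset.Icc 1 n, ∑ m ∈ Finset.Icc 1 n,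
      hermiteCoeff h l ^ 2 / (l.factorial : ℝ) * R (i - m) ^ l)
      ((1 / (n : ℝ)) * ∑ i ∈ Finset.Icc 1 n, ∑ m ∈ Finset.Icc 1 n,
        ∫ ω, h (X i ω) * h (X m ω) ∂P) :=
    (hasSum_sum fun i _ => hasSum_sum fun m _ => hX.hasSum_hermiteCoeff i m hh).mul_left _
  have hv : variance (normalizedSum h X n) P = (1 / (n : ℝ)) * ∑ i ∈ Finset.Icc 1 n,
      ∑ m ∈ Finset.Icc 1 n, ∫ ω, h (X i ω) * h (X m ω) ∂P := by
    have hint : ∀ i m, Integrable (fun ω => h (X i ω) * h (X m ω)) P := fun i m =>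
      (hi i).integrable_mul (hi m)
    rw [hX.variance_normalizedSum_eq_integral hh h0]
    have : ∀ ω, normalizedSum h X n ω ^ 2 = (1 / (n : ℝ)) * ∑ i ∈ Finset.Icc 1 n,
        ∑ m ∈ Finset.Icc 1 n, h (X i ω) * h (X m ω) := fun ω => by
      rw [normalizedSum, mul_pow, pow_two (∑ i ∈ _, _), Finset.sum_mul_sum, div_pow, one_pow,
        Real.sq_sqrt (Nat.cast_nonneg n)]
    simp_rw [this]
    rw [integral_const_mul, integral_finsetSum _ fun i _ => integrable_finsetSum _ fun m _ =>
      hint i m]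
    congr 1
    exact Finset.sum_congr rfl fun i _ => integral_finsetSum _ fun m _ => hint i m
  rw [hv]
  convert! hs using 2 with l
  rw [toeplitzMean, mul_left_comm]
  simp_rw [Finset.mul_sum]

/-- Termwise comparison of the variance series with `∑ c_l²/l! = ‖h‖²`. Applied to `h - k`, it
transfers `L²(γ)` approximation to the normalized sums. -/
lemma variance_normalizedSum_le (hX : IsStdGaussianSeq P X R) {B : ℝ} {n : ℕ}
    (hB : ∀ l, |toeplitzMean (fun k => R k ^ (l + 1)) n| ≤ B)
    (hh : MemLp h 2 (gaussianReal 0 1)) (h0 : hermiteCoeff h 0 = 0) :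
    variance (normalizedSum h X n) P ≤ B * ∫ x, h x ^ 2 ∂(gaussianReal 0 1) := by
  refine hasSum_le (fun l => ?_) (hX.hasSum_variance_normalizedSum hh h0 n)
    ((hasSum_hermiteCoeff_sq hh).mul_left B)
  rcases l with _ | l
  · simp [h0]
  · rw [mul_comm]
    exact mul_le_mul_of_nonneg_right ((le_abs_self _).trans (hB l)) (by positivity)

end IsStdGaussianSeq

end Variance

/-! ### The limiting variance -/

section VarianceLimit

variable {Ω : ℕ → Type*} [∀ j, MeasurableSpace (Ω j)] {P : (j : ℕ) → Measure (Ω j)}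
  [∀ j, IsProbabilityMeasure (P j)] {X : (j : ℕ) → ℕ → Ω j → ℝ} {R : ℕ → ℤ → ℝ} {h : ℝ → ℝ}

/-- Convergence of the variances of the normalized sums along an array. -/
lemma tendsto_variance_normalizedSum (hX : ∀ j, IsStdGaussianSeq (P j) (X j) (R j))
    (hh : MemLp h 2 (gaussianReal 0 1)) (h0 : hermiteCoeff h 0 = 0) {n : ℕ → ℕ} {B : ℝ}
    (hB : ∀ j l, |toeplitzMean (fun k => R j k ^ (l + 1)) (n j)| ≤ B) {S : ℕ → ℝ}
    (hS : ∀ l, Tendsto (fun j => toeplitzMean (fun k => R j k ^ (l + 1)) (n j)) atTop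
      (𝓝 (S (l + 1)))) :
    ∃ σsq : ℝ≥0,
      HasSum (fun l => hermiteCoeff h l ^ 2 / (l.factorial : ℝ) * S l) (σsq : ℝ) ∧
      Tendsto (fun j => variance (normalizedSum h (X j) (n j)) (P j)) atTop (𝓝 (σsq : ℝ)) := by
  have hc := hasSum_hermiteCoeff_sq hh
  have hb := hc.summable.mul_right B
  -- For `l = 0` the Toeplitz mean equals `n j`, which `B` does not control; the term disappears
  -- because `c_0 = 0`.
  have hbound : ∀ j l, ‖hermiteCoeff h l ^ 2 / (l.factorial : ℝ)
      * toeplitzMean (fun k => R j k ^ l) (n j)‖ ≤ hermiteCoeff h l ^ 2 / (l.factorial : ℝ) * B := by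
    intro j l
    rcases l with _ | l
    · simp [h0]
    · rw [norm_mul, Real.norm_of_nonneg (by positivity)]
      exact mul_le_mul_of_nonneg_left (hB j l) (by positivity)
  have hlim : ∀ l, Tendsto (fun j => hermiteCoeff h l ^ 2 / (l.factorial : ℝ)
      * toeplitzMean (fun k => R j k ^ l) (n j)) atTop
      (𝓝 (hermiteCoeff h l ^ 2 / (l.factorial : ℝ) * S l)) := by
    intro l
    rcases l with _ | l
    · simp [h0]
    · exact (hS l).const_mul _
  have hsum : Summable fun l => hermiteCoeff h l ^ 2 / (l.factorial : ℝ) * S l :=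
    Summable.of_norm_bounded hb fun l =>
      le_of_tendsto (hlim l).norm (Eventually.of_forall fun j => hbound j l)
  have ht := tendsto_tsum_of_dominated_convergence hb hlim (Eventually.of_forall hbound)
  have hv : Tendsto (fun j => variance (normalizedSum h (X j) (n j)) (P j)) atTop
      (𝓝 (∑' l, hermiteCoeff h l ^ 2 / (l.factorial : ℝ) * S l)) :=
    ht.congr fun j => ((hX j).hasSum_variance_normalizedSum hh h0 (n j)).tsum_eq
  have hnn : 0 ≤ ∑' l, hermiteCoeff h l ^ 2 / (l.factorial : ℝ) * S l :=
    ge_of_tendsto hv (Eventually.of_forall fun j => variance_nonneg _ _)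
  exact ⟨⟨_, hnn⟩, hsum.hasSum, hv⟩

end VarianceLimit

/-! ### Polynomials with a Gaussian factor -/

section PolyGauss

open Polynomial in
/-- A polynomial times the Gaussian `exp (-a x²)`. -/
noncomputable def polyGauss (a : ℝ) (p : ℝ[X]) (x : ℝ) : ℝ := p.eval x * Real.exp (-(a * x ^ 2))

open Polynomial in
lemma hasDerivAt_polyGauss (a : ℝ) (p : ℝ[X]) (x : ℝ) :
    HasDerivAt (polyGauss a p) (polyGauss a (derivative p - C (2 * a) * X * p) x) x := by
  have h1 : HasDerivAt (fun x : ℝ => -(a * x ^ 2)) (-(2 * a * x)) x := by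
    refine (((hasDerivAt_pow 2 x).const_mul a).neg).congr_deriv ?_
    norm_num
    ring
  refine ((p.hasDerivAt x).mul h1.exp).congr_deriv ?_
  simp only [polyGauss, eval_sub, eval_mul, eval_C, eval_X]
  ring

open Polynomial in
lemma continuous_polyGauss (a : ℝ) (p : ℝ[X]) : Continuous (polyGauss a p) :=
  continuous_iff_continuousAt.2 fun x => (hasDerivAt_polyGauss a p x).continuousAt

-- For a monomial, `|x^n| ≤ 1 + x^{2n}` and `(a x²)^n / n! ≤ exp (a x²)`.
open Polynomial in
lemma exists_abs_polyGauss_le {a : ℝ} (ha : 0 < a) (p : ℝ[X]) : ∃ K, ∀ x, |polyGauss a p x| ≤ K := by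
  induction p using Polynomial.induction_on' with
  | add p q hp hq =>
    obtain ⟨K, hK⟩ := hp
    obtain ⟨L, hL⟩ := hq
    refine ⟨K + L, fun x => ?_⟩
    have : polyGauss a (p + q) x = polyGauss a p x + polyGauss a q x := by
      simp only [polyGauss, eval_add, add_mul]
    rw [this]
    exact (abs_add_le _ _).trans (add_le_add (hK x) (hL x))
  | monomial n c =>
    refine ⟨|c| * (1 + n.factorial / a ^ n), fun x => ?_⟩
    rw [polyGauss, eval_monomial, abs_mul, abs_mul, mul_assoc, Real.abs_exp]
    refine mul_le_mul_of_nonneg_left ?_ (abs_nonneg _)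
    have h1 : |x ^ n| ≤ 1 + x ^ (2 * n) := by
      rw [mul_comm, pow_mul, ← sq_abs (x ^ n)]
      nlinarith [sq_nonneg (|x ^ n| - 1), abs_nonneg (x ^ n)]
    have h2 := Real.pow_div_factorial_le_exp (a * x ^ 2) (by positivity) n
    have h3 : x ^ (2 * n) ≤ n.factorial / a ^ n * Real.exp (a * x ^ 2) := by
      rw [mul_pow, div_le_iff₀ (by positivity), ← pow_mul] at h2
      rw [div_mul_eq_mul_div, le_div_iff₀ (by positivity)]
      linarith
    have h4 : Real.exp (-(a * x ^ 2)) ≤ 1 := Real.exp_le_one_iff.2 (by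
      have : 0 ≤ a * x ^ 2 := by positivity
      linarith)
    have h5 : Real.exp (a * x ^ 2) * Real.exp (-(a * x ^ 2)) = 1 := by
      rw [← Real.exp_add]
      simp
    calc |x ^ n| * Real.exp (-(a * x ^ 2))
        ≤ (1 + n.factorial / a ^ n * Real.exp (a * x ^ 2)) * Real.exp (-(a * x ^ 2)) := by
          gcongr
          linarith
      _ = Real.exp (-(a * x ^ 2)) + n.factorial / a ^ n := by
          rw [add_mul, one_mul, mul_assoc, h5, mul_one]
      _ ≤ 1 + n.factorial / a ^ n := by linarith

open Polynomial in
/-- Polynomials with a Gaussian factor give Stein data. -/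
lemma exists_steinData_polyGauss {a : ℝ} (ha : 0 < a) (p : ℝ[X]) :
    ∃ K q q' h' h'', SteinData K q q'
      (polyGauss a (X * p - derivative p + C (2 * a) * X * p)) h' h'' := by
  -- `D` is differentiation carried over to the polynomial factor. With `q = p e^{-a x²}`, the
  -- factor of `x q - q'` is `X p - D p = s`.
  set D : ℝ[X] → ℝ[X] := fun p => derivative p - C (2 * a) * X * p with hD
  set s := X * p - derivative p + C (2 * a) * X * p with hs
  obtain ⟨K1, h1⟩ := exists_abs_polyGauss_le ha p
  obtain ⟨K2, h2⟩ := exists_abs_polyGauss_le ha (D p)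
  obtain ⟨K3, h3⟩ := exists_abs_polyGauss_le ha s
  obtain ⟨K4, h4⟩ := exists_abs_polyGauss_le ha (D s)
  obtain ⟨K5, h5⟩ := exists_abs_polyGauss_le ha (D (D s))
  refine ⟨max K1 (max K2 (max K3 (max K4 K5))), polyGauss a p, polyGauss a (D p),
    polyGauss a (D s), polyGauss a (D (D s)), ?_⟩
  constructor
  · intro x
    simp only [polyGauss, hs, hD, eval_sub, eval_add, eval_mul, eval_C, eval_X]
    ring
  · exact hasDerivAt_polyGauss a p
  · exact hasDerivAt_polyGauss a s
  · exact hasDerivAt_polyGauss a (D s)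
  · exact continuous_polyGauss a _
  · exact continuous_polyGauss a _
  · exact fun x => (h1 x).trans (by simp)
  · exact fun x => (h2 x).trans (by simp)
  · exact fun x => (h3 x).trans (by simp)
  · exact fun x => (h4 x).trans (by simp)
  · exact fun x => (h5 x).trans (by simp)

-- Dominated convergence: for `a < 1` the difference is at most `2 |s| + |r|`. With `s = X p - p'`
-- and `r = 2 X p` the approximants are the Stein images of `p e^{-a x²}`.
open Polynomial in
lemma tendsto_integral_sq_sub_polyGauss (s r : ℝ[X]) :
    Tendsto (fun a : ℝ => ∫ x, (s.eval x - polyGauss a (s + C a * r) x) ^ 2 ∂(gaussianReal 0 1))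
      (𝓝[>] 0) (𝓝 0) := by
  have h0 : ∫ _ : ℝ, (0 : ℝ) ∂(gaussianReal 0 1) = 0 := by simp
  rw [show 𝓝 (0 : ℝ) = 𝓝 (∫ _ : ℝ, (0 : ℝ) ∂(gaussianReal 0 1)) by rw [h0]]
  refine tendsto_integral_filter_of_dominated_convergence (l := 𝓝[>] (0 : ℝ))
    (fun x => (2 * |s.eval x| + |r.eval x|) ^ 2) ?_ ?_ ?_ ?_
  · refine Eventually.of_forall fun a => ?_
    exact ((s.continuous.sub (continuous_polyGauss a _)).pow 2).aestronglyMeasurable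
  · filter_upwards [Ioo_mem_nhdsGT (zero_lt_one' ℝ)] with a ha
    refine ae_of_all _ fun x => ?_
    rw [norm_pow]
    refine pow_le_pow_left₀ (norm_nonneg _) ?_ 2
    have h4 : Real.exp (-(a * x ^ 2)) ≤ 1 := Real.exp_le_one_iff.2 (by
      have : 0 ≤ a * x ^ 2 := mul_nonneg ha.1.le (sq_nonneg x)
      linarith)
    have h5 : |polyGauss a (s + C a * r) x| ≤ |s.eval x| + |r.eval x| := by
      rw [polyGauss, abs_mul, Real.abs_exp]
      refine (mul_le_of_le_one_right (abs_nonneg _) h4).trans ?_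
      rw [eval_add, eval_mul, eval_C]
      refine (abs_add_le _ _).trans (add_le_add le_rfl ?_)
      rw [abs_mul, abs_of_pos ha.1]
      exact mul_le_of_le_one_left (abs_nonneg _) ha.2.le
    refine (norm_sub_le _ _).trans ?_
    rw [Real.norm_eq_abs, Real.norm_eq_abs]
    linarith
  · have h1 := ((memLp_eval_gaussianReal s).abs.const_mul 2).add (memLp_eval_gaussianReal r).abs
    exact h1.integrable_sq
  · refine ae_of_all _ fun x => ?_
    have : Continuous fun a : ℝ => (s.eval x - polyGauss a (s + C a * r) x) ^ 2 := by
      simp only [polyGauss, eval_add, eval_mul, eval_C]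
      fun_prop
    have h1 := (this.tendsto 0).mono_left (nhdsWithin_le_nhds (s := Set.Ioi 0))
    simpa [polyGauss] using h1

end PolyGauss

/-! ### Approximation in `L²` by functions with Stein data -/

section Approximation

variable {h : ℝ → ℝ}

/-- The coefficient of `h` in the Stein preimage of its Hermite expansion. -/
noncomputable def hermitePrimitive (h : ℝ → ℝ) (L : ℕ) : Polynomial ℝ :=
  ∑ l ∈ Finset.range L,
    Polynomial.C (hermiteCoeff h (l + 1) / ((l + 1).factorial : ℝ)) * hermiteReal l

open Polynomial in
lemma hermitePrimitive_stein (h : ℝ → ℝ) (L : ℕ) :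
    X * hermitePrimitive h L - derivative (hermitePrimitive h L) = ∑ l ∈ Finset.range L,
      C (hermiteCoeff h (l + 1) / ((l + 1).factorial : ℝ)) * hermiteReal (l + 1) := by
  simp only [hermitePrimitive, hermiteReal_succ, Finset.mul_sum, derivative_sum, derivative_C_mul,
    ← Finset.sum_sub_distrib]
  exact Finset.sum_congr rfl fun l _ => by ring

/-- Pythagoras: the truncated expansion is the orthogonal projection of `h` onto the span of `H_1,
…, H_L`. -/
lemma integral_sq_sub_hermite_sum (hh : MemLp h 2 (gaussianReal 0 1)) (L : ℕ) :
    ∫ x, (h x - (∑ l ∈ Finset.range L, Polynomial.C (hermiteCoeff h (l + 1)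
      / ((l + 1).factorial : ℝ)) * hermiteReal (l + 1)).eval x) ^ 2 ∂(gaussianReal 0 1)
    = ∫ x, h x ^ 2 ∂(gaussianReal 0 1)
      - ∑ l ∈ Finset.range L, hermiteCoeff h (l + 1) ^ 2 / ((l + 1).factorial : ℝ) := by
  set c : ℕ → ℝ := fun l => hermiteCoeff h (l + 1) / ((l + 1).factorial : ℝ) with hc
  set s := ∑ l ∈ Finset.range L, Polynomial.C (c l) * hermiteReal (l + 1) with hs
  have hse : ∀ x, s.eval x = ∑ l ∈ Finset.range L, c l * (hermiteReal (l + 1)).eval x := by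
    intro x
    simp [hs, Polynomial.eval_finsetSum]
  have hH := fun l => memLp_eval_gaussianReal (hermiteReal l)
  have hS := memLp_eval_gaussianReal s
  have hmul : ∀ {k : ℝ → ℝ}, MemLp k 2 (gaussianReal 0 1) →
      ∫ x, s.eval x * k x ∂(gaussianReal 0 1)
        = ∑ l ∈ Finset.range L, c l * hermiteCoeff k (l + 1) := by
    intro k hk
    simp_rw [hse, Finset.sum_mul, mul_assoc]
    have hi : ∀ l, Integrable (fun x => c l * ((hermiteReal (l + 1)).eval x * k x))
        (gaussianReal 0 1) := fun l => ((hH (l + 1)).integrable_mul hk).const_mul (c l)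
    rw [integral_finsetSum _ fun l _ => hi l]
    refine Finset.sum_congr rfl fun l _ => ?_
    rw [integral_const_mul, hermiteCoeff]
    simp_rw [hermiteFun_eq_eval, mul_comm]
  have hcs : ∀ l ∈ Finset.range L, hermiteCoeff (fun x => s.eval x) (l + 1)
      = hermiteCoeff h (l + 1) := by
    intro l hl
    unfold hermiteCoeff
    simp_rw [hermiteFun_eq_eval]
    rw [hmul (hH (l + 1))]
    simp_rw [hermiteCoeff, hermiteFun_eq_eval, integral_hermite_mul_hermite]
    rw [Finset.sum_eq_single l]
    · rw [if_pos rfl]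
      simp only [hc]
      field_simp
      simp_rw [hermiteCoeff, hermiteFun_eq_eval]
    · intro m _ hm
      rw [if_neg (by omega), mul_zero]
    · exact fun h => absurd hl h
  have e : ∀ x, (h x - s.eval x) ^ 2 = h x ^ 2 - 2 * (s.eval x * h x) + s.eval x * s.eval x :=
    fun x => by ring
  simp_rw [e]
  have i1 := hh.integrable_sq
  have i2 : Integrable (fun x => 2 * (s.eval x * h x)) (gaussianReal 0 1) :=
    (hS.integrable_mul hh).const_mul 2
  have i3 : Integrable (fun x => s.eval x * s.eval x) (gaussianReal 0 1) := hS.integrable_mul hS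
  have i4 : Integrable (fun x => h x ^ 2 - 2 * (s.eval x * h x)) (gaussianReal 0 1) := i1.sub i2
  rw [integral_add i4 i3, integral_sub i1 i2, integral_const_mul, hmul hh, hmul hS]
  have : ∀ l, c l * hermiteCoeff h (l + 1) = hermiteCoeff h (l + 1) ^ 2 / ((l + 1).factorial : ℝ) :=
    fun l => by simp only [hc]; ring
  rw [Finset.sum_congr rfl fun l hl => congrArg (c l * ·) (hcs l hl)]
  simp_rw [this]
  ring

/-- Centred square integrable functions are approximated in `L²` by functions with Stein data. -/
lemma exists_steinData_integral_sq_sub_le (hh : MemLp h 2 (gaussianReal 0 1))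
    (h0 : hermiteCoeff h 0 = 0) {δ : ℝ} (hδ : 0 < δ) :
    ∃ K q q' k k' k'', SteinData K q q' k k' k'' ∧
      ∫ x, (h x - k x) ^ 2 ∂(gaussianReal 0 1) ≤ δ := by
  have hs := (hasSum_nat_add_iff' 1).2 (hasSum_hermiteCoeff_sq hh)
  simp only [Finset.sum_range_one, h0] at hs
  norm_num at hs
  have ht := (hs.tendsto_sum_nat.const_sub (∫ x, h x ^ 2 ∂(gaussianReal 0 1)))
  rw [sub_self] at ht
  -- Truncation and the Gaussian factor each cost `δ / 4`; `(u + v)² ≤ 2 u² + 2 v²` combines them to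
  -- `δ`.
  obtain ⟨L, hL⟩ := (ht.eventually_lt_const (show (0 : ℝ) < δ / 4 by positivity)).exists
  rw [← integral_sq_sub_hermite_sum hh, ← hermitePrimitive_stein] at hL
  set p := hermitePrimitive h L with hp
  set s := Polynomial.X * p - Polynomial.derivative p with hsd
  have h2 := tendsto_integral_sq_sub_polyGauss s (2 * Polynomial.X * p)
  obtain ⟨a, ha, ha0⟩ := ((h2.eventually_lt_const (show (0 : ℝ) < δ / 4 by positivity)).and
    self_mem_nhdsWithin).exists
  obtain ⟨K, q, q', k', k'', S⟩ := exists_steinData_polyGauss ha0 p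
  have he : s + Polynomial.C a * (2 * Polynomial.X * p)
      = Polynomial.X * p - Polynomial.derivative p + Polynomial.C (2 * a) * Polynomial.X * p := by
    rw [Polynomial.C_mul, hsd, Polynomial.C_ofNat]
    ring
  rw [he] at ha
  refine ⟨K, q, q', _, k', k'', S, ?_⟩
  have hk : MemLp _ 2 (gaussianReal 0 1) :=
    MemLp.of_bound S.cont_h.aestronglyMeasurable K (ae_of_all _ S.bound_h)
  set k := polyGauss a
    (Polynomial.X * p - Polynomial.derivative p + Polynomial.C (2 * a) * Polynomial.X * p) with hkd
  have hS := memLp_eval_gaussianReal s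
  have i1 : Integrable (fun x => 2 * (h x - s.eval x) ^ 2) (gaussianReal 0 1) :=
    (hh.sub hS).integrable_sq.const_mul 2
  have i2 : Integrable (fun x => 2 * (s.eval x - k x) ^ 2) (gaussianReal 0 1) :=
    (hS.sub hk).integrable_sq.const_mul 2
  calc ∫ x, (h x - k x) ^ 2 ∂(gaussianReal 0 1)
      ≤ ∫ x, (2 * (h x - s.eval x) ^ 2 + 2 * (s.eval x - k x) ^ 2) ∂(gaussianReal 0 1) := by
        refine integral_mono (hh.sub hk).integrable_sq (i1.add i2) fun x => ?_
        simp only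
        nlinarith [sq_nonneg (h x - s.eval x - (s.eval x - k x))]
    _ = 2 * ∫ x, (h x - s.eval x) ^ 2 ∂(gaussianReal 0 1)
        + 2 * ∫ x, (s.eval x - k x) ^ 2 ∂(gaussianReal 0 1) := by
        rw [integral_add i1 i2, integral_const_mul, integral_const_mul]
    _ ≤ δ := by linarith

end Approximation

/-! ### Comparison of second moments and characteristic functions -/

section CharFunComparison

variable {Ω : Type*} [MeasurableSpace Ω] {P : Measure Ω}

/-- `F² - G² = 2 F (F - G) - (F - G)²`, with the cross term split by the weighted inequality `2 x y
≤ a⁻¹ y² + a x²`. -/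
lemma abs_integral_sq_sub_integral_sq_le {F G : Ω → ℝ} (hF : MemLp F 2 P) (hG : MemLp G 2 P)
    {a : ℝ} (ha : 0 < a) :
    |∫ ω, F ω ^ 2 ∂P - ∫ ω, G ω ^ 2 ∂P|
      ≤ (1 + a⁻¹) * ∫ ω, (F ω - G ω) ^ 2 ∂P + a * ∫ ω, F ω ^ 2 ∂P := by
  have i1 := hF.integrable_sq
  have i2 : Integrable (fun ω => (F ω - G ω) ^ 2) P := (hF.sub hG).integrable_sq
  rw [← integral_sub i1 hG.integrable_sq, ← integral_const_mul, ← integral_const_mul,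
    ← integral_add (i2.const_mul _) (i1.const_mul _)]
  rw [← Real.norm_eq_abs]
  refine norm_integral_le_of_norm_le ((i2.const_mul _).add (i1.const_mul _))
    (ae_of_all _ fun ω => ?_)
  simp only [Real.norm_eq_abs]
  have h1 : ∀ x y : ℝ, 2 * (x * y) ≤ a⁻¹ * y ^ 2 + a * x ^ 2 := by
    intro x y
    have h2 : 0 ≤ a⁻¹ * (y - a * x) ^ 2 := by positivity
    have h3 : a⁻¹ * (y - a * x) ^ 2 = a⁻¹ * y ^ 2 - 2 * (x * y) + a * x ^ 2 := by
      field_simp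
      ring
    linarith
  have h4 := h1 (F ω) (F ω - G ω)
  have h5 := h1 (-F ω) (F ω - G ω)
  rw [neg_sq] at h5
  rw [abs_le]
  constructor <;> nlinarith [sq_nonneg (F ω - G ω)]

variable [IsProbabilityMeasure P]

/-- `y ↦ e^{ity}` is Lipschitz with constant `|t|`, and the `L¹` norm is at most the `L²` norm. -/
lemma norm_charFun_map_sub_le {F G : Ω → ℝ} (hF : MemLp F 2 P) (hG : MemLp G 2 P) (t : ℝ) :
    ‖charFun (P.map F) t - charFun (P.map G) t‖ ≤ |t| * √(∫ ω, (F ω - G ω) ^ 2 ∂P) := by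
  have hc : Continuous fun y : ℝ => Complex.exp (t * y * Complex.I) := by fun_prop
  have hi : ∀ {F : Ω → ℝ}, AEMeasurable F P →
      Integrable (fun ω => Complex.exp (t * F ω * Complex.I)) P := by
    intro F hF
    refine Integrable.of_bound
      (hc.measurable.comp_aemeasurable hF).aestronglyMeasurable 1 (ae_of_all _ fun ω => ?_)
    rw [← Complex.ofReal_mul, Complex.norm_exp_ofReal_mul_I]
  rw [charFun_apply_real, charFun_apply_real, integral_map hF.aemeasurable hc.aestronglyMeasurable,
    integral_map hG.aemeasurable hc.aestronglyMeasurable,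
    ← integral_sub (hi hF.aemeasurable) (hi hG.aemeasurable)]
  have hd := hF.sub hG
  have h1 : ∀ ω, ‖Complex.exp (t * F ω * Complex.I) - Complex.exp (t * G ω * Complex.I)‖
      ≤ |t| * |F ω - G ω| := by
    intro ω
    have : Complex.exp (t * F ω * Complex.I) - Complex.exp (t * G ω * Complex.I)
        = Complex.exp ((t * G ω : ℝ) * Complex.I)
          * (Complex.exp (Complex.I * (t * (F ω - G ω) : ℝ)) - 1) := by
      rw [mul_sub, ← Complex.exp_add, mul_one]
      congr 2
      · push_cast
        ring
      · push_cast
        ring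
    rw [this, norm_mul, Complex.norm_exp_ofReal_mul_I, one_mul, ← abs_mul]
    exact Real.norm_exp_I_mul_ofReal_sub_one_le
  have h2 : ∫ ω, |F ω - G ω| ∂P ≤ √(∫ ω, (F ω - G ω) ^ 2 ∂P) := by
    refine Real.le_sqrt_of_sq_le ?_
    have h := variance_nonneg |F - G| P
    rw [variance_eq_sub hd.abs] at h
    have e : ∫ ω, (|F - G| ^ 2) ω ∂P = ∫ ω, (F ω - G ω) ^ 2 ∂P :=
      integral_congr_ae (ae_of_all _ fun ω => by simp)
    rw [e] at h
    have e' : ∫ ω, |F - G| ω ∂P = ∫ ω, |F ω - G ω| ∂P := rfl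
    rw [e'] at h
    linarith
  calc ‖∫ ω, (Complex.exp (t * F ω * Complex.I) - Complex.exp (t * G ω * Complex.I)) ∂P‖
      ≤ ∫ ω, |t| * |F ω - G ω| ∂P :=
        norm_integral_le_of_norm_le ((hd.integrable (by norm_num)).abs.const_mul _)
          (ae_of_all _ h1)
    _ ≤ |t| * √(∫ ω, (F ω - G ω) ^ 2 ∂P) := by
        rw [integral_const_mul]
        exact mul_le_mul_of_nonneg_left h2 (abs_nonneg _)

lemma abs_exp_neg_sub_exp_neg_le {a b : ℝ} (ha : 0 ≤ a) (hb : 0 ≤ b) :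
    |Real.exp (-a) - Real.exp (-b)| ≤ |a - b| := by
  wlog hab : a ≤ b generalizing a b
  · rw [abs_sub_comm, abs_sub_comm a]
    exact this hb ha (le_of_not_ge hab)
  have h1 : Real.exp (-b) ≤ Real.exp (-a) := Real.exp_le_exp.2 (by linarith)
  rw [abs_of_nonneg (by linarith), abs_sub_comm, abs_of_nonneg (by linarith)]
  have h2 : Real.exp (-b) = Real.exp (-a) * Real.exp (a - b) := by
    rw [← Real.exp_add]
    ring_nf
  have h3 := Real.add_one_le_exp (a - b)
  have h4 : Real.exp (-a) ≤ 1 := Real.exp_le_one_iff.2 (by linarith)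
  rw [h2]
  nlinarith [Real.exp_pos (-a)]

end CharFunComparison

/-! ### Asymptotic normality along the array -/

section CentralLimit

variable {Ω : ℕ → Type*} [∀ j, MeasurableSpace (Ω j)] {P : (j : ℕ) → Measure (Ω j)}
  [∀ j, IsProbabilityMeasure (P j)] {X : (j : ℕ) → ℕ → Ω j → ℝ} {R : ℕ → ℤ → ℝ} {h : ℝ → ℝ}

lemma normalizedSum_sub {Ω : Type*} (h k : ℝ → ℝ) (X : ℕ → Ω → ℝ) (n : ℕ) (ω : Ω) :
    normalizedSum (fun x => h x - k x) X n ω = normalizedSum h X n ω - normalizedSum k X n ω := by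
  simp only [normalizedSum, Finset.sum_sub_distrib, mul_sub]

lemma ofReal_exp_neg_mul_sq (v t : ℝ) :
    Complex.exp (-((v : ℝ) * t ^ 2 / 2 : ℂ)) = (Real.exp (-(v * t ^ 2 / 2)) : ℝ) := by
  push_cast
  rfl

/-- Bound for the characteristic function of a normalized sum which is approximated by a
normalized sum of a smooth function. -/
lemma IsStdGaussianSeq.norm_charFun_sub_le_of_approx {Ω : Type*} [MeasurableSpace Ω]
    {P : Measure Ω} [IsProbabilityMeasure P] {X : ℕ → Ω → ℝ} {R : ℤ → ℝ}
    (hX : IsStdGaussianSeq P X R) (hh : MemLp h 2 (gaussianReal 0 1)) (h0 : hermiteCoeff h 0 = 0)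
    {K : ℝ} {q q' k k' k'' : ℝ → ℝ} (S : SteinData K q q' k k' k'') {A B a : ℝ} (hA0 : 0 < A)
    (hA : QuadFormLE R A) {n : ℕ} (hn : 0 < n) (ha : 0 < a) (hB0 : 0 ≤ B)
    (hB : ∀ l, |toeplitzMean (fun k => R k ^ (l + 1)) n| ≤ B)
    (hk : ∫ x, (h x - k x) ^ 2 ∂(gaussianReal 0 1) ≤ a ^ 2) (t : ℝ) :
    ‖charFun (P.map (normalizedSum h X n)) t
        - Complex.exp (-((variance (normalizedSum h X n) P : ℝ) * t ^ 2 / 2 : ℂ))‖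
      ≤ |t| * √(B * a ^ 2) + t ^ 2 * √(Real.pi ^ 2 / 8 * A * (4 * K ^ 4 * A ^ 2 / n))
        + t ^ 2 / 2 * ((1 + a⁻¹) * (B * a ^ 2)
          + a * (B * ∫ x, h x ^ 2 ∂(gaussianReal 0 1))) := by
  have hkL : MemLp k 2 (gaussianReal 0 1) :=
    MemLp.of_bound S.cont_h.aestronglyMeasurable K (ae_of_all _ S.bound_h)
  have hk0 : hermiteCoeff k 0 = 0 := by
    have := hX.integral_comp_eq_zero S 0
    rw [hermiteCoeff_zero, ← hX.map_eq 0, integral_map (hX.measurable 0).aemeasurable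
      S.cont_h.aestronglyMeasurable, this]
  have hd : MemLp (fun x => h x - k x) 2 (gaussianReal 0 1) := hh.sub hkL
  have hd0 : hermiteCoeff (fun x => h x - k x) 0 = 0 := by
    rw [hermiteCoeff_zero, integral_sub (hh.integrable (by norm_num))
      (hkL.integrable (by norm_num)), ← hermiteCoeff_zero, ← hermiteCoeff_zero, h0, hk0, sub_zero]
  have hF := hX.memLp_normalizedSum hh n
  have hG := hX.memLp_normalizedSum hkL n
  set F := normalizedSum h X n with hFdef
  set G := normalizedSum k X n with hGdef
  have hFG : ∫ ω, (F ω - G ω) ^ 2 ∂P ≤ B * a ^ 2 := by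
    have h1 := hX.variance_normalizedSum_le hB hd hd0
    rw [hX.variance_normalizedSum_eq_integral hd hd0] at h1
    simp_rw [normalizedSum_sub] at h1
    exact h1.trans (mul_le_mul_of_nonneg_left hk hB0)
  have hF2 : ∫ ω, F ω ^ 2 ∂P ≤ B * ∫ x, h x ^ 2 ∂(gaussianReal 0 1) := by
    rw [← hX.variance_normalizedSum_eq_integral hh h0]
    exact hX.variance_normalizedSum_le hB hh h0
  have e1 : ‖charFun (P.map F) t - charFun (P.map G) t‖ ≤ |t| * √(B * a ^ 2) :=
    (norm_charFun_map_sub_le hF hG t).trans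
      (mul_le_mul_of_nonneg_left (Real.sqrt_le_sqrt hFG) (abs_nonneg _))
  have e2 := hX.norm_charFun_normalizedSum_sub_le S hA0 hA hn t
  have e3 : ‖Complex.exp (-((variance G P : ℝ) * t ^ 2 / 2 : ℂ))
      - Complex.exp (-((variance F P : ℝ) * t ^ 2 / 2 : ℂ))‖
      ≤ t ^ 2 / 2 * ((1 + a⁻¹) * (B * a ^ 2)
          + a * (B * ∫ x, h x ^ 2 ∂(gaussianReal 0 1))) := by
    have h1 := variance_nonneg F P
    have h2 := variance_nonneg G P
    rw [ofReal_exp_neg_mul_sq, ofReal_exp_neg_mul_sq, ← Complex.ofReal_sub, Complex.norm_real,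
      Real.norm_eq_abs]
    refine (abs_exp_neg_sub_exp_neg_le (by positivity) (by positivity)).trans ?_
    have h3 : variance G P * t ^ 2 / 2 - variance F P * t ^ 2 / 2
        = t ^ 2 / 2 * (variance G P - variance F P) := by ring
    rw [h3, abs_mul, abs_of_nonneg (by positivity), abs_sub_comm]
    refine mul_le_mul_of_nonneg_left ?_ (by positivity)
    rw [hX.variance_normalizedSum_eq_integral hh h0, hX.variance_normalizedSum_eq_integral hkL hk0]
    refine (abs_integral_sq_sub_integral_sq_le hF hG ha).trans ?_
    gcongr
  calc ‖charFun (P.map F) t - Complex.exp (-((variance F P : ℝ) * t ^ 2 / 2 : ℂ))‖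
      = ‖(charFun (P.map F) t - charFun (P.map G) t)
          + (charFun (P.map G) t - Complex.exp (-((variance G P : ℝ) * t ^ 2 / 2 : ℂ)))
          + (Complex.exp (-((variance G P : ℝ) * t ^ 2 / 2 : ℂ))
            - Complex.exp (-((variance F P : ℝ) * t ^ 2 / 2 : ℂ)))‖ := by
        congr 1
        ring
    _ ≤ _ := (norm_add₃_le).trans (add_le_add (add_le_add e1 e2) e3)

/-- Asymptotic normality of the normalized sums along an array. -/
lemma tendsto_charFun_normalizedSum (hX : ∀ j, IsStdGaussianSeq (P j) (X j) (R j))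
    (hh : MemLp h 2 (gaussianReal 0 1)) (h0 : hermiteCoeff h 0 = 0) {n : ℕ → ℕ} {A B : ℝ}
    (hA0 : 0 < A) (hA : ∀ j, QuadFormLE (R j) A) (hB0 : 0 ≤ B)
    (hB : ∀ j l, |toeplitzMean (fun k => R j k ^ (l + 1)) (n j)| ≤ B)
    (hn : Tendsto n atTop atTop) {v : ℝ}
    (hv : Tendsto (fun j => variance (normalizedSum h (X j) (n j)) (P j)) atTop (𝓝 v)) (t : ℝ) :
    Tendsto (fun j => charFun ((P j).map (normalizedSum h (X j) (n j))) t) atTop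
      (𝓝 (Complex.exp (-((v : ℝ) * t ^ 2 / 2 : ℂ)))) := by
  set H := ∫ x, h x ^ 2 ∂(gaussianReal 0 1) with hH
  have h1 : Tendsto (fun j => Complex.exp
      (-((variance (normalizedSum h (X j) (n j)) (P j) : ℝ) * t ^ 2 / 2 : ℂ))) atTop
      (𝓝 (Complex.exp (-((v : ℝ) * t ^ 2 / 2 : ℂ)))) := by
    have : Continuous fun v : ℝ => Complex.exp (-((v : ℝ) * t ^ 2 / 2 : ℂ)) := by fun_prop
    exact (this.tendsto v).comp hv
  suffices h2 : Tendsto (fun j => charFun ((P j).map (normalizedSum h (X j) (n j))) t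
      - Complex.exp (-((variance (normalizedSum h (X j) (n j)) (P j) : ℝ) * t ^ 2 / 2 : ℂ)))
      atTop (𝓝 0) by
    simpa using h2.add h1
  -- This is the part of the error that does not involve `j`. The order of choices matters: first
  -- `a` is fixed, which determines the approximant and its bound `K`; then `j → ∞` removes the
  -- remaining term, of order `K² / √(n j)`.
  have hD : Tendsto (fun a : ℝ => |t| * √(B * a ^ 2) + t ^ 2 / 2 * (B * (a ^ 2 + a) + a * (B * H)))
      (𝓝[>] 0) (𝓝 0) := by
    have hc : Continuous fun a : ℝ =>
        |t| * √(B * a ^ 2) + t ^ 2 / 2 * (B * (a ^ 2 + a) + a * (B * H)) := by fun_prop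
    have h2 := (hc.tendsto 0).mono_left (nhdsWithin_le_nhds (s := Set.Ioi 0))
    simpa using h2
  rw [Metric.tendsto_nhds]
  intro δ hδ
  obtain ⟨a, haD, ha : 0 < a⟩ := ((hD.eventually_lt_const (half_pos hδ)).and
    self_mem_nhdsWithin).exists
  obtain ⟨K, q, q', k, k', k'', S, hk⟩ :=
    exists_steinData_integral_sq_sub_le hh h0 (show 0 < a ^ 2 by positivity)
  have hN : Tendsto (fun j => t ^ 2 * √(Real.pi ^ 2 / 8 * A * (4 * K ^ 4 * A ^ 2 / n j))) atTop
      (𝓝 0) := by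
    have h3 : Tendsto (fun j => 4 * K ^ 4 * A ^ 2 / (n j : ℝ)) atTop (𝓝 0) :=
      (tendsto_const_div_atTop_nhds_zero_nat _).comp hn
    have h4 := ((h3.const_mul (Real.pi ^ 2 / 8 * A)).sqrt).const_mul (t ^ 2)
    simpa using h4
  filter_upwards [hN.eventually_lt_const (half_pos hδ), hn.eventually_gt_atTop 0] with j hj hj0
  rw [dist_zero_right]
  have h5 := (hX j).norm_charFun_sub_le_of_approx hh h0 S hA0 (hA j) hj0 ha hB0 (hB j) hk t
  have h6 : (1 + a⁻¹) * (B * a ^ 2) = B * (a ^ 2 + a) := by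
    field_simp
  rw [h6] at h5
  linarith

end CentralLimit

/-! ### Measurable modifications of stationary Gaussian processes -/

section Stationary

variable {Ω : Type*} [MeasurableSpace Ω] {P : Measure Ω} {X : ℕ → Ω → ℝ}

namespace IsStandardStationaryGaussian

lemma integral_mul_eq (hX : IsStandardStationaryGaussian P X) (i k : ℕ) :
    ∫ ω, X i ω * X (i + k) ω ∂P = autocorr P X k := by
  have h := ((hX.stationary i).comp (u := fun x : ℕ → ℝ => x 0 * x k) (by fun_prop)).integral_eq
  simpa [Function.comp_def, autocorr, add_comm] using h

lemma integral_mul_eq_natAbs (hX : IsStandardStationaryGaussian P X) (i m : ℕ) :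
    ∫ ω, X i ω * X m ω ∂P = autocorr P X ((i : ℤ) - m).natAbs := by
  rcases le_total i m with h | h
  · obtain ⟨k, rfl⟩ := Nat.exists_eq_add_of_le h
    rw [hX.integral_mul_eq]
    congr 1
    omega
  · obtain ⟨k, rfl⟩ := Nat.exists_eq_add_of_le h
    simp_rw [mul_comm (X (m + k) _)]
    rw [hX.integral_mul_eq]
    congr 1
    omega

lemma autocorr_zero [IsProbabilityMeasure P] (hX : IsStandardStationaryGaussian P X) :
    autocorr P X 0 = 1 := by
  have h := hX.variance_one 0
  rw [variance_eq_sub (hX.gaussian.hasGaussianLaw_eval 0).memLp_two, hX.mean_zero] at h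
  rw [← h, autocorr]
  simp [pow_two]

/-- Gaussianity gives only almost everywhere measurability; measurable modifications change neither
the Gaussian laws nor the moments. -/
lemma exists_isStdGaussianSeq [IsProbabilityMeasure P] (hX : IsStandardStationaryGaussian P X) :
    ∃ Y : ℕ → Ω → ℝ, (∀ i, X i =ᵐ[P] Y i) ∧
      IsStdGaussianSeq P Y (fun k => autocorr P X k.natAbs) := by
  have hm : ∀ i, AEMeasurable (X i) P := fun i =>
    (hX.gaussian.hasGaussianLaw_eval i).memLp_two.aemeasurable
  have he : ∀ i, X i =ᵐ[P] (hm i).mk (X i) := fun i => (hm i).ae_eq_mk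
  refine ⟨fun i => (hm i).mk (X i), he, ?_⟩
  constructor
  · exact fun i => (hm i).measurable_mk
  · exact hX.gaussian.congr he
  · intro i
    rw [← hX.mean_zero i]
    exact integral_congr_ae (he i).symm
  · intro i m
    rw [← hX.integral_mul_eq_natAbs]
    exact integral_congr_ae ((he i).symm.mul (he m).symm)
  · simpa using hX.autocorr_zero

end IsStandardStationaryGaussian

lemma normalizedSum_congr_ae {X Y : ℕ → Ω → ℝ} (h : ℝ → ℝ) (hXY : ∀ i, X i =ᵐ[P] Y i) (n : ℕ) :
    normalizedSum h X n =ᵐ[P] normalizedSum h Y n := by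
  filter_upwards [ae_all_iff.2 hXY] with ω hω
  simp only [normalizedSum, hω]

end Stationary

/-! ### Spectral densities and their trigonometric moments -/

section SpectralDensity

variable {ρ : ℕ → ℝ} {f : ℝ → ℝ}

namespace IsSpectralDensity

lemma aestronglyMeasurable (hf : IsSpectralDensity ρ f) :
    AEStronglyMeasurable f circleMeasure := by
  have := hf.integrable.1
  exact this.aestronglyMeasurable

/-- Negative frequencies follow by complex conjugation, since `f` and `ρ` are real. -/
lemma hasTrigMoments (hf : IsSpectralDensity ρ f) :
    HasTrigMoments f (fun k => ρ k.natAbs) := by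
  have h1 : ∀ k : ℕ, ∫ x, Complex.exp (Complex.I * x * (k : ℕ)) * f x ∂circleMeasure
      = (ρ k : ℂ) := fun k => by
    rw [hf.fourier k, intervalIntegral_eq_circleMeasure]
  intro k
  rcases Int.natAbs_eq k with hk | hk
  · rw [← h1, hk]
    simp
  · have h2 := congrArg (starRingEnd ℂ) (h1 k.natAbs)
    rw [← integral_conj, Complex.conj_ofReal] at h2
    rw [← h2]
    refine integral_congr_ae (ae_of_all _ fun x => ?_)
    simp only [map_mul, Complex.conj_ofReal, ← Complex.exp_conj, Complex.conj_I, Complex.conj_natCast]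
    congr 2
    rw [hk]
    push_cast
    simp

lemma abs_le_zero (hf : IsSpectralDensity ρ f) (k : ℕ) : |ρ k| ≤ ρ 0 := by
  have h0 : (ρ 0 : ℂ) = ((∫ x, f x ∂circleMeasure : ℝ) : ℂ) := by
    rw [hf.fourier 0, intervalIntegral_eq_circleMeasure, ← integral_complex_ofReal]
    simp
  rw [Complex.ofReal_inj] at h0
  have hk := hf.fourier k
  rw [intervalIntegral_eq_circleMeasure] at hk
  rw [← Real.norm_eq_abs, ← Complex.norm_real, hk, h0]
  refine norm_integral_le_of_norm_le hf.integrable.1 ?_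
  filter_upwards [ae_circleMeasure_mem_Ioo] with x hx
  have h1 := norm_character x k
  rw [Int.cast_natCast] at h1
  rw [norm_mul, h1, one_mul, Complex.norm_real, Real.norm_of_nonneg (hf.nonneg x hx)]

end IsSpectralDensity

/-- A periodic function bounded on `(-π, π)` is bounded. -/
lemma exists_abs_le_of_periodic {g : ℝ → ℝ} (hp : Function.Periodic g (2 * Real.pi)) {C : ℝ}
    (hC : ∀ x ∈ Set.Ioo (-Real.pi) Real.pi, |g x| ≤ C) : ∃ C', 0 < C' ∧ ∀ x, |g x| ≤ C' := by
  -- The representative of `x` lies in `(-π, π]`; the endpoint `π`, outside the open interval,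
  -- accounts for `|g π|`, and the `1` for strict positivity.
  refine ⟨|C| + |g Real.pi| + 1, by positivity, fun x => ?_⟩
  obtain ⟨y, hy, hxy⟩ := hp.exists_mem_Ioc (by positivity) x (-Real.pi)
  rw [hxy]
  rw [show -Real.pi + 2 * Real.pi = Real.pi by ring] at hy
  rcases eq_or_lt_of_le hy.2 with h | h
  · rw [h]
    have := abs_nonneg C
    linarith
  · have := hC y ⟨hy.1, h⟩
    have := le_abs_self C
    have := abs_nonneg (g Real.pi)
    linarith

end SpectralDensity

/-! ### Moments of the limiting symbol -/

section Limit

variable {f : ℕ → ℝ → ℝ} {g : ℝ → ℝ} {R : ℕ → ℤ → ℝ} {u : ℕ → ℝ}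

/-- The trigonometric moments of a uniform limit. -/
lemma exists_hasTrigMoments_of_tendsto (hg : IsCircleBounded g)
    (hf : ∀ j, IsCircleBounded (f j)) (hR : ∀ j, HasTrigMoments (f j) (R j))
    (hu : Tendsto u atTop (𝓝 0)) (hfg : ∀ j, ∀ᵐ x ∂circleMeasure, |f j x - g x| ≤ u j)
    (hR1 : ∀ j k, |R j k| ≤ 1) : ∃ r : ℤ → ℝ, HasTrigMoments g r ∧ ∀ k, |r k| ≤ 1 := by
  have hlim : ∀ k : ℤ, Tendsto (fun j => (R j k : ℂ)) atTop
      (𝓝 (∫ x, Complex.exp (Complex.I * x * k) * g x ∂circleMeasure)) := by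
    intro k
    have h : Tendsto (fun j => (R j k : ℂ)
        - ∫ x, Complex.exp (Complex.I * x * k) * g x ∂circleMeasure) atTop (𝓝 0) := by
      refine squeeze_zero_norm (a := fun j => u j * (2 * Real.pi)) (fun j => ?_)
        (by simpa using hu.mul_const (2 * Real.pi))
      rw [← hR j k, ← integral_sub ((hf j).bounded_mul (continuous_character k))
        (hg.bounded_mul (continuous_character k)), ← circleMeasure_real_univ]
      refine norm_integral_le_of_norm_le_const ?_
      filter_upwards [hfg j] with x hx
      rw [← mul_sub, norm_mul, norm_character, one_mul, ← Complex.ofReal_sub, Complex.norm_real]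
      exact hx
    simpa using h.add_const (∫ x, Complex.exp (Complex.I * x * k) * g x ∂circleMeasure)
  have hre := fun k => (Complex.continuous_re.tendsto _).comp (hlim k)
  have him := fun k => (Complex.continuous_im.tendsto _).comp (hlim k)
  -- The moments of `g` are real and at most `1` in modulus as limits of the moments `R j k`.
  refine ⟨fun k => (∫ x, Complex.exp (Complex.I * x * k) * g x ∂circleMeasure).re,
    fun k => ?_, fun k => ?_⟩
  · have h0 : (∫ x, Complex.exp (Complex.I * x * k) * g x ∂circleMeasure).im = 0 :=
      tendsto_nhds_unique (him k) (by simp [Function.comp_def])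
    exact Complex.ext (by simp) (by simpa using h0)
  · exact le_of_tendsto (hre k).abs (Eventually.of_forall fun j => by simpa using hR1 j k)

end Limit

/-! ### Square integrability of `h` and the main theorem -/

section Main

lemma memLp_of_bounded_or_isHermiteCombination {h : ℝ → ℝ} (hm : Measurable h)
    (hh : (∃ C : ℝ, ∀ x, |h x| ≤ C) ∨ IsHermiteCombination h) :
    MemLp h 2 (gaussianReal 0 1) := by
  rcases hh with ⟨C, hC⟩ | ⟨s, a, hs⟩
  · exact MemLp.of_bound hm.aestronglyMeasurable C (ae_of_all _ hC)
  · have : h = fun x => ∑ l ∈ s, a l * (hermiteReal l).eval x := by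
      ext x
      simp_rw [hs, hermiteFun_eq_eval]
    rw [this]
    exact memLp_finsetSum _ fun l _ => (memLp_eval_gaussianReal _).const_mul _

end Main

end GaussianArray

theorem mainTheorem5 {Ω : ℕ → Type*} [∀ j, MeasurableSpace (Ω j)]
    (P : (j : ℕ) → Measure (Ω j)) [∀ j, IsProbabilityMeasure (P j)]
    (X : (j : ℕ) → ℕ → Ω j → ℝ)
    (hX : ∀ j, GaussianArray.IsStandardStationaryGaussian (P j) (X j))
    (f : ℕ → ℝ → ℝ)
    (hf : ∀ j, GaussianArray.IsSpectralDensity (GaussianArray.autocorr (P j) (X j)) (f j))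
    (g : ℝ → ℝ) (hg_per : Function.Periodic g (2 * Real.pi))
    (hg_bdd : ∃ C : ℝ, ∀ x ∈ Set.Ioo (-Real.pi) Real.pi, |g x| ≤ C)
    (hg_cont : ContinuousAt g 0)
    (u : ℕ → ℝ) (hu_anti : Antitone u) (hu_lim : Tendsto u atTop (𝓝 0))
    (hfg : ∀ j, ∀ x ∈ Set.Ioo (-Real.pi) Real.pi, |f j x - g x| ≤ u j)
    (h : ℝ → ℝ) (hh_meas : Measurable h)
    (τ : ℕ) (hτ : 1 ≤ τ) (hh_rank : GaussianArray.HasHermiteRank h τ)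
    (hh : (∃ C : ℝ, ∀ x, |h x| ≤ C) ∨ GaussianArray.IsHermiteCombination h)
    (n : ℕ → ℕ) (hn : Tendsto n atTop atTop) :
    ∃ σsq : ℝ≥0,
      HasSum (fun l : {l : ℕ // τ ≤ l} =>
        2 * Real.pi * ((GaussianArray.hermiteCoeff h l) ^ 2 / (Nat.factorial l : ℝ)
          * GaussianArray.selfConv g l 0)) (σsq : ℝ) ∧
      Tendsto (fun j => variance (GaussianArray.normalizedSum h (X j) (n j)) (P j))
        atTop (𝓝 (σsq : ℝ)) ∧
      TendstoInDistribution (fun j => GaussianArray.normalizedSum h (X j) (n j))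
        atTop (id : ℝ → ℝ) P (gaussianReal 0 σsq) := by
  open GaussianArray in
  have hpi := Real.pi_pos
  have hL := memLp_of_bounded_or_isHermiteCombination hh_meas hh
  have hlow : ∀ l < τ, hermiteCoeff h l = 0 := fun l hl => by
    by_contra hne
    exact absurd (hh_rank.2 hne) (by omega)
  have h0 := hlow 0 hτ
  choose Y hXY hY using fun j => (hX j).exists_isStdGaussianSeq
  set R : ℕ → ℤ → ℝ := fun j k => autocorr (P j) (X j) k.natAbs with hRdef
  have hR : ∀ j, HasTrigMoments (f j) (R j) := fun j => (hf j).hasTrigMoments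
  have hR1 : ∀ j k, |R j k| ≤ 1 := fun j k =>
    ((hf j).abs_le_zero _).trans_eq (hX j).autocorr_zero
  have hu0 : ∀ j, 0 ≤ u j := fun j => (abs_nonneg _).trans (hfg j 0 (by simp [hpi]))
  obtain ⟨C₀, hC₀⟩ := hg_bdd
  obtain ⟨C, hC, hgC⟩ := exists_abs_le_of_periodic hg_per hC₀
  have hfgae : ∀ j, ∀ᵐ x ∂circleMeasure, |f j x - g x| ≤ u j := fun j =>
    ae_circleMeasure_mem_Ioo.mono fun x hx => hfg j x hx
  -- Measurability of `g` is inherited from the spectral densities, which converge to it pointwise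
  -- on `(-π, π)`.
  have hgm : AEStronglyMeasurable g circleMeasure := by
    refine aestronglyMeasurable_of_tendsto_ae atTop (fun j => (hf j).aestronglyMeasurable) ?_
    filter_upwards [ae_circleMeasure_mem_Ioo] with x hx
    exact tendsto_iff_norm_sub_tendsto_zero.2
      (squeeze_zero (fun _ => norm_nonneg _) (fun j => hfg j x hx) hu_lim)
  have hg : IsCircleBounded g := ⟨hgm, C, ae_of_all _ hgC⟩
  have hfC : ∀ j, ∀ᵐ x ∂circleMeasure, |f j x| ≤ C + u 0 := fun j => by
    filter_upwards [hfgae j] with x hx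
    have h1 := hgC x
    have h2 := hu_anti (Nat.zero_le j)
    have h3 := abs_add_le (g x) (f j x - g x)
    rw [add_sub_cancel] at h3
    linarith
  have hfb : ∀ j, IsCircleBounded (f j) := fun j => ⟨(hf j).aestronglyMeasurable, _, hfC j⟩
  obtain ⟨r, hr, hr1⟩ := exists_hasTrigMoments_of_tendsto hg hfb hR hu_lim hfgae hR1
  have hD : 0 < C + u 0 := add_pos_of_pos_of_nonneg hC (hu0 0)
  have hB : ∀ j l, |toeplitzMean (fun k => R j k ^ (l + 1)) (n j)|
      ≤ (C + u 0) * (2 * Real.pi) + ((C + u 0) * (2 * Real.pi)) ^ 2 := fun j l =>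
    (hR j).abs_toeplitzMean_pow_le (hfb j) hD.le (hfC j) (hR1 j) l (n j)
  obtain ⟨σsq, hsum, hvar⟩ := tendsto_variance_normalizedSum hY hL h0 hB
    (S := fun l => 2 * Real.pi * selfConv g l 0) fun l =>
      tendsto_toeplitzMean_pow hg_per hgC hgm hg_cont hr hr1 hfb hR hR1 hu0 hu_lim hfgae hn l
  have hchar := tendsto_charFun_normalizedSum hY hL h0 (A := 2 * Real.pi * (C + u 0))
    (by positivity)
    (fun j => (hR j).quadFormLE (hfb j) ((hfC j).mono fun x hx => (le_abs_self _).trans hx))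
    (by positivity) hB hn hvar
  have hcongr : ∀ j, normalizedSum h (Y j) (n j) =ᵐ[P j] normalizedSum h (X j) (n j) := fun j =>
    (normalizedSum_congr_ae h (hXY j) (n j)).symm
  refine ⟨σsq, ?_, ?_, ?_⟩
  · have h1 : HasSum (fun l : ℕ => 2 * Real.pi * (hermiteCoeff h l ^ 2 / (Nat.factorial l : ℝ)
        * selfConv g l 0)) (σsq : ℝ) := by
      convert! hsum using 2 with l
      ring
    refine (hasSum_subtype_iff_of_support_subset (s := {l | τ ≤ l}) fun l hl => ?_).2 h1
    by_contra hlt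
    refine hl ?_
    simp [hlow l (not_le.1 hlt)]
  · exact hvar.congr fun j => variance_congr (hcongr j)
  · refine TendstoInDistribution.congr hcongr (ae_eq_refl _) ?_
    refine ⟨fun j => (measurable_normalizedSum (hY j).measurable hh_meas (n j)).aemeasurable,
      aemeasurable_id, ?_⟩
    refine ProbabilityMeasure.tendsto_iff_tendsto_charFun.2 fun t => ?_
    simpa [charFun_gaussianReal, Measure.map_id] using hchar t
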